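/- Let $s_0>0$ be real and $a_m=m^{s_0-1}$ for $m\ge 1$. For $|z|<1$ let $Q_n(z)$ be defined by $$P(z,q)=1+\sum_{n\ge 1}Q_n(z)q^n=\prod_{m\ge 1}\frac{1}{(1-zq^m)^{a_m}}\qquad(|q|<1).$$ For $k\ge 1$ and $h\in\mathbb Z$ let $D_{h,k}(s)=\sum_{m\ge1}e^{2\pi i hm/k}a_m m^{-s}$, let $A_{h,k}$ be the residue of (the continuation of) $D_{h,k}$ at $s=s_0$, and define $c(j)=c_k(j)$ by $A_{h,k}=\sum_{j\in\mathbb Z_k}e^{2\pi i hj/k}c(j)$. With $Li_s(z)=\sum_{m\ge1}z^m/m^s$ put $$\Psi_{h,k}(z,w)=\frac{\Gamma(s_0+1)}{s_0w^{s_0}}\sum_{j\in\mathbb Z_k}c(j)\,Li_{s_0+1}(e^{2\pi i hj/k}z),\qquad L_{h,k}(z)=\bigl(w^{s_0}s_0\Psi_{h,k}(z,w)\bigr)^{1/(s_0+1)}$$ (principal root, $\arg\in(-\pi,\pi]$; $L_{h,k}$ does not depend on $w$). Let $D=(-1,1)$ and, for coprime $0<p\le q$, let the phase $R(p,q)$ be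 the set of $x\in D$ such that $\Re L_{p,q}(x)>\Re L_{h,k}(x)$ for all coprime $0<h\le k$ for which $\Re L_{h,k}$ and $\Re L_{p,q}$ are not identical on $D$. Theorem. For every $s_0>0$ there is $x^*=x^*(s_0)\in[-1,0]$ such that $R(1,1)=(0,1)\cup(x^*,0)$ and $R(1,2)=(-1,x^*)$, where for $x\in(-1,1)$ $$L_{1,2}(x)=\tfrac12\bigl(\Gamma(s_0+1)\,Li_{s_0+1}(x^2)\bigr)^{1/(s_0+1)},$$ and such that for every compact $X\subset(-1,x^*)$, uniformly for $x\in X$ as $n\to\infty$, $$Q_n(x)\sim(-1)^n(1-x)^{-B}(1+x)^{-A}\sqrt{\frac{L_{1,2}(x)}{2\pi(s_0+1)n^{\frac{s_0+2}{s_0+1}}}}\;\exp\left(\frac{s_0+1}{s_0}\,n^{\frac{s_0}{s_0+1}}L_{1,2}(x)\right),$$ with $A=\zeta(1-s_0)(1-2^{s_0-1})$ and $B=\zeta(1-s_0)2^{s_0-1}$. Here uniform asymptotic equivalence means that the quotient of the two sides tends to $1$ uniformly on $X$. -/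

import Mathlib

open Filter Topology

noncomputable section

namespace PolyMeinardus

/-- The Euler product `P(z,q) = ∏_{m ≥ 1} (1 - z q^m)^{-a_m}` (principal powers), for `|z|, |q| < 1`. -/
def eulerProduct (a : ℕ → ℝ) (z q : ℂ) : ℂ :=
  ∏' m : ℕ, 1 / (1 - z * q ^ (m + 1)) ^ (a (m + 1) : ℂ)

/-- `Q_n(z)`: the coefficient of `q^n` in the Taylor expansion of `q ↦ P(z,q)` at `q = 0`. -/
def coeffQ (a : ℕ → ℝ) (n : ℕ) (z : ℂ) : ℂ :=
  iteratedDeriv n (fun q : ℂ => eulerProduct a z q) 0 / (n.factorial : ℂ)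

/-- The root of unity `e^{2π i h / k}`. -/
def rootOfUnity (h k : ℕ) : ℂ :=
  Complex.exp (2 * Real.pi * Complex.I * ((h : ℂ) / (k : ℂ)))

/-- The twisted Dirichlet series `D_{h,k}(s) = ∑_{m ≥ 1} e^{2π i h m / k} a_m / m^s`. -/
def twistedDirichlet (a : ℕ → ℝ) (h k : ℕ) (s : ℂ) : ℂ :=
  LSeries (fun m : ℕ => rootOfUnity h k ^ m * (a m : ℂ)) s

/-- The residue `A_{h,k}` of `D_{h,k}` at its (at most simple) pole `s₀`, the abscissa of absolute
convergence, computed as the limit of `(σ - s₀) D_{h,k}(σ)` for real `σ ↓ s₀`. -/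
def residueA (a : ℕ → ℝ) (s₀ : ℝ) (h k : ℕ) : ℂ :=
  limUnder (𝓝[>] s₀) (fun σ : ℝ => ((σ - s₀ : ℝ) : ℂ) * twistedDirichlet a h k (σ : ℂ))

/-- The discrete Fourier coefficients `c(j)` of `h ↦ A_{h,k}`, so that
`A_{h,k} = ∑_{j mod k} e^{2π i h j / k} c(j)`. -/
def fourierC (a : ℕ → ℝ) (s₀ : ℝ) (k j : ℕ) : ℂ :=
  (1 / (k : ℂ)) * ∑ h ∈ Finset.range k, (rootOfUnity (h * j) k)⁻¹ * residueA a s₀ h k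

/-- The polylogarithm `Li_s(z) = ∑_{m ≥ 1} z^m / m^s`, for `|z| < 1`. -/
def polylog (s z : ℂ) : ℂ :=
  ∑' m : ℕ, z ^ (m + 1) / ((m + 1 : ℕ) : ℂ) ^ s

/-- `Ψ_{h,k}(z,w) = Γ(s₀+1) / (s₀ w^{s₀}) ∑_{j mod k} c(j) Li_{s₀+1}(e^{2π i h j / k} z)`. -/
def Psi (a : ℕ → ℝ) (s₀ : ℝ) (h k : ℕ) (z w : ℂ) : ℂ :=
  (Real.Gamma (s₀ + 1) : ℂ) / ((s₀ : ℂ) * w ^ (s₀ : ℂ)) *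
    ∑ j ∈ Finset.range k,
      fourierC a s₀ k j * polylog ((s₀ + 1 : ℝ) : ℂ) (rootOfUnity (h * j) k * z)

/-- `L_{h,k}(z)`, the principal `(s₀+1)`-st root of `w^{s₀} s₀ Ψ_{h,k}(z,w)`. This last quantity does
not depend on `w` in the right half plane, and is taken at `w = 1`. -/
def arcL (a : ℕ → ℝ) (s₀ : ℝ) (h k : ℕ) (z : ℂ) : ℂ :=
  ((s₀ : ℂ) * Psi a s₀ h k z 1) ^ ((1 / (s₀ + 1) : ℝ) : ℂ)

/-- The phase `R(p,q)` relative to the set `D`: the points `z` of `D` at which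
`Re L_{p,q}(z) > Re L_{h,k}(z)` for all coprime `0 < h ≤ k` such that `L_{h,k}` is not in the class
of `L_{p,q}`, i.e. such that `Re L_{h,k}` and `Re L_{p,q}` are not identical on `D`. -/
def phase (a : ℕ → ℝ) (s₀ : ℝ) (D : Set ℂ) (p q : ℕ) : Set ℂ :=
  {z | z ∈ D ∧ ∀ h k : ℕ, 0 < h → h ≤ k → Nat.Coprime h k →
    ¬ (∀ u ∈ D, (arcL a s₀ h k u).re = (arcL a s₀ p q u).re) →
      (arcL a s₀ h k z).re < (arcL a s₀ p q z).re}

/-- The real interval `(-1,1)`, as a subset of the complex plane. -/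
def realDisk : Set ℂ := (fun x : ℝ => (x : ℂ)) '' Set.Ioo (-1) 1

/-- The power function sequence `a_m = m^{s₀-1}`. -/
def powerSeq (s₀ : ℝ) (m : ℕ) : ℝ := (m : ℝ) ^ (s₀ - 1)

/-- `A = ζ(1-s₀) (1 - 2^{s₀-1})`. -/
def expA (s₀ : ℝ) : ℂ := riemannZeta (1 - (s₀ : ℂ)) * (1 - (2 : ℂ) ^ ((s₀ : ℂ) - 1))

/-- `B = ζ(1-s₀) 2^{s₀-1}`. -/
def expB (s₀ : ℝ) : ℂ := riemannZeta (1 - (s₀ : ℂ)) * (2 : ℂ) ^ ((s₀ : ℂ) - 1)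

/-- `½ (Γ(s₀+1) Li_{s₀+1}(x²))^{1/(s₀+1)}`. -/
def explicitL (s₀ x : ℝ) : ℂ :=
  (1 / 2) * ((Real.Gamma (s₀ + 1) : ℂ) * polylog ((s₀ + 1 : ℝ) : ℂ) ((x : ℂ) ^ 2)) ^
    ((1 / (s₀ + 1) : ℝ) : ℂ)

/-- `(-1)^n (1-x)^{-B} (1+x)^{-A} √(L / (2π (s₀+1) n^{(s₀+2)/(s₀+1)}))
  exp(((s₀+1)/s₀) n^{s₀/(s₀+1)} L)` with `L = ½ (Γ(s₀+1) Li_{s₀+1}(x²))^{1/(s₀+1)}`. For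
`-1 < x < 1` all bases of powers here are nonnegative reals. -/
def mainTerm (s₀ : ℝ) (n : ℕ) (x : ℝ) : ℂ :=
  (-1) ^ n * (1 - (x : ℂ)) ^ (-expB s₀) * (1 + (x : ℂ)) ^ (-expA s₀) *
    (explicitL s₀ x /
      (2 * Real.pi * ((s₀ : ℂ) + 1) * (((n : ℝ) ^ ((s₀ + 2) / (s₀ + 1)) : ℝ) : ℂ))) ^ (1 / 2 : ℂ) *
    Complex.exp (((s₀ : ℂ) + 1) / (s₀ : ℂ) * (((n : ℝ) ^ (s₀ / (s₀ + 1)) : ℝ) : ℂ) *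
      explicitL s₀ x)

end PolyMeinardus

end

noncomputable section

namespace PolyMeinardus

open MeasureTheory Set Complex

/-! The proof is the circle method at `q = -1`. Write `s` for `s₀`, `q = e^{-t}` and `φ(t) = ∑
m^{s-1} e^{-mt}`. Expanding logarithms gives `log P(z, e^{-t}) = ∑_k (z^k / k) φ(kt)`, so everything
rests on one analytic fact: `φ` is `2πi`-periodic, and `φ(t) - Γ(s) t^{-s}` tends to `ζ(1-s)` at `0`
and is bounded on the strip `|Im t| ≤ π` and on sectors (`tendsto_phiRem`, `exists_norm_phiRem_le`).
Instead of a Mellin transform, this uses Lipschitz's formula `φ(t) = Γ(s) ∑_k (t + 2πik)^{-s}` for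
`Re s > 1`, continued to `Re s > 0` after subtracting the value at `t = 1`.

Near `q = -1`, with `t = w + πi`, the even `k` contribute singular terms, while those of the odd `k`
cancel by duplication. Hence `log P = Λ(x) w^{-s} - B log(1-x) - A log(1+x) + o(1)` with `Λ(x) =
Γ(s) 2^{-(s+1)} Li_{s+1}(x²)`. Cauchy's formula on the circle of radius `e^{-τ}` with `nτ =
sΛτ^{-s}`, together with Laplace's method, produces the main term.

The rest of the circle must be exponentially smaller. Away from `q = ±1`, the early terms with
`φ(kt)` large all have `k` divisible by a single `d ≥ 3` (`exists_dvd_of_near_multiple`), so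
`3^{-(s+1)}` replaces `2^{-(s+1)}`. Near `q = 1` the coefficient `Γ(s) Li_{s+1}(x)` is negative for
`x < 0`, and `-Re w^{-s}` on `Re w = τ` is at most `κ τ^{-s}` with `κ = max(0, cos(π/(s+1)))^{s+1}`.
The arc at `-1` therefore wins where `κ |Li_{s+1}(x)| < 2^{-(s+1)} Li_{s+1}(x²)`. This is the same
as `Re L_{1,1}(x) < Re L_{1,2}(x)`, because the principal root of a negative number has argument
`π/(s+1)`.

For the phases, only the trivial character has a residue, so `c(j) = 1/k` and `L_{h,k}(x)` is the
principal root of `Γ(s+1) k^{-(s+1)} Li_{s+1}(x^k)`. The arc `k = 1` dominates for `x > 0`, and `k =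
2` beats every `k ≥ 3` for `x < 0`. Between `k = 1` and `k = 2` there is one change of sign at most:
with `y = -x`, `Li_{s+1}(y²)/y` increases strictly and, for `s ≥ 1`, `-Li_{s+1}(-y)/y` does not
increase; for `s ≤ 1` one has `κ = 0` and `x* = 0`. -/

/-! ### The Gamma integral with a complex rate. -/

theorem integrableOn_cpow_mul_exp_neg {a r : ℂ} (ha : 0 < a.re) (hr : 0 < r.re) :
    IntegrableOn (fun x : ℝ => (x : ℂ) ^ (a - 1) * cexp (-(r * x))) (Ioi 0) := by
  have h1 : IntegrableOn (fun x : ℝ => x ^ (a.re - 1) * Real.exp (-(r.re * x))) (Ioi 0) := by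
    -- The integral of a non-integrable function is `0` by convention, so a nonzero value proves
    -- integrability.
    refine Integrable.of_integral_ne_zero ?_
    rw [Real.integral_rpow_mul_exp_neg_mul_Ioi ha hr]
    have := Real.Gamma_pos_of_pos ha
    positivity
  refine Integrable.mono' h1 ?_ ?_
  · refine ContinuousOn.aestronglyMeasurable ?_ measurableSet_Ioi
    intro x hx
    refine ContinuousAt.continuousWithinAt ?_
    refine ContinuousAt.mul ?_ (by fun_prop)
    exact continuousAt_ofReal_cpow_const x _ (Or.inr (ne_of_gt hx))
  · filter_upwards [ae_restrict_mem measurableSet_Ioi] with x hx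
    rw [norm_mul, norm_cpow_eq_rpow_re_of_pos hx, norm_exp]
    simp

/-- Holomorphy in the rate lets the identity theorem carry the formula from positive reals to the
half plane. On the disc of radius `r.re / 2` real parts stay above `r.re / 2`, which supplies the
dominating function. -/
theorem hasDerivAt_integral_cpow_mul_exp_neg {a r : ℂ} (ha : 0 < a.re) (hr : 0 < r.re) :
    HasDerivAt (fun r : ℂ => ∫ x : ℝ in Ioi 0, (x : ℂ) ^ (a - 1) * cexp (-(r * x)))
      (∫ x : ℝ in Ioi 0, (x : ℂ) ^ (a - 1) * (cexp (-(r * x)) * (-x))) r := by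
  have hmeas : ∀ z : ℂ, AEStronglyMeasurable (fun x : ℝ => (x : ℂ) ^ (a - 1) * cexp (-(z * x)))
      (volume.restrict (Ioi 0)) := by
    intro z
    refine ContinuousOn.aestronglyMeasurable ?_ measurableSet_Ioi
    intro x hx
    refine ContinuousAt.continuousWithinAt ?_
    refine ContinuousAt.mul ?_ (by fun_prop)
    exact continuousAt_ofReal_cpow_const x _ (Or.inr (ne_of_gt hx))
  have h1 : IntegrableOn (fun x : ℝ => x ^ (a.re + 1 - 1) * Real.exp (-(r.re / 2 * x))) (Ioi 0) := by
    refine Integrable.of_integral_ne_zero ?_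
    rw [Real.integral_rpow_mul_exp_neg_mul_Ioi (by linarith) (by linarith)]
    have := Real.Gamma_pos_of_pos (show 0 < a.re + 1 by linarith)
    positivity
  refine (hasDerivAt_integral_of_dominated_loc_of_deriv_le
    (bound := fun x : ℝ => x ^ (a.re + 1 - 1) * Real.exp (-(r.re / 2 * x)))
    (F' := fun (r : ℂ) (x : ℝ) => (x : ℂ) ^ (a - 1) * (cexp (-(r * x)) * (-x)))
    (Metric.ball_mem_nhds r (half_pos hr)) (Eventually.of_forall hmeas)
    (integrableOn_cpow_mul_exp_neg ha hr) ?_ ?_ h1 ?_).2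
  · have := (hmeas r).mul
      (show AEStronglyMeasurable (fun x : ℝ => -(x : ℂ)) (volume.restrict (Ioi 0)) from
        (by fun_prop : Continuous (fun x : ℝ => -(x : ℂ))).aestronglyMeasurable)
    refine this.congr (Eventually.of_forall fun x => ?_)
    simp only [Pi.mul_apply]; ring
  · filter_upwards [ae_restrict_mem measurableSet_Ioi] with x hx z hz
    have hx' : (0 : ℝ) < x := hx
    rw [norm_mul, norm_mul, norm_cpow_eq_rpow_re_of_pos hx, norm_exp, norm_neg, norm_real,
      Real.norm_of_nonneg hx'.le]
    have hz' : r.re / 2 ≤ z.re := by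
      have := (abs_re_le_norm (z - r)).trans (mem_ball_iff_norm.1 hz).le
      rw [sub_re, abs_le] at this
      linarith
    have e1 : x ^ (a.re + 1 - 1) = x ^ (a.re - 1) * x := by
      rw [← Real.rpow_add_one hx'.ne']; congr 1; ring
    have e2 : (-(z * (x : ℂ))).re = -(z.re * x) := by simp
    rw [e1, e2, sub_re, one_re, mul_assoc, mul_comm x]
    gcongr
  · filter_upwards with x z hz
    refine HasDerivAt.const_mul _ ?_
    have : HasDerivAt (fun z : ℂ => -(z * x)) (-(x : ℂ)) z := by
      simpa using ((hasDerivAt_id' z).mul_const (x : ℂ)).fun_neg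
    exact this.cexp

/-- `∫_0^∞ x^{a-1} e^{-rx} dx = r^{-a} Γ(a)` for complex `a`, `r` with positive real parts. -/
theorem integral_cpow_mul_exp_neg {a r : ℂ} (ha : 0 < a.re) (hr : 0 < r.re) :
    ∫ x : ℝ in Ioi 0, (x : ℂ) ^ (a - 1) * cexp (-(r * x)) = r ^ (-a) * Complex.Gamma a := by
  have hopen : IsOpen {z : ℂ | 0 < z.re} := isOpen_lt continuous_const continuous_re
  have hconv : IsPreconnected {z : ℂ | 0 < z.re} := (convex_halfSpace_re_gt 0).isPreconnected
  have h1 : AnalyticOnNhd ℂ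
      (fun r : ℂ => ∫ x : ℝ in Ioi 0, (x : ℂ) ^ (a - 1) * cexp (-(r * x))) {z : ℂ | 0 < z.re} :=
    DifferentiableOn.analyticOnNhd (fun z hz =>
      (hasDerivAt_integral_cpow_mul_exp_neg ha hz).differentiableAt.differentiableWithinAt) hopen
  have h2 : AnalyticOnNhd ℂ (fun r : ℂ => r ^ (-a) * Complex.Gamma a) {z : ℂ | 0 < z.re} :=
    DifferentiableOn.analyticOnNhd (fun z hz =>
      ((((hasDerivAt_id z).cpow_const (c := -a) (Or.inl hz)).mul_const
        _).differentiableAt.differentiableWithinAt)) hopen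
  refine h1.eqOn_of_preconnected_of_frequently_eq h2 hconv (z₀ := 1) (by simp) ?_ hr
  -- Positive real rates accumulating at `1`, where the formula is already known.
  have ht : Tendsto (fun n : ℕ => (((1 : ℝ) + 1 / ((n : ℝ) + 1) : ℝ) : ℂ)) atTop (𝓝[≠] 1) := by
    refine tendsto_nhdsWithin_iff.2 ⟨?_, Eventually.of_forall fun n => ?_⟩
    · have := (tendsto_one_div_add_atTop_nhds_zero_nat (𝕜 := ℝ)).const_add 1
      rw [add_zero] at this
      exact (continuous_ofReal.tendsto' 1 1 (by simp)).comp this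
    · have : (0 : ℝ) < 1 / ((n : ℝ) + 1) := by positivity
      simp only [mem_compl_iff, mem_singleton_iff]
      intro h
      have h' := congrArg Complex.re h
      rw [ofReal_re, one_re] at h'
      linarith
  refine ht.frequently (Eventually.frequently (Eventually.of_forall fun n => ?_))
  have hpos : (0 : ℝ) < (1 : ℝ) + 1 / ((n : ℝ) + 1) := by positivity
  generalize (1 : ℝ) + 1 / ((n : ℝ) + 1) = y at hpos ⊢
  rw [Complex.integral_cpow_mul_exp_neg_mul_Ioi ha hpos, one_div, inv_cpow, cpow_neg]
  rw [arg_ofReal_of_nonneg hpos.le]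
  exact Real.pi_pos.ne

/-! ### Lipschitz's formula by Poisson summation. -/

/-- `∑_{m ≥ 1} m^{s-1} e^{-mt}`. -/
def phi (s t : ℂ) : ℂ := ∑' m : ℕ, ((m + 1 : ℕ) : ℂ) ^ (s - 1) * cexp (-(((m + 1 : ℕ) : ℂ) * t))

theorem norm_cpow_le_exp (z s : ℂ) : ‖z ^ s‖ ≤ ‖z‖ ^ s.re * Real.exp (Real.pi * |s.im|) := by
  refine (norm_cpow_le z s).trans ?_
  rw [div_eq_mul_inv, ← Real.exp_neg]
  gcongr
  refine (neg_le_abs _).trans ?_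
  rw [abs_mul]
  gcongr
  exact abs_arg_le_pi z

/-- The integrand of the Poisson summation giving the Lipschitz formula. -/
def lipFun (s t : ℂ) (x : ℝ) : ℂ := if 0 < x then (x : ℂ) ^ (s - 1) * cexp (-(t * x)) else 0

/-- For `Re s > 1` the power vanishes at `0`, so the two branches fit together. Poisson summation
needs this continuity, hence the later continuation in `s`. -/
theorem continuous_lipFun {s : ℂ} (hs : 1 < s.re) (t : ℂ) : Continuous (lipFun s t) := by
  have h0 : 0 < (s - 1).re := by simpa using hs
  have : Continuous fun x : ℝ => (x : ℂ) ^ (s - 1) * cexp (-(t * x)) :=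
    (continuous_ofReal_cpow_const h0).mul (by fun_prop)
  refine Continuous.if (fun a ha => ?_) this continuous_const
  have : frontier {x : ℝ | 0 < x} = {0} := frontier_Ioi
  rw [this] at ha
  rw [ha]
  have : s - 1 ≠ 0 := by intro h; rw [h] at h0; simp at h0
  simp [zero_cpow this]

theorem norm_lipFun (s t : ℂ) {x : ℝ} (hx : 0 < x) :
    ‖lipFun s t x‖ = x ^ (s.re - 1) * Real.exp (-t.re * x) := by
  rw [lipFun, if_pos hx, norm_mul, norm_cpow_eq_rpow_re_of_pos hx, norm_exp]
  simp

theorem lipFun_isBigO (s : ℂ) {t : ℂ} (ht : 0 < t.re) (b : ℝ) :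
    lipFun s t =O[cocompact ℝ] fun x => |x| ^ (-b) := by
  rw [cocompact_eq_atBot_atTop, Asymptotics.isBigO_sup]
  constructor
  · refine Asymptotics.IsBigO.congr' (f₁ := fun _ => (0 : ℂ)) (g₁ := fun x : ℝ => |x| ^ (-b))
      (Asymptotics.isBigO_zero _ _) ?_ (by rfl)
    filter_upwards [eventually_lt_atBot 0] with x hx
    rw [lipFun, if_neg (not_lt.2 hx.le)]
  · have h1 := (isLittleO_exp_neg_mul_rpow_atTop ht (-b - (s.re - 1))).isBigO
    have h2 := (Asymptotics.isBigO_refl (fun x : ℝ => x ^ (s.re - 1)) atTop).mul h1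
    refine (Asymptotics.isBigO_norm_left.1 ?_)
    refine h2.congr' ?_ ?_
    · filter_upwards [eventually_gt_atTop 0] with x hx
      rw [norm_lipFun s t hx]
    · filter_upwards [eventually_gt_atTop 0] with x hx
      rw [← Real.rpow_add hx, abs_of_pos hx]
      congr 1
      ring

/-- The Fourier kernel and `e^{-tx}` merge into one exponential of rate `t + 2πiξ`; this is why
complex rates were needed in the Gamma integral. -/
theorem fourier_lipFun {s t : ℂ} (hs : 0 < s.re) (ht : 0 < t.re) (ξ : ℝ) :
    FourierTransform.fourier (lipFun s t) ξ
      = (t + 2 * Real.pi * I * ξ) ^ (-s) * Complex.Gamma s := by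
  rw [Real.fourier_eq', ← integral_cpow_mul_exp_neg hs (by simpa using ht),
    ← integral_indicator measurableSet_Ioi]
  refine integral_congr_ae (Eventually.of_forall fun x => ?_)
  simp only [indicator, mem_Ioi, lipFun, smul_eq_mul]
  split_ifs with h
  · rw [mul_left_comm, ← Complex.exp_add]
    congr 2
    simp only [RCLike.inner_apply, conj_trivial]
    push_cast
    ring
  · simp

theorem summable_phi {s t : ℂ} (ht : 0 < t.re) :
    Summable fun m : ℕ => ((m + 1 : ℕ) : ℂ) ^ (s - 1) * cexp (-(((m + 1 : ℕ) : ℂ) * t)) := by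
  have h : (fun m : ℕ => ((m : ℕ) : ℂ) ^ (s - 1) * cexp (-(((m : ℕ) : ℂ) * t))) =O[atTop]
      fun m : ℕ => (m : ℝ) ^ (-2 : ℝ) := by
    have h1 := ((lipFun_isBigO s ht 2).mono (le_sup_right.trans cocompact_eq_atBot_atTop.ge)).comp_tendsto
      tendsto_natCast_atTop_atTop
    refine h1.congr' ?_ ?_
    · filter_upwards [eventually_gt_atTop 0] with m hm
      simp only [Function.comp, lipFun]
      rw [if_pos (by exact_mod_cast hm), mul_comm t]
      simp
    · filter_upwards with m
      simp
  have h2 : Summable fun m : ℕ => (m : ℝ) ^ (-2 : ℝ) := Real.summable_nat_rpow.2 (by norm_num)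
  exact (summable_nat_add_iff 1).2 (summable_of_isBigO_nat h2 h)

/-- The Lipschitz summation formula. -/
theorem phi_eq_tsum_int {s t : ℂ} (hs : 1 < s.re) (ht : 0 < t.re) :
    phi s t = Complex.Gamma s * ∑' k : ℤ, (t + 2 * Real.pi * I * k) ^ (-s) := by
  have hF : FourierTransform.fourier (lipFun s t) =O[cocompact ℝ] fun x => |x| ^ (-s.re) := by
    have hfun : FourierTransform.fourier (lipFun s t)
        = fun ξ : ℝ => (t + 2 * Real.pi * I * ξ) ^ (-s) * Complex.Gamma s :=
      funext fun ξ => fourier_lipFun (by linarith) ht ξ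
    rw [hfun]
    refine Asymptotics.IsBigO.of_bound (Real.exp (Real.pi * |s.im|) * ‖Complex.Gamma s‖) ?_
    have hev : ∀ᶠ x : ℝ in cocompact ℝ, |t.im| + 1 ≤ |x| :=
      tendsto_norm_cocompact_atTop.eventually_ge_atTop (|t.im| + 1)
    filter_upwards [hev] with x hx
    have hx0 : 0 < |x| := by have := abs_nonneg t.im; linarith
    have h1 : |x| ≤ ‖t + 2 * Real.pi * I * x‖ := by
      refine le_trans ?_ (abs_im_le_norm _)
      have e : (t + 2 * Real.pi * I * x).im = 2 * Real.pi * x - (- t.im) := by simp; ring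
      rw [e]
      refine le_trans ?_ (abs_sub_abs_le_abs_sub _ _)
      rw [abs_mul, abs_of_pos (by positivity : 0 < 2 * Real.pi), abs_neg]
      nlinarith [Real.pi_gt_three]
    rw [norm_mul, Real.norm_of_nonneg (by positivity)]
    have h2 := norm_cpow_le_exp (t + 2 * Real.pi * I * x) (-s)
    rw [neg_re, neg_im, abs_neg] at h2
    have h3 : ‖t + 2 * Real.pi * I * x‖ ^ (-s.re) ≤ |x| ^ (-s.re) :=
      Real.rpow_le_rpow_of_nonpos hx0 h1 (by linarith)
    calc _ ≤ (|x| ^ (-s.re) * Real.exp (Real.pi * |s.im|)) * ‖Complex.Gamma s‖ := by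
          gcongr
          exact h2.trans (by gcongr)
      _ = _ := by ring
  have key := Real.tsum_eq_tsum_fourier_of_rpow_decay (continuous_lipFun hs t) hs
    (lipFun_isBigO s ht s.re) hF 0
  have h1 : phi s t = ∑' n : ℤ, lipFun s t (0 + n) := by
    have hsupp : Function.support (fun n : ℤ => lipFun s t (0 + n)) ⊆
        range (fun m : ℕ => ((m + 1 : ℕ) : ℤ)) := by
      intro n hn
      by_cases h : 0 < n
      · refine ⟨n.toNat - 1, ?_⟩
        simp only
        omega
      · exfalso
        apply hn
        simp only [lipFun]
        rw [if_neg]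
        rw [zero_add]
        exact_mod_cast h
    have hinj : Function.Injective (fun m : ℕ => ((m + 1 : ℕ) : ℤ)) := by
      intro a b h
      simp only at h
      omega
    rw [← hinj.tsum_eq hsupp, phi]
    refine tsum_congr fun m => ?_
    rw [lipFun, zero_add, if_pos (by push_cast; positivity), mul_comm t]
    simp
  rw [h1, key, ← tsum_mul_left]
  refine tsum_congr fun k => ?_
  rw [fourier_lipFun (by linarith) ht, fourier_coe_apply]
  simp [mul_comm]

/-! ### Continuation to `Re s > 0`, and the behaviour of `φ` at the origin. -/

/-- The rectangle `0 ≤ Re t ≤ 1`, `|Im t| ≤ π`. -/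
def lipRect : Set ℂ := {t | 0 ≤ t.re ∧ t.re ≤ 1 ∧ |t.im| ≤ Real.pi}

theorem convex_lipRect : Convex ℝ lipRect := by
  have h : lipRect = re ⁻¹' Icc 0 1 ∩ im ⁻¹' Icc (-Real.pi) Real.pi := by
    ext t; simp [lipRect, abs_le, and_assoc]
  rw [h]
  exact ((convex_Icc (0 : ℝ) 1).is_linear_preimage reLm.isLinear).inter
    ((convex_Icc (-Real.pi) Real.pi).is_linear_preimage imLm.isLinear)

theorem one_mem_lipRect : (1 : ℂ) ∈ lipRect := by
  simp [lipRect, Real.pi_pos.le]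

theorem zero_mem_lipRect : (0 : ℂ) ∈ lipRect := by
  simp [lipRect, Real.pi_pos.le]

/-- Since `2π|k| - π ≥ |k|` for `k ≠ 0`, the shifted points stay away from the branch cut, uniformly
over the strip. -/
theorem le_abs_im_add {t : ℂ} (ht : |t.im| ≤ Real.pi) {k : ℤ} (hk : k ≠ 0) :
    |(k : ℝ)| ≤ |(t + 2 * Real.pi * I * k).im| := by
  have hk1 : (1 : ℝ) ≤ |(k : ℝ)| := by exact_mod_cast Int.one_le_abs hk
  have e : (t + 2 * Real.pi * I * k).im = 2 * Real.pi * k - (-t.im) := by simp; ring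
  rw [e]
  refine le_trans ?_ (abs_sub_abs_le_abs_sub _ _)
  rw [abs_mul, abs_of_pos (by positivity : 0 < 2 * Real.pi), abs_neg]
  nlinarith [Real.pi_gt_three]

theorem norm_add_cpow_le {s t : ℂ} (ht : |t.im| ≤ Real.pi) (hs : 0 ≤ s.re) {k : ℤ} (hk : k ≠ 0) :
    ‖(t + 2 * Real.pi * I * k) ^ (-s)‖ ≤ Real.exp (Real.pi * |s.im|) * |(k : ℝ)| ^ (-s.re) := by
  have hk0 : 0 < |(k : ℝ)| := by positivity
  have h2 := norm_cpow_le_exp (t + 2 * Real.pi * I * k) (-s)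
  rw [neg_re, neg_im, abs_neg] at h2
  refine h2.trans ?_
  rw [mul_comm]
  refine mul_le_mul_of_nonneg_left ?_ (Real.exp_pos _).le
  exact Real.rpow_le_rpow_of_nonpos hk0 ((le_abs_im_add ht hk).trans (abs_im_le_norm _))
    (by linarith)

theorem summable_add_cpow {s t : ℂ} (ht : |t.im| ≤ Real.pi) (hs : 1 < s.re) :
    Summable fun k : ℤ => (t + 2 * Real.pi * I * k) ^ (-s) := by
  refine Summable.of_norm_bounded_eventually
    (g := fun k : ℤ => Real.exp (Real.pi * |s.im|) * |(k : ℝ)| ^ (-s.re))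
    ((Real.summable_abs_int_rpow hs).mul_left _) ?_
  have : ({0}ᶜ : Set ℤ) ∈ cofinite := (finite_singleton (0 : ℤ)).compl_mem_cofinite
  filter_upwards [this] with k hk
  exact norm_add_cpow_le ht (by linarith) hk

/-- `(t + 2πik)^{-s} - (1 + 2πik)^{-s}` for `k ≠ 0`. -/
def lipTerm (s t : ℂ) (k : ℤ) : ℂ :=
  if k = 0 then 0 else (t + 2 * Real.pi * I * k) ^ (-s) - (1 + 2 * Real.pi * I * k) ^ (-s)

/-- The regularized Lipschitz sum, which converges for `Re s > 0`. -/
def lipTail (s t : ℂ) : ℂ := ∑' k : ℤ, lipTerm s t k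

theorem add_mem_slitPlane {t : ℂ} (ht : |t.im| ≤ Real.pi) {k : ℤ} (hk : k ≠ 0) :
    t + 2 * Real.pi * I * k ∈ slitPlane := by
  refine Or.inr fun h => ?_
  have := le_abs_im_add ht hk
  rw [h, abs_zero] at this
  have hk0 : 0 < |(k : ℝ)| := by positivity
  linarith

/-- The mean value inequality on the convex rectangle gains one power of `|k|`, which makes the
regularized sum converge for all `Re s > 0`. The constant `5` bounds `‖t - 1‖ ≤ 1 + π`. -/
theorem norm_lipTerm_le {s t : ℂ} (hs : 0 ≤ s.re) (ht : t ∈ lipRect) (k : ℤ) :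
    ‖lipTerm s t k‖ ≤ 5 * ‖s‖ * Real.exp (Real.pi * |s.im|) * |(k : ℝ)| ^ (-(s.re + 1)) := by
  rcases eq_or_ne k 0 with rfl | hk
  · simp only [lipTerm, if_true, norm_zero]
    positivity
  rw [lipTerm, if_neg hk]
  have key := convex_lipRect.norm_image_sub_le_of_norm_hasDerivWithin_le
    (f := fun z : ℂ => (z + 2 * Real.pi * I * k) ^ (-s))
    (f' := fun z : ℂ => -s * (z + 2 * Real.pi * I * k) ^ (-s - 1) * 1)
    (C := ‖s‖ * (Real.exp (Real.pi * |s.im|) * |(k : ℝ)| ^ (-(s.re + 1))))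
    (fun z hz => (((hasDerivAt_id' z).add_const _).cpow_const
      (add_mem_slitPlane hz.2.2 hk)).hasDerivWithinAt)
    (fun z hz => by
      rw [mul_one, norm_mul, norm_neg]
      gcongr
      have := norm_add_cpow_le (s := s + 1) hz.2.2 (by simp; linarith) hk
      rw [neg_add'] at this
      simpa using this) one_mem_lipRect ht
  refine key.trans ?_
  have h5 : ‖t - 1‖ ≤ 5 := by
    refine (norm_le_abs_re_add_abs_im _).trans ?_
    have h1 : |(t - 1).re| ≤ 1 := by
      rw [abs_le]; simp only [sub_re, one_re]; constructor <;> linarith [ht.1, ht.2.1]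
    have h2 : |(t - 1).im| ≤ Real.pi := by simpa using ht.2.2
    linarith [Real.pi_lt_four]
  calc _ ≤ ‖s‖ * (Real.exp (Real.pi * |s.im|) * |(k : ℝ)| ^ (-(s.re + 1))) * 5 := by gcongr
    _ = _ := by ring

theorem differentiableAt_lipTail {s t : ℂ} (hs : 0 < s.re) (ht : t ∈ lipRect) :
    DifferentiableAt ℂ (fun s => lipTail s t) s := by
  have hU : IsOpen {z : ℂ | s.re / 2 < z.re ∧ ‖z‖ < ‖s‖ + 1} :=
    (isOpen_lt continuous_const continuous_re).inter (isOpen_lt continuous_norm continuous_const)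
  refine (differentiableOn_tsum_of_summable_norm
    (u := fun k : ℤ => 5 * (‖s‖ + 1) * Real.exp (Real.pi * (‖s‖ + 1)) *
      |(k : ℝ)| ^ (-(s.re / 2 + 1)))
    ((Real.summable_abs_int_rpow (by linarith)).mul_left _) ?_ hU ?_).differentiableAt
      (hU.mem_nhds ⟨by linarith, by linarith⟩)
  · intro k z hz
    refine DifferentiableAt.differentiableWithinAt ?_
    rcases eq_or_ne k 0 with rfl | hk
    · simp [lipTerm]
    · simp only [lipTerm, if_neg hk]
      exact ((differentiableAt_id.neg).const_cpow
          (Or.inl (slitPlane_ne_zero (add_mem_slitPlane ht.2.2 hk)))).sub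
        ((differentiableAt_id.neg).const_cpow
          (Or.inl (slitPlane_ne_zero (add_mem_slitPlane one_mem_lipRect.2.2 hk))))
  · rintro k z ⟨hz1, hz2⟩
    refine (norm_lipTerm_le (by linarith) ht k).trans ?_
    rcases eq_or_ne k 0 with rfl | hk
    -- At `k = 0` both sides vanish, because `0` to a nonzero real power is `0`.
    · rw [Int.cast_zero, abs_zero, Real.zero_rpow (by linarith), Real.zero_rpow (by linarith)]
      simp
    have hk1 : (1 : ℝ) ≤ |(k : ℝ)| := by exact_mod_cast Int.one_le_abs hk
    have := abs_im_le_norm z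
    gcongr
    · linarith

theorem differentiable_phi {t : ℂ} (ht : 0 < t.re) : Differentiable ℂ (fun s => phi s t) := by
  intro s
  have hU : IsOpen {z : ℂ | ‖z‖ < ‖s‖ + 1} := isOpen_lt continuous_norm continuous_const
  refine (differentiableOn_tsum_of_summable_norm
    (u := fun m : ℕ => ‖((m + 1 : ℕ) : ℂ) ^ (((‖s‖ + 1 : ℝ) : ℂ) - 1) *
      cexp (-(((m + 1 : ℕ) : ℂ) * t))‖)
    (summable_phi ht).norm ?_ hU ?_).differentiableAt (hU.mem_nhds (by simp))
  · intro m z _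
    refine DifferentiableAt.differentiableWithinAt ?_
    refine DifferentiableAt.mul_const ?_ _
    exact (differentiableAt_id.sub_const 1).const_cpow (Or.inl (Nat.cast_ne_zero.2 m.succ_ne_zero))
  · intro m z hz
    rw [norm_mul, norm_mul, norm_natCast_cpow_of_pos m.succ_pos, norm_natCast_cpow_of_pos m.succ_pos]
    refine mul_le_mul_of_nonneg_right ?_ (norm_nonneg _)
    refine Real.rpow_le_rpow_of_exponent_le (by simp) ?_
    have h1 := re_le_norm z
    have h2 : ‖z‖ < ‖s‖ + 1 := hz
    simp only [sub_re, one_re, ofReal_re]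
    linarith

/-- Analytic continuation from `Re s > 1` to `Re s > 0`. -/
theorem eq_of_eq_of_one_lt_re {f g : ℂ → ℂ} (hf : ∀ s : ℂ, 0 < s.re → DifferentiableAt ℂ f s)
    (hg : ∀ s : ℂ, 0 < s.re → DifferentiableAt ℂ g s) (h : ∀ s : ℂ, 1 < s.re → f s = g s)
    {s : ℂ} (hs : 0 < s.re) : f s = g s := by
  have hopen : IsOpen {z : ℂ | 0 < z.re} := isOpen_lt continuous_const continuous_re
  have h1 : AnalyticOnNhd ℂ f {z : ℂ | 0 < z.re} :=
    DifferentiableOn.analyticOnNhd (fun z hz => (hf z hz).differentiableWithinAt) hopen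
  have h2 : AnalyticOnNhd ℂ g {z : ℂ | 0 < z.re} :=
    DifferentiableOn.analyticOnNhd (fun z hz => (hg z hz).differentiableWithinAt) hopen
  refine h1.eqOn_of_preconnected_of_eventuallyEq h2 (convex_halfSpace_re_gt 0).isPreconnected
    (z₀ := 2) (by simp) ?_ hs
  filter_upwards [(isOpen_lt continuous_const continuous_re).mem_nhds
    (show (1 : ℝ) < (2 : ℂ).re by norm_num)] with z hz
  exact h z hz

theorem differentiableAt_Gamma_of_re_pos {s : ℂ} (hs : 0 < s.re) :
    DifferentiableAt ℂ Complex.Gamma s := by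
  refine Complex.differentiableAt_Gamma s fun m h => ?_
  rw [h] at hs
  simp only [neg_re, natCast_re] at hs
  have : (0 : ℝ) ≤ m := m.cast_nonneg
  linarith

/-- `∑ m^{s-1} e^{-mt} - Γ(s) t^{-s}`. -/
def phiRem (s t : ℂ) : ℂ := phi s t - Complex.Gamma s * t ^ (-s)

theorem phiRem_eq_of_one_lt_re {s t : ℂ} (hs : 1 < s.re) (ht : |t.im| ≤ Real.pi)
    (ht0 : 0 < t.re) : phiRem s t = Complex.Gamma s *
      ∑' k : ℤ, if k = 0 then 0 else (t + 2 * Real.pi * I * k) ^ (-s) := by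
  rw [phiRem, phi_eq_tsum_int hs ht0, (summable_add_cpow ht hs).tsum_eq_add_tsum_ite 0]
  simp
  ring

theorem summable_ite_add_cpow {s t : ℂ} (ht : |t.im| ≤ Real.pi) (hs : 1 < s.re) :
    Summable fun k : ℤ => if k = 0 then 0 else (t + 2 * Real.pi * I * k) ^ (-s) :=
  Summable.of_norm_bounded (summable_add_cpow ht hs).norm (fun k => by
    split_ifs
    · rw [norm_zero]; exact norm_nonneg _
    · exact le_rfl)

theorem lipTail_eq_sub {s t : ℂ} (hs : 1 < s.re) (ht : |t.im| ≤ Real.pi) :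
    lipTail s t = (∑' k : ℤ, if k = 0 then 0 else (t + 2 * Real.pi * I * k) ^ (-s)) -
      ∑' k : ℤ, if k = 0 then 0 else (1 + 2 * Real.pi * I * k) ^ (-s) := by
  rw [← (summable_ite_add_cpow ht hs).tsum_sub (summable_ite_add_cpow one_mem_lipRect.2.2 hs)]
  refine tsum_congr fun k => ?_
  rw [lipTerm]
  split_ifs <;> simp

/-- For `Re s > 1` the term `k = 0` of Lipschitz's formula is the singular part, and the others at
`t` and at `1` differ by the regularized sum. Both sides are holomorphic on `Re s > 0`, so the
identity persists there. -/
theorem phiRem_eq_lipTail {s t : ℂ} (hs : 0 < s.re) (ht : t ∈ lipRect) (ht0 : 0 < t.re) :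
    phiRem s t = phiRem s 1 + Complex.Gamma s * lipTail s t := by
  have hR : ∀ t : ℂ, 0 < t.re → ∀ s : ℂ, 0 < s.re → DifferentiableAt ℂ (fun s => phiRem s t) s := by
    intro t ht s hs
    refine ((differentiable_phi ht) s).sub ((differentiableAt_Gamma_of_re_pos hs).mul ?_)
    refine differentiableAt_id.neg.const_cpow (Or.inl fun h => ?_)
    rw [h] at ht
    simp at ht
  refine eq_of_eq_of_one_lt_re (f := fun s => phiRem s t)
    (g := fun s => phiRem s 1 + Complex.Gamma s * lipTail s t) (hR t ht0)
    (fun s hs => (hR 1 (by simp) s hs).add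
      ((differentiableAt_Gamma_of_re_pos hs).mul (differentiableAt_lipTail hs ht))) ?_ hs
  intro s hs
  rw [phiRem_eq_of_one_lt_re hs ht.2.2 ht0, phiRem_eq_of_one_lt_re hs one_mem_lipRect.2.2 (by simp),
    lipTail_eq_sub hs ht.2.2]
  ring

theorem cpow_I_add_cpow_neg_I (s : ℂ) : I ^ (-s) + (-I) ^ (-s) = 2 * Complex.cos (Real.pi * s / 2) := by
  rw [cpow_def_of_ne_zero I_ne_zero, cpow_def_of_ne_zero (neg_ne_zero.2 I_ne_zero), log_I, log_neg_I,
    Complex.cos]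
  rw [show (Real.pi : ℂ) / 2 * I * -s = -(Real.pi * s / 2) * I by ring,
    show -(Real.pi / 2 : ℂ) * I * -s = (Real.pi * s / 2) * I by ring]
  ring

theorem ofReal_mul_cpow {r : ℝ} (hr : 0 < r) {z : ℂ} (hz : z ≠ 0) (s : ℂ) :
    ((r : ℂ) * z) ^ s = (r : ℂ) ^ s * z ^ s := by
  have hr' : (r : ℂ) ≠ 0 := ofReal_ne_zero.2 hr.ne'
  rw [cpow_def_of_ne_zero (mul_ne_zero hr' hz), cpow_def_of_ne_zero hr', cpow_def_of_ne_zero hz,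
    log_ofReal_mul hr hz, ofReal_log hr.le, add_mul, Complex.exp_add]

/-- The terms of `k` and `-k` add up to `2 cos(πs/2) (2π|k|)^{-s}`, and the functional equation of
`ζ` evaluates the resulting sum. -/
theorem gamma_mul_tsum_eq_zeta {s : ℂ} (hs : 1 < s.re) :
    Complex.Gamma s * (∑' k : ℤ, if k = 0 then 0 else (0 + 2 * Real.pi * I * k) ^ (-s))
      = riemannZeta (1 - s) := by
  have hsum : Summable fun n : ℕ => 1 / ((n : ℂ) + 1) ^ s := by
    have := (summable_nat_add_iff 1).2 (Complex.summable_one_div_nat_cpow.2 hs)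
    simpa using this
  have hterm : ∀ (n : ℕ) (j : ℂ), j ≠ 0 → (2 * Real.pi * ((n : ℂ) + 1) * j) ^ (-s)
      = (2 * Real.pi) ^ (-s) * (1 / ((n : ℂ) + 1) ^ s) * j ^ (-s) := by
    intro n j hj
    have e : (2 * Real.pi * ((n : ℂ) + 1) * j : ℂ)
        = ((2 * Real.pi * (n + 1) : ℝ) : ℂ) * j := by push_cast; ring
    rw [e, ofReal_mul_cpow (by positivity) hj, ofReal_mul,
      mul_cpow_ofReal_nonneg (by positivity) (by positivity), cpow_neg ((n + 1 : ℝ) : ℂ)]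
    push_cast
    rw [one_div]
  have hpos : ∀ n : ℕ, (if ((n : ℤ) + 1) = 0 then 0 else
      (0 + 2 * Real.pi * I * (((n : ℤ) + 1 : ℤ) : ℂ)) ^ (-s))
      = (2 * Real.pi) ^ (-s) * (1 / ((n : ℂ) + 1) ^ s) * I ^ (-s) := by
    intro n
    rw [if_neg (by positivity), ← hterm n I I_ne_zero]
    congr 1
    push_cast
    ring
  have hneg : ∀ n : ℕ, (if (-((n : ℤ) + 1)) = 0 then 0 else
      (0 + 2 * Real.pi * I * ((-((n : ℤ) + 1) : ℤ) : ℂ)) ^ (-s))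
      = (2 * Real.pi) ^ (-s) * (1 / ((n : ℂ) + 1) ^ s) * (-I) ^ (-s) := by
    intro n
    rw [if_neg (by omega), ← hterm n (-I) (neg_ne_zero.2 I_ne_zero)]
    congr 1
    push_cast
    ring
  rw [tsum_of_add_one_of_neg_add_one]
  · simp_rw [hpos, hneg, tsum_mul_right, tsum_mul_left, ← zeta_eq_tsum_one_div_nat_add_one_cpow hs]
    rw [riemannZeta_one_sub]
    · rw [if_pos trivial]
      linear_combination (Complex.Gamma s * (2 * Real.pi) ^ (-s) * riemannZeta s) *
        cpow_I_add_cpow_neg_I s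
    · intro n h
      rw [h] at hs
      simp only [neg_re, natCast_re] at hs
      have : (0 : ℝ) ≤ n := n.cast_nonneg
      linarith
    · rintro rfl
      simp at hs
  · simp_rw [hpos]
    exact (hsum.mul_left _).mul_right _
  · simp_rw [hneg]
    exact (hsum.mul_left _).mul_right _

/-- Identifies the constant term of `φ` at the origin: it is known for `Re s > 1` from the
functional equation, and both sides are holomorphic on `Re s > 0`, where `1 - s` avoids the pole of
`ζ`. -/
theorem zeta_one_sub_eq_lipTail {s : ℂ} (hs : 0 < s.re) :
    riemannZeta (1 - s) = phiRem s 1 + Complex.Gamma s * lipTail s 0 := by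
  refine eq_of_eq_of_one_lt_re (f := fun s => riemannZeta (1 - s))
    (g := fun s => phiRem s 1 + Complex.Gamma s * lipTail s 0) ?_ ?_ ?_ hs
  · intro s hs
    refine (differentiableAt_riemannZeta ?_).comp s (differentiableAt_id.const_sub 1)
    intro h
    have : s = 0 := by simpa using h
    rw [this] at hs
    simp at hs
  · intro s hs
    refine DifferentiableAt.add ?_ ((differentiableAt_Gamma_of_re_pos hs).mul
      (differentiableAt_lipTail hs zero_mem_lipRect))
    refine ((differentiable_phi (by simp)) s).sub ((differentiableAt_Gamma_of_re_pos hs).mul ?_)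
    exact differentiableAt_id.neg.const_cpow (Or.inl one_ne_zero)
  · intro s hs
    rw [phiRem_eq_of_one_lt_re hs one_mem_lipRect.2.2 (by simp), lipTail_eq_sub hs
      zero_mem_lipRect.2.2, ← gamma_mul_tsum_eq_zeta hs]
    ring

theorem tendsto_lipTail {s : ℂ} (hs : 0 < s.re) :
    Tendsto (lipTail s) (𝓝[lipRect] 0) (𝓝 (lipTail s 0)) := by
  refine tendsto_tsum_of_dominated_convergence (f := fun t k => lipTerm s t k)
    ((Real.summable_abs_int_rpow (show 1 < s.re + 1 by linarith)).mul_left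
      (5 * ‖s‖ * Real.exp (Real.pi * |s.im|))) ?_ ?_
  · intro k
    refine Tendsto.mono_left ?_ nhdsWithin_le_nhds
    rcases eq_or_ne k 0 with rfl | hk
    · simp [lipTerm]
    · simp only [lipTerm, if_neg hk]
      refine Tendsto.sub_const ?_ _
      exact (((continuousAt_id (x := (0 : ℂ))).add_const _).cpow continuousAt_const
        (add_mem_slitPlane zero_mem_lipRect.2.2 hk))
  · filter_upwards [self_mem_nhdsWithin] with t ht k
    exact norm_lipTerm_le hs.le ht k

/-- `∑ m^{s-1} e^{-mt} = Γ(s) t^{-s} + ζ(1-s) + o(1)` as `t → 0` in the right half plane. -/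
theorem tendsto_phiRem {s : ℂ} (hs : 0 < s.re) :
    Tendsto (phiRem s) (𝓝[{t | 0 < t.re}] 0) (𝓝 (riemannZeta (1 - s))) := by
  have hmem : ∀ᶠ t : ℂ in 𝓝[{t | 0 < t.re}] 0, t ∈ lipRect ∧ 0 < t.re := by
    have h1 : ∀ᶠ t : ℂ in 𝓝[{t | 0 < t.re}] 0, ‖t‖ < 1 :=
      nhdsWithin_le_nhds ((isOpen_lt continuous_norm continuous_const).mem_nhds (by simp))
    filter_upwards [h1, self_mem_nhdsWithin] with t ht ht0
    exact ⟨⟨le_of_lt ht0, (re_le_norm t).trans ht.le,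
      ((abs_im_le_norm t).trans ht.le).trans (by linarith [Real.pi_gt_three])⟩, ht0⟩
  have h2 : Tendsto (fun t : ℂ => t) (𝓝[{t | 0 < t.re}] 0) (𝓝[lipRect] 0) :=
    tendsto_nhdsWithin_iff.2 ⟨tendsto_id.mono_left nhdsWithin_le_nhds, hmem.mono fun t ht => ht.1⟩
  rw [zeta_one_sub_eq_lipTail hs]
  refine ((((tendsto_lipTail hs).comp h2).const_mul (Complex.Gamma s)).const_add
    (phiRem s 1)).congr' ?_
  filter_upwards [hmem] with t ht
  rw [phiRem_eq_lipTail hs ht.1 ht.2]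
  rfl

theorem norm_phi_le {s : ℝ} {t : ℂ} {r : ℝ} (hr : 0 < r) (ht : r ≤ t.re) :
    ‖phi s t‖ ≤ ∑' m : ℕ, ((m + 1 : ℕ) : ℝ) ^ (s - 1) * Real.exp (-((m + 1 : ℕ) * r)) := by
  have hsum := (summable_phi (s := (s : ℂ)) (t := (r : ℂ)) (by simpa using hr)).norm
  have e : ∀ (u : ℂ) (m : ℕ), ‖((m + 1 : ℕ) : ℂ) ^ ((s : ℂ) - 1) * cexp (-(((m + 1 : ℕ) : ℂ) * u))‖
      = ((m + 1 : ℕ) : ℝ) ^ (s - 1) * Real.exp (-((m + 1 : ℕ) * u.re)) := by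
    intro u m
    rw [norm_mul, norm_natCast_cpow_of_pos m.succ_pos, norm_exp]
    simp
  refine tsum_of_norm_bounded (f := fun m : ℕ => ((m + 1 : ℕ) : ℂ) ^ ((s : ℂ) - 1) *
    cexp (-(((m + 1 : ℕ) : ℂ) * t))) (Summable.hasSum ?_) ?_
  · refine hsum.congr fun m => ?_
    rw [e]
    simp
  · intro m
    rw [e]
    gcongr

/-- `∑ m^{s-1} e^{-mt} - Γ(s) t^{-s}` is bounded on every region made of the strip `|Im t| ≤ π` and a
sector. -/
theorem exists_norm_phiRem_le {s : ℝ} (hs : 0 < s) (M : ℝ) :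
    ∃ C, ∀ t : ℂ, 0 < t.re → (|t.im| ≤ Real.pi ∨ |t.im| ≤ M * t.re) → ‖phiRem s t‖ ≤ C := by
  have hsre : 0 < (s : ℂ).re := by simpa using hs
  -- Outside the rectangle `Re t` is at least this number: either `Re t > 1`, or `|Im t| > π` and
  -- the sector condition forces `Re t ≥ π/(|M|+1)`.
  set r : ℝ := min 1 (Real.pi / (|M| + 1)) with hr
  have hr0 : 0 < r := lt_min one_pos (by have := Real.pi_pos; positivity)
  set C1 : ℝ := ‖phiRem s 1‖ + ‖Complex.Gamma s‖ * ∑' k : ℤ, 5 * ‖(s : ℂ)‖ *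
    Real.exp (Real.pi * |(s : ℂ).im|) * |(k : ℝ)| ^ (-((s : ℂ).re + 1))
  set C2 : ℝ := (∑' m : ℕ, ((m + 1 : ℕ) : ℝ) ^ (s - 1) * Real.exp (-((m + 1 : ℕ) * r))) +
    ‖Complex.Gamma s‖ * r ^ (-s)
  refine ⟨max C1 C2, fun t ht0 ht => ?_⟩
  by_cases hcase : t ∈ lipRect
  · refine le_trans ?_ (le_max_left _ _)
    rw [phiRem_eq_lipTail hsre hcase ht0]
    refine (norm_add_le _ _).trans ?_
    rw [norm_mul]
    refine add_le_add le_rfl (mul_le_mul_of_nonneg_left ?_ (norm_nonneg _))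
    exact tsum_of_norm_bounded ((Real.summable_abs_int_rpow
      (show 1 < (s : ℂ).re + 1 by linarith)).mul_left _).hasSum (norm_lipTerm_le hsre.le hcase)
  · refine le_trans ?_ (le_max_right _ _)
    have hrt : r ≤ t.re := by
      by_cases h1 : |t.im| ≤ Real.pi
      · by_contra h
        refine hcase ⟨ht0.le, ?_, h1⟩
        linarith [min_le_left 1 (Real.pi / (|M| + 1))]
      · refine (min_le_right _ _).trans ?_
        have h2 := ht.resolve_left h1
        rw [div_le_iff₀ (by positivity)]
        have := le_abs_self M
        nlinarith
    refine (norm_sub_le _ _).trans ?_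
    rw [norm_mul]
    refine add_le_add (norm_phi_le hr0 hrt) (mul_le_mul_of_nonneg_left ?_ (norm_nonneg _))
    · rw [← ofReal_neg, norm_cpow_real]
      exact Real.rpow_le_rpow_of_nonpos hr0 (hrt.trans (re_le_norm t)) (by linarith)

/-! ### The Euler product, its logarithm and Cauchy's formula. -/

theorem powerSeq_nonneg (s : ℝ) (m : ℕ) : 0 ≤ powerSeq s m := Real.rpow_nonneg m.cast_nonneg _

theorem ofReal_powerSeq (s : ℝ) (m : ℕ) : (powerSeq s m : ℂ) = (m : ℂ) ^ ((s : ℂ) - 1) := by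
  rw [powerSeq, ofReal_cpow m.cast_nonneg]
  push_cast
  rfl

theorem summable_powerSeq_mul_pow (s : ℝ) {r : ℝ} (hr0 : 0 < r) (hr : r < 1) :
    Summable fun m : ℕ => powerSeq s (m + 1) * r ^ (m + 1) := by
  have h := (summable_phi (s := (s : ℂ)) (t := ((-Real.log r : ℝ) : ℂ)) (by
    rw [ofReal_re]; linarith [Real.log_neg hr0 hr])).norm
  refine h.congr fun m => ?_
  rw [norm_mul, norm_natCast_cpow_of_pos m.succ_pos, norm_exp, powerSeq]
  congr 1
  rw [show (-(((m + 1 : ℕ) : ℂ) * ((-Real.log r : ℝ) : ℂ))).re = ((m + 1 : ℕ) : ℝ) * Real.log r by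
    rw [← ofReal_natCast, ← ofReal_mul, ← ofReal_neg, ofReal_re]; ring]
  rw [Real.exp_nat_mul, Real.exp_log hr0]

theorem norm_log_one_sub_le {z : ℂ} {r : ℝ} (hr : r < 1) (hz : ‖z‖ ≤ r) :
    ‖Complex.log (1 - z)‖ ≤ ‖z‖ / (1 - r) := by
  have h := Complex.norm_log_one_add_le (z := -z) (by rw [norm_neg]; linarith)
  rw [norm_neg, ← sub_eq_add_neg] at h
  refine h.trans ?_
  have h0 := norm_nonneg z
  have h1 : 0 < 1 - ‖z‖ := by linarith
  calc ‖z‖ ^ 2 * (1 - ‖z‖)⁻¹ / 2 + ‖z‖ ≤ ‖z‖ / (1 - ‖z‖) := by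
        rw [le_div_iff₀ h1]
        have e : (‖z‖ ^ 2 * (1 - ‖z‖)⁻¹ / 2 + ‖z‖) * (1 - ‖z‖) = ‖z‖ ^ 2 / 2 + ‖z‖ * (1 - ‖z‖) := by
          field_simp
        rw [e]
        nlinarith
    _ ≤ ‖z‖ / (1 - r) := by gcongr

/-- The logarithm of the Euler product as a series over the factors. -/
def eulerLog (s : ℝ) (z q : ℂ) : ℂ :=
  ∑' m : ℕ, -((powerSeq s (m + 1) : ℂ) * Complex.log (1 - z * q ^ (m + 1)))

theorem norm_eulerLog_term_le (s : ℝ) {z q : ℂ} {r : ℝ} (hz : ‖z‖ ≤ 1) (hr : r < 1) (hq : ‖q‖ ≤ r)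
    (m : ℕ) : ‖-((powerSeq s (m + 1) : ℂ) * Complex.log (1 - z * q ^ (m + 1)))‖ ≤
      powerSeq s (m + 1) * r ^ (m + 1) * (1 / (1 - r)) := by
  have hr1 : 0 < 1 - r := by linarith
  have hr0 : 0 ≤ r := (norm_nonneg q).trans hq
  have h1 : ‖z * q ^ (m + 1)‖ ≤ r ^ (m + 1) := by
    rw [norm_mul, norm_pow]
    calc ‖z‖ * ‖q‖ ^ (m + 1) ≤ 1 * r ^ (m + 1) := by gcongr
      _ = _ := one_mul _
  have h2 : r ^ (m + 1) ≤ r := pow_le_of_le_one hr0 hr.le m.succ_ne_zero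
  rw [norm_neg, norm_mul, norm_real, Real.norm_of_nonneg (powerSeq_nonneg s _), mul_assoc]
  refine mul_le_mul_of_nonneg_left ?_ (powerSeq_nonneg s _)
  refine (norm_log_one_sub_le hr (h1.trans h2)).trans ?_
  rw [div_eq_mul_one_div]
  gcongr

theorem eulerProduct_eq_exp (s : ℝ) {z q : ℂ} (hz : ‖z‖ ≤ 1) (hq : ‖q‖ < 1) :
    eulerProduct (powerSeq s) z q = cexp (eulerLog s z q) := by
  obtain ⟨r, hr, hr1⟩ := exists_between hq
  have hsum : Summable fun m : ℕ => -((powerSeq s (m + 1) : ℂ) * Complex.log (1 - z * q ^ (m + 1))) :=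
    Summable.of_norm_bounded ((summable_powerSeq_mul_pow s ((norm_nonneg q).trans_lt hr)
      hr1).mul_right _) (norm_eulerLog_term_le s hz hr1 hr.le)
  rw [eulerLog, ← hsum.hasSum.cexp.tprod_eq, eulerProduct]
  refine tprod_congr fun m => ?_
  have hne : 1 - z * q ^ (m + 1) ≠ 0 := by
    intro h
    have h1 : ‖z * q ^ (m + 1)‖ = 1 := by rw [← sub_eq_zero.1 h, norm_one]
    have h2 : ‖z * q ^ (m + 1)‖ < 1 := by
      rw [norm_mul, norm_pow]
      calc ‖z‖ * ‖q‖ ^ (m + 1) ≤ 1 * ‖q‖ ^ (m + 1) := by gcongr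
        _ < 1 := by rw [one_mul]; exact pow_lt_one₀ (norm_nonneg _) hq m.succ_ne_zero
    linarith
  rw [Function.comp, Complex.exp_neg, one_div, cpow_def_of_ne_zero hne, mul_comm]

theorem differentiableOn_eulerProduct (s : ℝ) {z : ℂ} (hz : ‖z‖ ≤ 1) :
    DifferentiableOn ℂ (fun q => eulerProduct (powerSeq s) z q) (Metric.ball 0 1) := by
  intro q hq
  have hq1 : ‖q‖ < 1 := by simpa using hq
  obtain ⟨r, hr, hr1⟩ := exists_between hq1
  refine DifferentiableAt.differentiableWithinAt ?_
  have hball : Metric.ball (0 : ℂ) r ∈ 𝓝 q := Metric.isOpen_ball.mem_nhds (by simpa using hr)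
  have h : DifferentiableOn ℂ (fun q => eulerLog s z q) (Metric.ball 0 r) := by
    refine differentiableOn_tsum_of_summable_norm ((summable_powerSeq_mul_pow s
      ((norm_nonneg q).trans_lt hr) hr1).mul_right (1 / (1 - r))) ?_ Metric.isOpen_ball ?_
    · intro m u hu
      have hu1 : ‖u‖ < r := by simpa using hu
      refine (((differentiableAt_const _).mul (DifferentiableAt.clog ?_ ?_)).neg).differentiableWithinAt
      · fun_prop
      · refine Or.inl ?_
        have h2 : ‖z * u ^ (m + 1)‖ < 1 := by
          rw [norm_mul, norm_pow]
          calc ‖z‖ * ‖u‖ ^ (m + 1) ≤ 1 * ‖u‖ ^ (m + 1) := by gcongr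
            _ < 1 := by
              rw [one_mul]; exact pow_lt_one₀ (norm_nonneg _) (hu1.trans hr1) m.succ_ne_zero
        have := re_le_norm (z * u ^ (m + 1))
        rw [sub_re, one_re]
        linarith
    · intro m u hu
      have hu1 : ‖u‖ < r := by simpa using hu
      exact norm_eulerLog_term_le s hz hr1 hu1.le m
  refine (h.differentiableAt hball).cexp.congr_of_eventuallyEq ?_
  filter_upwards [hball] with u hu
  have hu1 : ‖u‖ < r := by simpa using hu
  exact eulerProduct_eq_exp s hz (hu1.trans hr1)

/-- The logarithm of the Euler product at `q = e^{-t}` as a series in `z`. -/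
def logP (s : ℝ) (z t : ℂ) : ℂ :=
  ∑' k : ℕ, z ^ (k + 1) / ((k + 1 : ℕ) : ℂ) * phi s (((k + 1 : ℕ) : ℂ) * t)

/-- Each logarithm is expanded in its Taylor series and the two sums are exchanged. The double
series is dominated by `a_m |q|^m · |z|^k`, since `|q|^{mk} ≤ |q|^m`. -/
theorem eulerLog_exp_neg (s : ℝ) {z t : ℂ} (hz : ‖z‖ < 1) (ht : 0 < t.re) :
    eulerLog s z (cexp (-t)) = logP s z t := by
  set q : ℂ := cexp (-t) with hq
  have hq0 : 0 < ‖q‖ := norm_pos_iff.2 (Complex.exp_ne_zero _)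
  have hq1 : ‖q‖ < 1 := by rw [hq, norm_exp]; simpa using ht
  set f : ℕ → ℕ → ℂ := fun m k =>
    (powerSeq s (m + 1) : ℂ) * ((z * q ^ (m + 1)) ^ (k + 1) / ((k + 1 : ℕ) : ℂ)) with hf
  have hsum : Summable (Function.uncurry f) := by
    have h1 := summable_powerSeq_mul_pow s hq0 hq1
    have h2 : Summable fun k : ℕ => ‖z‖ ^ (k + 1) :=
      (summable_nat_add_iff 1).2 (summable_geometric_of_lt_one (norm_nonneg z) hz)
    have h3 := h1.mul_of_nonneg h2 (fun m => mul_nonneg (powerSeq_nonneg s _) (by positivity))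
      (fun k => by positivity)
    refine Summable.of_norm_bounded h3 ?_
    rintro ⟨m, k⟩
    simp only [Function.uncurry, hf]
    rw [norm_mul, norm_div, norm_pow, norm_mul, norm_pow, norm_real,
      Real.norm_of_nonneg (powerSeq_nonneg s _), mul_assoc]
    refine mul_le_mul_of_nonneg_left ?_ (powerSeq_nonneg s _)
    rw [norm_natCast]
    have h4 : (1 : ℝ) ≤ ((k + 1 : ℕ) : ℝ) := by simp
    refine (div_le_self (by positivity) h4).trans ?_
    rw [mul_pow, mul_comm]
    refine mul_le_mul_of_nonneg_right ?_ (by positivity)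
    exact pow_le_of_le_one (by positivity) (pow_le_one₀ hq0.le hq1.le) k.succ_ne_zero
  have e1 : eulerLog s z q = ∑' m, ∑' k, f m k := by
    refine tsum_congr fun m => ?_
    have h2 : ‖z * q ^ (m + 1)‖ < 1 := by
      rw [norm_mul, norm_pow]
      calc ‖z‖ * ‖q‖ ^ (m + 1) ≤ ‖z‖ * 1 := by
            gcongr; exact pow_le_one₀ hq0.le hq1.le
        _ < 1 := by rw [mul_one]; exact hz
    have h3 := hasSum_taylorSeries_neg_log h2
    have h4 := (hasSum_nat_add_iff' 1).2 h3
    simp only [Finset.range_one, Finset.sum_singleton, pow_zero, Nat.cast_zero, div_zero,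
      sub_zero] at h4
    rw [tsum_mul_left, h4.tsum_eq]
    ring
  have e2 : logP s z t = ∑' k, ∑' m, f m k := by
    refine tsum_congr fun k => ?_
    rw [phi, ← tsum_mul_left]
    refine tsum_congr fun m => ?_
    simp only [hf]
    rw [ofReal_powerSeq, hq, mul_pow, ← pow_mul, ← Complex.exp_nat_mul]
    rw [show ((((m + 1) * (k + 1) : ℕ) : ℂ)) * -t = -(((m + 1 : ℕ) : ℂ) * (((k + 1 : ℕ) : ℂ) * t)) by
      push_cast; ring]
    ring
  rw [e1, e2, hsum.tsum_comm]

theorem eulerProduct_exp_neg (s : ℝ) {z t : ℂ} (hz : ‖z‖ < 1) (ht : 0 < t.re) :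
    eulerProduct (powerSeq s) z (cexp (-t)) = cexp (logP s z t) := by
  rw [eulerProduct_eq_exp s hz.le (by rw [norm_exp]; simpa using ht), eulerLog_exp_neg s hz ht]

/-- Cauchy's formula for the coefficients, on the circle of radius `e^{-τ}`. -/
theorem coeffQ_eq_integral (s : ℝ) (n : ℕ) {z : ℂ} (hz : ‖z‖ < 1) {τ : ℝ} (hτ : 0 < τ) :
    coeffQ (powerSeq s) n z = (-1) ^ n / (2 * Real.pi) * ∫ ϑ in (-Real.pi)..Real.pi,
      cexp (n * (τ - I * ϑ) + logP s z (τ - I * ϑ + Real.pi * I)) := by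
  have hr0 : 0 < Real.exp (-τ) := Real.exp_pos _
  have hr1 : Real.exp (-τ) < 1 := by simpa using hτ
  have hC := DifferentiableOn.circleIntegral_one_div_sub_center_pow_smul (c := 0) hr0 n
    ((differentiableOn_eulerProduct s hz.le).mono (Metric.closedBall_subset_ball hr1))
  have hpi : (2 * Real.pi * I : ℂ) ≠ 0 := by simp [Real.pi_ne_zero, I_ne_zero]
  have hfac : (n.factorial : ℂ) ≠ 0 := Nat.cast_ne_zero.2 n.factorial_ne_zero
  have h1 : coeffQ (powerSeq s) n z = (2 * Real.pi * I : ℂ)⁻¹ *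
      ∮ w in C(0, Real.exp (-τ)), (1 / (w - 0) ^ (n + 1)) • eulerProduct (powerSeq s) z w := by
    rw [hC, coeffQ, smul_eq_mul]
    field_simp
  set g : ℝ → ℂ := fun θ => deriv (circleMap 0 (Real.exp (-τ))) θ •
    ((1 / (circleMap 0 (Real.exp (-τ)) θ - 0) ^ (n + 1)) •
      eulerProduct (powerSeq s) z (circleMap 0 (Real.exp (-τ)) θ)) with hg
  -- Angles are counted from the point `-1`, so that the dominant arc is centred at `ϑ = 0`.
  have h2 : ∫ θ in (0 : ℝ)..(2 * Real.pi), g θ = ∫ ϑ in (-Real.pi)..Real.pi, g (ϑ + Real.pi) := by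
    rw [intervalIntegral.integral_comp_add_right]
    congr 1 <;> ring
  rw [h1, circleIntegral, h2, ← intervalIntegral.integral_const_mul,
    ← intervalIntegral.integral_const_mul]
  refine intervalIntegral.integral_congr fun ϑ _ => ?_
  set t : ℂ := τ - I * ϑ + Real.pi * I with ht
  have htre : 0 < t.re := by simpa [ht] using hτ
  have hcm : circleMap 0 (Real.exp (-τ)) (ϑ + Real.pi) = cexp (-t) := by
    rw [circleMap_zero, ofReal_exp, ← Complex.exp_add, Complex.exp_eq_exp_iff_exists_int]
    -- The angles `ϑ + π` and `ϑ - π` differ by one full turn.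
    refine ⟨1, ?_⟩
    rw [ht]
    push_cast
    ring
  simp only [hg, deriv_circleMap, hcm, smul_eq_mul, sub_zero]
  rw [eulerProduct_exp_neg s hz htre, Complex.exp_add, Complex.exp_neg]
  have hexp : cexp (n * (τ - I * ϑ)) * (-1) ^ n = cexp t ^ n := by
    rw [ht, Complex.exp_add, Complex.exp_pi_mul_I, mul_pow, ← Complex.exp_nat_mul]
  have hne := Complex.exp_ne_zero t
  have hne' : cexp t ^ n ≠ 0 := pow_ne_zero _ hne
  calc _ = (2 * Real.pi * I)⁻¹ * I * (cexp t ^ n * cexp (logP s z t)) := by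
        rw [inv_pow, one_div, inv_inv, pow_succ]
        field_simp
    _ = (2 * Real.pi * I)⁻¹ * I * ((cexp (n * (τ - I * ϑ)) * (-1) ^ n) * cexp (logP s z t)) := by
        rw [hexp]
    _ = _ := by
        field_simp

/-! ### The logarithm of the product near `q = 1` and `q = -1`. -/

theorem cpow_add_one_eq (x y : ℂ) (hx : x ≠ 0) : x ^ (y + 1) = x ^ y * x := by
  rw [cpow_add _ _ hx, cpow_one]

theorem natCast_mul_cpow_neg {k : ℕ} (hk : k ≠ 0) {w : ℂ} (hw : w ≠ 0) (s : ℂ) :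
    ((k : ℂ) * w) ^ (-s) = (k : ℂ) ^ (-s) * w ^ (-s) := by
  have := ofReal_mul_cpow (r := (k : ℝ)) (by positivity) hw (-s)
  simpa using this

theorem ne_zero_of_re_pos' {w : ℂ} (hw : 0 < w.re) : w ≠ 0 := by
  rintro rfl
  simp at hw

theorem phi_add_two_pi (s t : ℂ) (h : ℤ) : phi s (t - 2 * Real.pi * I * h) = phi s t := by
  refine tsum_congr fun m => ?_
  congr 1
  rw [Complex.exp_eq_exp_iff_exists_int]
  refine ⟨(m + 1) * h, ?_⟩
  push_cast
  ring

theorem phi_nat_mul_add_two_pi (s t : ℂ) (k : ℕ) : phi s (t + k * (2 * Real.pi * I)) = phi s t := by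
  have := phi_add_two_pi s t (-k)
  rw [← this]
  congr 1
  push_cast
  ring

/-- The duplication formula `φ(-q) = 2^s φ(q²) - φ(q)`. -/
theorem phi_add_pi (s : ℂ) {t : ℂ} (ht : 0 < t.re) :
    phi s (t + Real.pi * I) = 2 ^ s * phi s (2 * t) - phi s t := by
  set f : ℕ → ℂ := fun m => ((m + 1 : ℕ) : ℂ) ^ (s - 1) * cexp (-(((m + 1 : ℕ) : ℂ) * t)) with hf
  have hfs : Summable f := summable_phi ht
  have hg : ∀ m : ℕ, ((m + 1 : ℕ) : ℂ) ^ (s - 1) * cexp (-(((m + 1 : ℕ) : ℂ) * (t + Real.pi * I)))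
      = (-1) ^ (m + 1) * f m := by
    intro m
    rw [hf, mul_add, neg_add, Complex.exp_add]
    have : cexp (-(((m + 1 : ℕ) : ℂ) * (Real.pi * I))) = (-1) ^ (m + 1) := by
      rw [Complex.exp_neg, Complex.exp_nat_mul, Complex.exp_pi_mul_I, ← inv_pow]
      norm_num
    rw [this]
    ring
  have h1 : phi s (t + Real.pi * I) + phi s t = ∑' m : ℕ, ((-1) ^ (m + 1) * f m + f m) := by
    rw [Summable.tsum_add _ hfs]
    · congr 1
      exact tsum_congr hg
    · refine Summable.of_norm_bounded hfs.norm fun m => ?_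
      simp
  have h2 : ∑' m : ℕ, ((-1) ^ (m + 1) * f m + f m) = 2 ^ s * phi s (2 * t) := by
    have hinj : Function.Injective (fun j : ℕ => 2 * j + 1) := by
      intro a b h
      simp only at h
      omega
    have hsupp : Function.support (fun m : ℕ => (-1) ^ (m + 1) * f m + f m) ⊆
        range (fun j : ℕ => 2 * j + 1) := by
      intro m hm
      rcases Nat.even_or_odd m with he | ho
      · exfalso
        apply hm
        simp only
        rw [he.add_one.neg_one_pow]
        ring
      · obtain ⟨j, rfl⟩ := ho
        exact ⟨j, rfl⟩
    rw [← hinj.tsum_eq hsupp, phi, ← tsum_mul_left]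
    refine tsum_congr fun j => ?_
    have e1 : ((2 * j + 1 + 1 : ℕ) : ℂ) = ((2 : ℕ) : ℂ) * ((j + 1 : ℕ) : ℂ) := by push_cast; ring
    have e2 : (-1 : ℂ) ^ (2 * j + 1 + 1) = 1 := Even.neg_one_pow ⟨j + 1, by ring⟩
    simp only [hf]
    rw [e1, e2, natCast_mul_natCast_cpow]
    have e3 : (2 : ℂ) ^ s = ((2 : ℕ) : ℂ) ^ (s - 1) * 2 := by
      rw [Nat.cast_ofNat, ← cpow_add_one_eq _ _ two_ne_zero, sub_add_cancel]
    rw [e3]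
    rw [show -(((2 : ℕ) : ℂ) * ((j + 1 : ℕ) : ℂ) * t) = -(((j + 1 : ℕ) : ℂ) * (2 * t)) by
      push_cast; ring]
    ring
  rw [← h2, ← h1]
  ring

/-- The remainder of `φ(e^{-k(w + πi)})`. -/
def altRem (s : ℂ) (k : ℕ) (w : ℂ) : ℂ :=
  if Even k then phiRem s (k * w) else 2 ^ s * phiRem s (2 * (k * w)) - phiRem s (k * w)

/-- For even `k` the shift `kπi` is a period, and the singularity of `φ(kw)` survives. For odd `k`
the duplication formula applies, and the singular parts of `2^s φ(2kw)` and `φ(kw)` cancel. -/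
theorem phi_mul_add_pi (s : ℂ) {k : ℕ} (hk : k ≠ 0) {w : ℂ} (hw : 0 < w.re) :
    phi s (k * (w + Real.pi * I)) =
      (if Even k then Complex.Gamma s * (k : ℂ) ^ (-s) * w ^ (-s) else 0) + altRem s k w := by
  have hk' : (0 : ℝ) < k := by positivity
  have hkw : 0 < ((k : ℂ) * w).re := by simpa using mul_pos hk' hw
  have hw0 := ne_zero_of_re_pos' hw
  rcases Nat.even_or_odd k with he | ho
  · rw [if_pos he, altRem, if_pos he, phiRem, natCast_mul_cpow_neg hk hw0]
    obtain ⟨j, rfl⟩ := he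
    rw [show (((j + j : ℕ) : ℂ)) * (w + Real.pi * I) = ((j + j : ℕ) : ℂ) * w + j * (2 * Real.pi * I) by
      push_cast; ring, phi_nat_mul_add_two_pi]
    ring
  · have hne : ¬ Even k := Nat.not_even_iff_odd.2 ho
    rw [if_neg hne, altRem, if_neg hne, zero_add, phiRem, phiRem]
    have h2 := natCast_mul_cpow_neg two_ne_zero (ne_zero_of_re_pos' hkw) s
    rw [Nat.cast_ofNat] at h2
    have e : phi s (k * (w + Real.pi * I)) = phi s (k * w + Real.pi * I) := by
      obtain ⟨j, rfl⟩ := ho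
      rw [← phi_nat_mul_add_two_pi s (((2 * j + 1 : ℕ) : ℂ) * w + Real.pi * I) j]
      congr 1
      push_cast
      ring
    rw [e, phi_add_pi s hkw, h2, cpow_neg 2 s]
    have : (2 : ℂ) ^ s ≠ 0 := by simp [cpow_eq_zero_iff]
    field_simp
    ring

theorem norm_pow_div_le {z : ℂ} {ρ : ℝ} (hz : ‖z‖ ≤ ρ) (k : ℕ) :
    ‖z ^ (k + 1) / ((k + 1 : ℕ) : ℂ)‖ ≤ ρ ^ (k + 1) := by
  rw [norm_div, norm_pow, norm_natCast]
  have h4 : (1 : ℝ) ≤ ((k + 1 : ℕ) : ℝ) := by simp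
  exact (div_le_self (by positivity) h4).trans (by gcongr)

theorem summable_geometric_succ {ρ : ℝ} (h0 : 0 ≤ ρ) (h1 : ρ < 1) :
    Summable fun k : ℕ => ρ ^ (k + 1) :=
  (summable_nat_add_iff 1).2 (summable_geometric_of_lt_one h0 h1)

theorem summable_polylog {s : ℝ} (hs : 0 < s) {z : ℂ} (hz : ‖z‖ < 1) :
    Summable fun m : ℕ => z ^ (m + 1) / ((m + 1 : ℕ) : ℂ) ^ ((s + 1 : ℝ) : ℂ) := by
  refine Summable.of_norm_bounded (summable_geometric_succ (norm_nonneg z) hz) fun m => ?_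
  rw [norm_div, norm_pow, norm_natCast_cpow_of_pos m.succ_pos, ofReal_re]
  exact div_le_self (by positivity) (Real.one_le_rpow (by simp) (by linarith))

theorem natCast_cpow_neg_div {k : ℕ} (hk : k ≠ 0) (s : ℝ) (z : ℂ) :
    z / (k : ℂ) * (k : ℂ) ^ (-(s : ℂ)) = z / (k : ℂ) ^ ((s + 1 : ℝ) : ℂ) := by
  have hk' : (k : ℂ) ≠ 0 := Nat.cast_ne_zero.2 hk
  rw [cpow_neg, ofReal_add, ofReal_one, cpow_add_one_eq _ _ hk']
  field_simp

theorem logP_sub_eq {s : ℝ} (hs : 0 < s) {z w : ℂ} (hz : ‖z‖ < 1) (hw : 0 < w.re)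
    (hsum : Summable fun k : ℕ => z ^ (k + 1) / ((k + 1 : ℕ) : ℂ) * phiRem s (((k + 1 : ℕ) : ℂ) * w)) :
    logP s z w = Complex.Gamma s * polylog ((s + 1 : ℝ) : ℂ) z * w ^ (-(s : ℂ)) +
      ∑' k : ℕ, z ^ (k + 1) / ((k + 1 : ℕ) : ℂ) * phiRem s (((k + 1 : ℕ) : ℂ) * w) := by
  rw [mul_right_comm, polylog, ← tsum_mul_left, ← ((summable_polylog hs hz).mul_left _).tsum_add hsum]
  refine tsum_congr fun k => ?_
  rw [← natCast_cpow_neg_div k.succ_ne_zero, phiRem,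
    natCast_mul_cpow_neg k.succ_ne_zero (ne_zero_of_re_pos' hw)]
  ring

/-- A sector, unlike a strip, is stable under multiplication by `k`; so a single bound for the
remainder of `φ` serves all the points `kw`. -/
theorem sector_nat_mul {M : ℝ} {w : ℂ} (hM : |w.im| ≤ M * w.re) (k : ℕ) :
    |(((k : ℕ) : ℂ) * w).im| ≤ M * (((k : ℕ) : ℂ) * w).re := by
  have e1 : (((k : ℕ) : ℂ) * w).im = k * w.im := by simp
  have e2 : (((k : ℕ) : ℂ) * w).re = k * w.re := by simp
  rw [e1, e2, abs_mul, Nat.abs_cast]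
  have : (0 : ℝ) ≤ k := k.cast_nonneg
  nlinarith

theorem nat_mul_re_pos {w : ℂ} (hw : 0 < w.re) {k : ℕ} (hk : k ≠ 0) : 0 < ((k : ℂ) * w).re := by
  have : (0 : ℝ) < k := by positivity
  simpa using mul_pos this hw

/-- The behaviour of `log P` near `q = 1`. -/
theorem exists_norm_logP_sub_le {s : ℝ} (hs : 0 < s) {ρ : ℝ} (hρ0 : 0 ≤ ρ) (hρ : ρ < 1) (M : ℝ) :
    ∃ C, ∀ z w : ℂ, ‖z‖ ≤ ρ → 0 < w.re → |w.im| ≤ M * w.re →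
      ‖logP s z w - Complex.Gamma s * polylog ((s + 1 : ℝ) : ℂ) z * w ^ (-(s : ℂ))‖ ≤ C := by
  obtain ⟨C, hC⟩ := exists_norm_phiRem_le hs M
  refine ⟨∑' k : ℕ, ρ ^ (k + 1) * C, fun z w hz hw hM => ?_⟩
  have hb : ∀ k : ℕ, ‖z ^ (k + 1) / ((k + 1 : ℕ) : ℂ) * phiRem s (((k + 1 : ℕ) : ℂ) * w)‖ ≤
      ρ ^ (k + 1) * C := by
    intro k
    rw [norm_mul]
    exact mul_le_mul (norm_pow_div_le hz k) (hC _ (nat_mul_re_pos hw k.succ_ne_zero)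
      (Or.inr (sector_nat_mul hM _))) (norm_nonneg _) (by positivity)
  have hsum := (summable_geometric_succ hρ0 hρ).mul_right C
  rw [logP_sub_eq hs (hz.trans_lt hρ) hw (Summable.of_norm_bounded hsum hb), add_sub_cancel_left]
  exact tsum_of_norm_bounded hsum.hasSum hb

theorem tsum_even_polylog {s : ℝ} (z : ℂ) :
    (∑' k : ℕ, if Even (k + 1) then z ^ (k + 1) / ((k + 1 : ℕ) : ℂ) ^ ((s + 1 : ℝ) : ℂ) else 0)
      = (2 : ℂ) ^ (-((s + 1 : ℝ) : ℂ)) * polylog ((s + 1 : ℝ) : ℂ) (z ^ 2) := by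
  have hinj : Function.Injective (fun j : ℕ => 2 * j + 1) := by
    intro a b h
    simp only at h
    omega
  have hsupp : Function.support (fun k : ℕ => if Even (k + 1) then
      z ^ (k + 1) / ((k + 1 : ℕ) : ℂ) ^ ((s + 1 : ℝ) : ℂ) else 0) ⊆ range (fun j : ℕ => 2 * j + 1) := by
    intro m hm
    rcases Nat.even_or_odd m with he | ho
    · exfalso
      apply hm
      simp only
      rw [if_neg (Nat.not_even_iff_odd.2 he.add_one)]
    · obtain ⟨j, rfl⟩ := ho
      exact ⟨j, rfl⟩
  rw [← hinj.tsum_eq hsupp, polylog, ← tsum_mul_left]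
  refine tsum_congr fun j => ?_
  rw [if_pos ⟨j + 1, by ring⟩, show 2 * j + 1 + 1 = 2 * (j + 1) by ring, pow_mul, Nat.cast_mul,
    natCast_mul_natCast_cpow, cpow_neg, Nat.cast_ofNat]
  rw [div_eq_mul_inv, mul_inv]
  ring

theorem logP_add_pi_eq {s : ℝ} (hs : 0 < s) {z w : ℂ} (hz : ‖z‖ < 1) (hw : 0 < w.re)
    (hsum : Summable fun k : ℕ => z ^ (k + 1) / ((k + 1 : ℕ) : ℂ) * altRem s (k + 1) w) :
    logP s z (w + Real.pi * I) =
      Complex.Gamma s * (2 : ℂ) ^ (-((s + 1 : ℝ) : ℂ)) * polylog ((s + 1 : ℝ) : ℂ) (z ^ 2) *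
        w ^ (-(s : ℂ)) +
      ∑' k : ℕ, z ^ (k + 1) / ((k + 1 : ℕ) : ℂ) * altRem s (k + 1) w := by
  have hs2 : Summable (fun k : ℕ => if Even (k + 1) then
      z ^ (k + 1) / ((k + 1 : ℕ) : ℂ) ^ ((s + 1 : ℝ) : ℂ) else 0) := by
    refine Summable.of_norm_bounded (summable_polylog hs hz).norm fun k => ?_
    split_ifs
    · exact le_rfl
    · rw [norm_zero]; exact norm_nonneg _
  rw [mul_assoc (Complex.Gamma s), ← tsum_even_polylog, mul_right_comm, ← tsum_mul_left,
    ← (hs2.mul_left _).tsum_add hsum]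
  refine tsum_congr fun k => ?_
  rw [phi_mul_add_pi (s : ℂ) k.succ_ne_zero hw]
  split_ifs
  · rw [← natCast_cpow_neg_div k.succ_ne_zero]
    ring
  · ring

theorem exists_norm_altRem_le {s : ℝ} (hs : 0 < s) (M : ℝ) :
    ∃ C, ∀ (k : ℕ) (w : ℂ), k ≠ 0 → 0 < w.re → |w.im| ≤ M * w.re → ‖altRem s k w‖ ≤ C := by
  obtain ⟨C, hC⟩ := exists_norm_phiRem_le hs M
  refine ⟨‖(2 : ℂ) ^ (s : ℂ)‖ * C + C, fun k w hk hw hM => ?_⟩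
  have h1 := hC _ (nat_mul_re_pos hw hk) (Or.inr (sector_nat_mul hM k))
  have h2 := hC _ (nat_mul_re_pos (nat_mul_re_pos hw hk) two_ne_zero)
    (Or.inr (sector_nat_mul (sector_nat_mul hM k) 2))
  rw [Nat.cast_ofNat] at h2
  have h0 : 0 ≤ C := (norm_nonneg _).trans h1
  rw [altRem]
  split_ifs
  · have : 0 ≤ ‖(2 : ℂ) ^ (s : ℂ)‖ * C := by positivity
    linarith
  · refine (norm_sub_le _ _).trans (add_le_add ?_ h1)
    rw [norm_mul]
    gcongr

/-- The behaviour of `log P` near `q = -1`, in any sector. -/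
theorem exists_norm_logP_add_pi_sub_le {s : ℝ} (hs : 0 < s) {ρ : ℝ} (hρ0 : 0 ≤ ρ) (hρ : ρ < 1)
    (M : ℝ) : ∃ C, ∀ z w : ℂ, ‖z‖ ≤ ρ → 0 < w.re → |w.im| ≤ M * w.re →
      ‖logP s z (w + Real.pi * I) - Complex.Gamma s * (2 : ℂ) ^ (-((s + 1 : ℝ) : ℂ)) *
        polylog ((s + 1 : ℝ) : ℂ) (z ^ 2) * w ^ (-(s : ℂ))‖ ≤ C := by
  obtain ⟨C, hC⟩ := exists_norm_altRem_le hs M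
  refine ⟨∑' k : ℕ, ρ ^ (k + 1) * C, fun z w hz hw hM => ?_⟩
  have hb : ∀ k : ℕ, ‖z ^ (k + 1) / ((k + 1 : ℕ) : ℂ) * altRem s (k + 1) w‖ ≤ ρ ^ (k + 1) * C := by
    intro k
    rw [norm_mul]
    exact mul_le_mul (norm_pow_div_le hz k) (hC _ _ k.succ_ne_zero hw hM) (norm_nonneg _)
      (by positivity)
  have hsum := (summable_geometric_succ hρ0 hρ).mul_right C
  rw [logP_add_pi_eq hs (hz.trans_lt hρ) hw (Summable.of_norm_bounded hsum hb), add_sub_cancel_left]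
  exact tsum_of_norm_bounded hsum.hasSum hb

/-- The limit is `ζ(1-s) = B + A` for even `k` and `(2^s - 1) ζ(1-s) = B - A` for odd `k`. -/
theorem tendsto_altRem {s : ℝ} (hs : 0 < s) {k : ℕ} (hk : k ≠ 0) :
    Tendsto (altRem s k) (𝓝[{t | 0 < t.re}] 0) (𝓝 (expB s + (-1) ^ k * expA s)) := by
  have hR := tendsto_phiRem (s := (s : ℂ)) (by simpa using hs)
  have hmul : ∀ j : ℕ, j ≠ 0 →
      Tendsto (fun w : ℂ => (j : ℂ) * w) (𝓝[{t | 0 < t.re}] 0) (𝓝[{t | 0 < t.re}] 0) := by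
    intro j hj
    refine tendsto_nhdsWithin_iff.2 ⟨?_, ?_⟩
    · have : Continuous fun w : ℂ => (j : ℂ) * w := by fun_prop
      exact (this.tendsto' 0 0 (by simp)).mono_left nhdsWithin_le_nhds
    · filter_upwards [self_mem_nhdsWithin] with w hw
      exact nat_mul_re_pos hw hj
  have h1 := hR.comp (hmul k hk)
  have h2 := hR.comp ((hmul 2 two_ne_zero).comp (hmul k hk))
  have e : (2 : ℂ) ^ (s : ℂ) = 2 * 2 ^ ((s : ℂ) - 1) := by
    rw [mul_comm, ← cpow_add_one_eq _ _ two_ne_zero, sub_add_cancel]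
  rcases Nat.even_or_odd k with he | ho
  · have : expB s + (-1) ^ k * expA s = riemannZeta (1 - s) := by
      rw [he.neg_one_pow, expA, expB]
      ring
    rw [this]
    refine h1.congr fun w => ?_
    rw [altRem, if_pos he]
    rfl
  · have : expB s + (-1) ^ k * expA s = 2 ^ (s : ℂ) * riemannZeta (1 - s) - riemannZeta (1 - s) := by
      rw [ho.neg_one_pow, expA, expB, e]
      ring
    rw [this]
    refine ((h2.const_mul _).sub h1).congr fun w => ?_
    rw [altRem, if_neg (Nat.not_even_iff_odd.2 ho)]
    simp [Function.comp]

/-- Limits alternating between `B - A` and `B + A` sum to logarithmic series at `z` and `-z`. This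
is the origin of the factors `(1-x)^{-B} (1+x)^{-A}`. -/
theorem hasSum_log_const (s : ℝ) {z : ℂ} (hz : ‖z‖ < 1) :
    HasSum (fun k : ℕ => z ^ (k + 1) / ((k + 1 : ℕ) : ℂ) * (expB s + (-1) ^ (k + 1) * expA s))
      (-expB s * Complex.log (1 - z) - expA s * Complex.log (1 + z)) := by
  have h1 := (hasSum_nat_add_iff' 1).2 (hasSum_taylorSeries_neg_log hz)
  have h2 := (hasSum_nat_add_iff' 1).2 (hasSum_taylorSeries_neg_log (z := -z) (by rwa [norm_neg]))
  simp only [Finset.range_one, Finset.sum_singleton, pow_zero, Nat.cast_zero, div_zero,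
      sub_zero, sub_neg_eq_add] at h1 h2
  have h3 := (h1.mul_left (expB s)).add (h2.mul_left (expA s))
  have e : -expB s * Complex.log (1 - z) - expA s * Complex.log (1 + z) =
    expB s * -Complex.log (1 - z) + expA s * -Complex.log (1 + z) := by ring
  rw [e]
  refine h3.congr_fun fun k => ?_
  rw [neg_pow z]
  ring

/-- The behaviour of `log P` near `q = -1`, including the constant term. -/
theorem exists_norm_logP_add_pi_sub_const_le {s : ℝ} (hs : 0 < s) {ρ : ℝ} (hρ0 : 0 ≤ ρ) (hρ : ρ < 1)
    (M : ℝ) {ε : ℝ} (hε : 0 < ε) : ∃ δ > 0, ∀ z w : ℂ, ‖z‖ ≤ ρ → 0 < w.re → |w.im| ≤ M * w.re →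
      w.re < δ →
      ‖logP s z (w + Real.pi * I) - Complex.Gamma s * (2 : ℂ) ^ (-((s + 1 : ℝ) : ℂ)) *
        polylog ((s + 1 : ℝ) : ℂ) (z ^ 2) * w ^ (-(s : ℂ)) -
        (-expB s * Complex.log (1 - z) - expA s * Complex.log (1 + z))‖ ≤ ε := by
  obtain ⟨C, hC⟩ := exists_norm_altRem_le hs M
  set c : ℕ → ℂ := fun k => expB s + (-1) ^ k * expA s with hc
  have hcC : ∀ k, ‖c k‖ ≤ ‖expB s‖ + ‖expA s‖ := by
    intro k
    refine (norm_add_le _ _).trans ?_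
    simp
  have hsum := (summable_geometric_succ hρ0 hρ).mul_right C
  have hsum2 := (summable_geometric_succ hρ0 hρ).mul_right (C + (‖expB s‖ + ‖expA s‖))
  set l : Filter ℂ := 𝓝[{t : ℂ | 0 < t.re ∧ |t.im| ≤ M * t.re}] 0 with hl
  -- Replacing `|z|^k` by `ρ^k` before passing to the limit makes the result uniform in `z`.
  have hlim : Tendsto (fun w : ℂ => ∑' k : ℕ, ρ ^ (k + 1) * ‖altRem s (k + 1) w - c (k + 1)‖) l
      (𝓝 (∑' k : ℕ, ρ ^ (k + 1) * 0)) := by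
    refine tendsto_tsum_of_dominated_convergence hsum2 ?_ ?_
    · intro k
      refine Tendsto.const_mul _ ?_
      have h1 : l ≤ 𝓝[{t : ℂ | 0 < t.re}] 0 := nhdsWithin_mono _ fun t ht => ht.1
      have h2 := ((tendsto_altRem hs k.succ_ne_zero).mono_left h1).sub_const (c (k + 1))
      rw [hc] at h2
      simp only [Nat.succ_eq_add_one, sub_self] at h2
      simpa using h2.norm
    · filter_upwards [self_mem_nhdsWithin] with w hw k
      rw [norm_mul, norm_norm, Real.norm_of_nonneg (by positivity)]
      refine mul_le_mul_of_nonneg_left ?_ (by positivity)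
      exact (norm_sub_le _ _).trans (add_le_add (hC _ _ k.succ_ne_zero hw.1 hw.2) (hcC _))
  simp only [mul_zero, tsum_zero] at hlim
  obtain ⟨δ, hδ, hδ2⟩ := Metric.mem_nhdsWithin_iff.1 (hlim.eventually (gt_mem_nhds hε))
  -- In the sector `‖w‖ ≤ (1 + |M|) Re w`, so a small real part makes `w` small.
  refine ⟨δ / (1 + |M|), by positivity, fun z w hz hw hM hwδ => ?_⟩
  have hb : ∀ k : ℕ, ‖z ^ (k + 1) / ((k + 1 : ℕ) : ℂ) * altRem s (k + 1) w‖ ≤ ρ ^ (k + 1) * C := by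
    intro k
    rw [norm_mul]
    exact mul_le_mul (norm_pow_div_le hz k) (hC _ _ k.succ_ne_zero hw hM) (norm_nonneg _)
      (by positivity)
  have hmem : w ∈ Metric.ball (0 : ℂ) δ ∩ {t : ℂ | 0 < t.re ∧ |t.im| ≤ M * t.re} := by
    refine ⟨?_, hw, hM⟩
    rw [mem_ball_zero_iff]
    refine (norm_le_abs_re_add_abs_im w).trans_lt ?_
    rw [abs_of_pos hw]
    rw [lt_div_iff₀ (by positivity)] at hwδ
    have := le_abs_self M
    nlinarith
  have hlt : ∑' k : ℕ, ρ ^ (k + 1) * ‖altRem s (k + 1) w - c (k + 1)‖ < ε := hδ2 hmem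
  have hS := Summable.of_norm_bounded hsum hb
  rw [logP_add_pi_eq hs (hz.trans_lt hρ) hw hS, add_sub_cancel_left,
    ← (hasSum_log_const s (hz.trans_lt hρ)).tsum_eq,
    ← hS.tsum_sub (hasSum_log_const s (hz.trans_lt hρ)).summable]
  refine (tsum_of_norm_bounded (Summable.hasSum ?_) fun k => ?_).trans hlt.le
  · refine hsum2.of_nonneg_of_le (fun k => by positivity) fun k => ?_
    refine mul_le_mul_of_nonneg_left ?_ (by positivity)
    exact (norm_sub_le _ _).trans (add_le_add (hC _ _ k.succ_ne_zero hw hM) (hcC _))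
  · rw [← mul_sub, norm_mul]
    exact mul_le_mul_of_nonneg_right (norm_pow_div_le hz k) (norm_nonneg _)

/-! ### The minor arcs. -/

/-- If neither `θ` nor `2θ` is close to a multiple of `2π` then all small `k` for which `kθ` is close
to a multiple of `2π` are multiples of one `d ≥ 3`. -/
theorem exists_dvd_of_near_multiple {M τ θ : ℝ} {K : ℕ} (hM : 0 ≤ M) (hτ : 0 < τ)
    (hK : 2 * M * τ * K ^ 2 < 2 * Real.pi)
    (h1 : ∀ h : ℤ, M * τ < |θ - 2 * Real.pi * h|)
    (h2 : ∀ h : ℤ, 2 * M * τ < |2 * θ - 2 * Real.pi * h|) :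
    ∃ d : ℕ, 3 ≤ d ∧ ∀ k : ℕ, 1 ≤ k → k ≤ K →
      (∃ h : ℤ, |k * θ - 2 * Real.pi * h| ≤ M * (k * τ)) → d ∣ k := by
  classical
  by_cases hex : ∃ k : ℕ, 1 ≤ k ∧ ∃ h : ℤ, |k * θ - 2 * Real.pi * h| ≤ M * (k * τ)
  swap
  · exact ⟨3, le_rfl, fun k hk1 _ hk => absurd ⟨k, hk1, hk⟩ hex⟩
  -- The least index with a near multiple; `h1` and `h2` exclude the values `1` and `2`.
  set d := Nat.find hex with hd
  obtain ⟨hd1, h₀, hh₀⟩ := Nat.find_spec hex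
  rw [← hd] at hd1 hh₀
  refine ⟨d, ?_, ?_⟩
  · by_contra hlt
    have : d = 1 ∨ d = 2 := by omega
    rcases this with h | h
    · have := h1 h₀
      rw [h] at hh₀
      norm_num at hh₀
      linarith
    · have := h2 h₀
      rw [h] at hh₀
      norm_num at hh₀
      linarith
  · rintro k hk1 hkK ⟨h, hh⟩
    have hdk : d ≤ k := Nat.find_min' hex ⟨hk1, h, hh⟩
    have hkK' : (k : ℝ) ≤ K := by exact_mod_cast hkK
    have hdk' : (d : ℝ) ≤ k := by exact_mod_cast hdk
    have hd0 : (0 : ℝ) < d := by exact_mod_cast hd1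
    have hpi := Real.pi_pos
    -- The two approximations combine to show that `2π` times this integer difference is at most
    -- `2MτK² < 2π` in absolute value, so the difference is zero: both rational approximations to
    -- `θ/2π` agree.
    have heq : h * d = h₀ * k := by
      have e : 2 * Real.pi * ((h * d - h₀ * k : ℤ) : ℝ) =
          k * (d * θ - 2 * Real.pi * h₀) - d * (k * θ - 2 * Real.pi * h) := by
        push_cast; ring
      have hb : 2 * Real.pi * |((h * d - h₀ * k : ℤ) : ℝ)| < 2 * Real.pi := by
        rw [← abs_of_pos (by positivity : 0 < 2 * Real.pi), ← abs_mul,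
          abs_of_pos (by positivity : 0 < 2 * Real.pi), e]
        refine lt_of_le_of_lt ?_ hK
        refine (abs_sub _ _).trans ?_
        rw [abs_mul, abs_mul, Nat.abs_cast, Nat.abs_cast]
        have a1 : (k : ℝ) * |d * θ - 2 * Real.pi * h₀| ≤ k * (M * (d * τ)) := by gcongr
        have a2 : (d : ℝ) * |k * θ - 2 * Real.pi * h| ≤ d * (M * (k * τ)) := by gcongr
        have a3 : (k : ℝ) * d ≤ K ^ 2 := by nlinarith
        have a4 : 0 ≤ M * τ := by positivity
        nlinarith
      have hb' : |((h * d - h₀ * k : ℤ) : ℝ)| < 1 := by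
        by_contra hcon
        push Not at hcon
        nlinarith
      have : |h * d - h₀ * k| < 1 := by exact_mod_cast hb'
      rw [Int.abs_lt_one_iff] at this
      linarith
    have heq' : (h : ℝ) * d = h₀ * k := by exact_mod_cast heq
    -- A nonzero remainder `r = k mod d` would be a smaller index with a near multiple, because
    -- `d(rθ - 2π(h - a h₀)) = r(dθ - 2πh₀)`.
    rw [Nat.dvd_iff_mod_eq_zero]
    by_contra hr
    set r := k % d with hrdef
    set a := k / d with hadef
    have hk : (k : ℝ) = d * a + r := by exact_mod_cast (Nat.div_add_mod k d).symm
    have hrlt : r < d := Nat.mod_lt _ hd1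
    refine Nat.find_min hex hrlt ⟨Nat.one_le_iff_ne_zero.2 hr, h - a * h₀, ?_⟩
    have hr0 : (0 : ℝ) ≤ r := r.cast_nonneg
    have e : d * (r * θ - 2 * Real.pi * ((h - a * h₀ : ℤ) : ℝ)) = r * (d * θ - 2 * Real.pi * h₀) := by
      push_cast
      have : (r : ℝ) = k - d * a := by linarith
      rw [this]
      linear_combination (-(2 * Real.pi)) * heq'
    have e2 : d * |r * θ - 2 * Real.pi * ((h - a * h₀ : ℤ) : ℝ)| = r * |d * θ - 2 * Real.pi * h₀| := by
      have := congrArg abs e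
      rwa [abs_mul, abs_mul, Nat.abs_cast, Nat.abs_cast] at this
    have e3 : d * |r * θ - 2 * Real.pi * ((h - a * h₀ : ℤ) : ℝ)| ≤ d * (M * (r * τ)) := by
      rw [e2]
      calc r * |d * θ - 2 * Real.pi * h₀| ≤ r * (M * (d * τ)) := by gcongr
        _ = _ := by ring
    exact le_of_mul_le_mul_left e3 hd0

theorem exists_int_abs_sub_two_pi_le (y : ℝ) : ∃ h : ℤ, |y - 2 * Real.pi * h| ≤ Real.pi := by
  refine ⟨round (y / (2 * Real.pi)), ?_⟩
  have h := abs_sub_round (y / (2 * Real.pi))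
  have hp : 0 < 2 * Real.pi := by positivity
  have e : y - 2 * Real.pi * round (y / (2 * Real.pi)) =
      2 * Real.pi * (y / (2 * Real.pi) - round (y / (2 * Real.pi))) := by
    field_simp
  rw [e, abs_mul, abs_of_pos hp]
  nlinarith

/-- A bound for `φ(e^{-t})` in terms of the distance from `Im t` to `2πℤ`. -/
theorem exists_norm_phi_le {s : ℝ} (hs : 0 < s) : ∃ C, 0 ≤ C ∧ ∀ (t : ℂ) (y : ℝ), 0 < t.re → 0 < y →
    y ≤ t.re ∨ (∀ h : ℤ, y ≤ |t.im - 2 * Real.pi * h|) →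
    ‖phi s t‖ ≤ Real.Gamma s * y ^ (-s) + C := by
  obtain ⟨C, hC⟩ := exists_norm_phiRem_le hs 0
  refine ⟨C, (norm_nonneg _).trans (hC 1 (by simp) (Or.inl (by simp [Real.pi_pos.le]))),
    fun t y ht hy hty => ?_⟩
  obtain ⟨h, hh⟩ := exists_int_abs_sub_two_pi_le t.im
  set u : ℂ := t - 2 * Real.pi * I * h with hu
  have hre : u.re = t.re := by simp [hu]
  have him : u.im = t.im - 2 * Real.pi * h := by simp [hu]
  have hyu : y ≤ ‖u‖ := by
    rcases hty with h1 | h1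
    · exact h1.trans (hre ▸ re_le_norm u)
    · exact (h1 h).trans (him ▸ abs_im_le_norm u)
  have e : phi s t = Complex.Gamma s * u ^ (-(s : ℂ)) + phiRem s u := by
    rw [phiRem, hu, phi_add_two_pi]
    ring
  rw [e]
  refine (norm_add_le _ _).trans (add_le_add ?_ (hC u (hre ▸ ht) (Or.inl (him ▸ hh))))
  rw [norm_mul, Complex.Gamma_ofReal, norm_real, Real.norm_of_nonneg (Real.Gamma_pos_of_pos hs).le,
    ← ofReal_neg, norm_cpow_real]
  refine mul_le_mul_of_nonneg_left ?_ (Real.Gamma_pos_of_pos hs).le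
  exact Real.rpow_le_rpow_of_nonpos hy hyu (by linarith)

/-- The real series `∑ y^m / m^{s+1}`. -/
def liR (s y : ℝ) : ℝ := ∑' m : ℕ, y ^ (m + 1) / ((m + 1 : ℕ) : ℝ) ^ (s + 1)

theorem polylog_ofReal (s y : ℝ) : polylog ((s + 1 : ℝ) : ℂ) (y : ℂ) = (liR s y : ℂ) := by
  rw [polylog, liR, ofReal_tsum]
  refine tsum_congr fun m => ?_
  rw [ofReal_div, ofReal_pow, ofReal_cpow (Nat.cast_nonneg _)]
  push_cast
  rfl

theorem summable_liR {s : ℝ} (hs : 0 < s) {y : ℝ} (hy : |y| < 1) :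
    Summable fun m : ℕ => y ^ (m + 1) / ((m + 1 : ℕ) : ℝ) ^ (s + 1) := by
  refine Summable.of_norm_bounded (summable_geometric_succ (abs_nonneg y) hy) fun m => ?_
  rw [norm_div, norm_pow, Real.norm_eq_abs, Real.norm_of_nonneg (by positivity)]
  exact div_le_self (by positivity) (Real.one_le_rpow (by simp) (by linarith))

/-- The part of the polylogarithm carried by the multiples of `d ≥ 3`. -/
theorem tsum_dvd_le {s : ℝ} (hs : 0 < s) {y : ℝ} (hy0 : 0 ≤ y) (hy1 : y < 1) {d : ℕ} (hd : 3 ≤ d) :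
    (∑' k : ℕ, if d ∣ k + 1 then y ^ (k + 1) / ((k + 1 : ℕ) : ℝ) ^ (s + 1) else 0) ≤
      3 ^ (-(s + 1)) * liR s (y ^ 2) := by
  have hinj : Function.Injective (fun j : ℕ => d * (j + 1) - 1) := by
    intro a b h
    simp only at h
    have h1 : 1 ≤ d * (a + 1) := Nat.mul_pos (by omega) (by omega)
    have h2 : 1 ≤ d * (b + 1) := Nat.mul_pos (by omega) (by omega)
    have h3 : d * (a + 1) = d * (b + 1) := by omega
    have := Nat.eq_of_mul_eq_mul_left (by omega) h3
    omega
  have hsupp : Function.support (fun k : ℕ => if d ∣ k + 1 then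
      y ^ (k + 1) / ((k + 1 : ℕ) : ℝ) ^ (s + 1) else 0) ⊆ range (fun j : ℕ => d * (j + 1) - 1) := by
    intro k hk
    have : d ∣ k + 1 := by
      by_contra h
      exact hk (if_neg h)
    obtain ⟨c, hc⟩ := this
    rcases c with _ | c
    · omega
    · exact ⟨c, by simp only; omega⟩
  have hy2 : |y ^ 2| < 1 := by
    rw [abs_of_nonneg (by positivity)]
    nlinarith
  have hsum := (summable_liR hs hy2).mul_left ((3 : ℝ) ^ (-(s + 1)))
  -- From `d ≥ 3` the denominator gives `d^{-(s+1)} ≤ 3^{-(s+1)}`, while the weaker `y^{dj} ≤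
  -- y^{2j}` suffices for the numerator.
  have hle : ∀ j : ℕ, (if d ∣ (d * (j + 1) - 1) + 1 then
      y ^ ((d * (j + 1) - 1) + 1) / (((d * (j + 1) - 1) + 1 : ℕ) : ℝ) ^ (s + 1) else 0) ≤
      3 ^ (-(s + 1)) * ((y ^ 2) ^ (j + 1) / ((j + 1 : ℕ) : ℝ) ^ (s + 1)) := by
    intro j
    have h1 : d * (j + 1) - 1 + 1 = d * (j + 1) := Nat.sub_add_cancel (Nat.mul_pos (by omega) (by omega))
    rw [h1, if_pos (dvd_mul_right _ _), Nat.cast_mul, Real.mul_rpow (by positivity) (by positivity),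
      ← div_div, Real.rpow_neg (by norm_num), ← pow_mul]
    have h3 : (3 : ℝ) ^ (s + 1) ≤ (d : ℝ) ^ (s + 1) :=
      Real.rpow_le_rpow (by norm_num) (by exact_mod_cast hd) (by linarith)
    have h4 : y ^ (d * (j + 1)) ≤ y ^ (2 * (j + 1)) :=
      pow_le_pow_of_le_one hy0 hy1.le (Nat.mul_le_mul_right _ (by omega))
    have h5 : (0 : ℝ) < 3 ^ (s + 1) := by positivity
    rw [← mul_div_assoc]
    refine div_le_div_of_nonneg_right ?_ (by positivity)
    rw [inv_mul_eq_div]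
    exact div_le_div₀ (by positivity) h4 h5 h3
  rw [← hinj.tsum_eq hsupp, liR, ← tsum_mul_left]
  refine Summable.tsum_le_tsum hle ?_ hsum
  refine hsum.of_nonneg_of_le (fun j => ?_) hle
  split_ifs
  · positivity
  · exact le_rfl

theorem summable_ite_dvd {s : ℝ} (hs : 0 < s) {y : ℝ} (hy0 : 0 ≤ y) (hy1 : y < 1) (d : ℕ) :
    Summable fun k : ℕ => if d ∣ k + 1 then y ^ (k + 1) / ((k + 1 : ℕ) : ℝ) ^ (s + 1) else 0 := by
  refine (summable_liR hs (by rwa [abs_of_nonneg hy0])).of_nonneg_of_le (fun k => ?_) (fun k => ?_)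
  · split_ifs
    · positivity
    · exact le_rfl
  · split_ifs
    · exact le_rfl
    · positivity

/-- The minor arcs: `log P` away from `q = ±1`. -/
theorem exists_norm_logP_minor_le {s : ℝ} (hs : 0 < s) {ρ : ℝ} (hρ0 : 0 ≤ ρ) (hρ : ρ < 1)
    {η : ℝ} (hη : 0 < η) : ∃ M > 0, ∃ τ₀ > 0, ∀ (z t : ℂ), ‖z‖ ≤ ρ → 0 < t.re → t.re < τ₀ →
      (∀ h : ℤ, M * t.re < |t.im - 2 * Real.pi * h|) →
      (∀ h : ℤ, 2 * M * t.re < |2 * t.im - 2 * Real.pi * h|) →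
      ‖logP s z t‖ ≤ t.re ^ (-s) * (Real.Gamma s * (3 ^ (-(s + 1)) * liR s (‖z‖ ^ 2)) + η) := by
  obtain ⟨C, hC0, hC⟩ := exists_norm_phi_le hs
  have hG : 0 < Real.Gamma s := Real.Gamma_pos_of_pos hs
  have hgeo := summable_geometric_succ hρ0 hρ
  set S : ℝ := ∑' k : ℕ, ρ ^ (k + 1) with hS
  have hS0 : 0 ≤ S := tsum_nonneg fun k => by positivity
  -- The allowance `η` is split in three: `K` cuts off the tail in `k`, `M` makes the terms without
  -- a near multiple small, and `τ₁` absorbs the bounded remainder of `φ`.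
  have htail : ∃ K : ℕ, Real.Gamma s * (∑' k : ℕ, ρ ^ (k + K + 1)) ≤ η / 3 := by
    have h1 := (tendsto_sum_nat_add fun k : ℕ => ρ ^ (k + 1)).const_mul (Real.Gamma s)
    rw [mul_zero] at h1
    obtain ⟨K, hK⟩ := (h1.eventually (gt_mem_nhds (show 0 < η / 3 by positivity))).exists
    exact ⟨K, hK.le⟩
  obtain ⟨K, hK⟩ := htail
  obtain ⟨M, hM0, hM⟩ : ∃ M : ℝ, 0 < M ∧ Real.Gamma s * S * M ^ (-s) ≤ η / 3 := by
    have h1 := (tendsto_rpow_neg_atTop hs).const_mul (Real.Gamma s * S)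
    rw [mul_zero] at h1
    obtain ⟨M, hM, hM0⟩ := ((h1.eventually (gt_mem_nhds (show 0 < η / 3 by positivity))).and
      (eventually_gt_atTop 0)).exists
    exact ⟨M, hM0, hM.le⟩
  obtain ⟨τ₁, hτ₁, hτ₁'⟩ : ∃ τ₁ > 0, ∀ τ : ℝ, 0 < τ → τ < τ₁ → C * S * τ ^ s ≤ η / 3 := by
    have h1 : Tendsto (fun τ : ℝ => C * S * τ ^ s) (𝓝 0) (𝓝 (C * S * 0 ^ s)) :=
      ((Real.continuousAt_rpow_const 0 s (Or.inr hs.le)).tendsto).const_mul _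
    rw [Real.zero_rpow hs.ne', mul_zero] at h1
    obtain ⟨δ, hδ, h2⟩ := Metric.eventually_nhds_iff.1
      (h1.eventually (gt_mem_nhds (show 0 < η / 3 by positivity)))
    exact ⟨δ, hδ, fun τ h0 hlt => (h2 (by rw [Real.dist_0_eq_abs, abs_of_pos h0]; exact hlt)).le⟩
  refine ⟨M, hM0, min τ₁ (Real.pi / (M * (K ^ 2 + 1))), lt_min hτ₁ (by positivity), ?_⟩
  intro z t hz ht0 htτ h1 h2
  set τ := t.re with hτ
  have hz1 : ‖z‖ < 1 := hz.trans_lt hρ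
  have hKτ : 2 * M * τ * K ^ 2 < 2 * Real.pi := by
    have h3 := htτ.trans_le (min_le_right _ _)
    rw [lt_div_iff₀ (by positivity)] at h3
    have : 0 < τ * M := by positivity
    nlinarith
  obtain ⟨d, hd3, hd⟩ := exists_dvd_of_near_multiple hM0.le ht0 hKτ h1 h2
  have hτs : 0 < τ ^ (-s) := by positivity
  set F : ℕ → ℝ := fun k =>
    τ ^ (-s) * (Real.Gamma s * (if d ∣ k + 1 then ‖z‖ ^ (k + 1) / ((k + 1 : ℕ) : ℝ) ^ (s + 1) else 0)
      + Real.Gamma s * (if K ≤ k then ρ ^ (k + 1) else 0)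
      + Real.Gamma s * M ^ (-s) * ρ ^ (k + 1) + C * τ ^ s * ρ ^ (k + 1)) with hF
  have hite : HasSum (fun k : ℕ => if K ≤ k then ρ ^ (k + 1) else 0) (∑' k : ℕ, ρ ^ (k + K + 1)) := by
    rw [← hasSum_nat_add_iff' K]
    have e0 : ∑ i ∈ Finset.range K, (if K ≤ i then ρ ^ (i + 1) else 0) = 0 :=
      Finset.sum_eq_zero fun i hi => if_neg (not_le.2 (Finset.mem_range.1 hi))
    rw [e0, sub_zero]
    simp only [le_add_iff_nonneg_left, zero_le, if_true]
    exact ((summable_nat_add_iff K).2 hgeo).hasSum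
  have hFsum := ((((summable_ite_dvd hs (norm_nonneg z) hz1 d).hasSum.mul_left (Real.Gamma s)).add
    (hite.mul_left (Real.Gamma s))).add (hgeo.hasSum.mul_left (Real.Gamma s * M ^ (-s)))).add
      (hgeo.hasSum.mul_left (C * τ ^ s)) |>.mul_left (τ ^ (-s))
  have hterm : ∀ k : ℕ, ‖z ^ (k + 1) / ((k + 1 : ℕ) : ℂ) * phi s (((k + 1 : ℕ) : ℂ) * t)‖ ≤ F k := by
    intro k
    have hk0 : (0 : ℝ) < ((k + 1 : ℕ) : ℝ) := by positivity
    have hk1 : (1 : ℝ) ≤ ((k + 1 : ℕ) : ℝ) := by simp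
    have hre : (((k + 1 : ℕ) : ℂ) * t).re = ((k + 1 : ℕ) : ℝ) * τ := by
      rw [← ofReal_natCast, re_ofReal_mul]
    have him : (((k + 1 : ℕ) : ℂ) * t).im = ((k + 1 : ℕ) : ℝ) * t.im := by
      rw [← ofReal_natCast, im_ofReal_mul]
    have hz0 := norm_nonneg z
    have hzk : ‖z‖ ^ (k + 1) / ((k + 1 : ℕ) : ℝ) ≤ ρ ^ (k + 1) :=
      (div_le_self (by positivity) hk1).trans (by gcongr)
    have hCb : ‖z‖ ^ (k + 1) / ((k + 1 : ℕ) : ℝ) * C ≤ τ ^ (-s) * (C * τ ^ s * ρ ^ (k + 1)) := by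
      have e : τ ^ (-s) * (C * τ ^ s * ρ ^ (k + 1)) = ρ ^ (k + 1) * C := by
        rw [Real.rpow_neg ht0.le]
        field_simp
      rw [e]
      gcongr
    have hone : ((k + 1 : ℕ) : ℝ) ^ (-s) ≤ 1 := Real.rpow_le_one_of_one_le_of_nonpos hk1 (by linarith)
    rw [norm_mul, norm_div, norm_pow, norm_natCast]
    -- Without a near multiple the distance to `2πiℤ` is at least `M(k+1)τ`, which gains `M^{-s}`.
    -- With one, only the real part is used, and either `k` lies in the tail or `d` divides `k + 1`.
    by_cases hact : ∀ h : ℤ, M * (((k + 1 : ℕ) : ℝ) * τ) ≤ |((k + 1 : ℕ) : ℝ) * t.im - 2 * Real.pi * h|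
    · have hp := hC (((k + 1 : ℕ) : ℂ) * t) (M * (((k + 1 : ℕ) : ℝ) * τ)) (by rw [hre]; positivity)
        (by positivity) (Or.inr (by rw [him]; exact hact))
      rw [Real.mul_rpow hM0.le (by positivity), Real.mul_rpow hk0.le ht0.le] at hp
      have b1 : ‖z‖ ^ (k + 1) / ((k + 1 : ℕ) : ℝ) *
          (Real.Gamma s * (M ^ (-s) * (((k + 1 : ℕ) : ℝ) ^ (-s) * τ ^ (-s)))) ≤
          τ ^ (-s) * (Real.Gamma s * M ^ (-s) * ρ ^ (k + 1)) := by
        calc _ ≤ ρ ^ (k + 1) * (Real.Gamma s * (M ^ (-s) * (1 * τ ^ (-s)))) := by gcongr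
          _ = _ := by ring
      have b2 : 0 ≤ τ ^ (-s) * (Real.Gamma s *
          (if d ∣ k + 1 then ‖z‖ ^ (k + 1) / ((k + 1 : ℕ) : ℝ) ^ (s + 1) else 0)) := by
        split_ifs <;> positivity
      have b3 : 0 ≤ τ ^ (-s) * (Real.Gamma s * (if K ≤ k then ρ ^ (k + 1) else 0)) := by
        split_ifs <;> positivity
      calc _ ≤ ‖z‖ ^ (k + 1) / ((k + 1 : ℕ) : ℝ) *
            (Real.Gamma s * (M ^ (-s) * (((k + 1 : ℕ) : ℝ) ^ (-s) * τ ^ (-s))) + C) := by gcongr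
        _ ≤ F k := by rw [hF]; linarith
    · push Not at hact
      obtain ⟨h, hh⟩ := hact
      have hp := hC (((k + 1 : ℕ) : ℂ) * t) (((k + 1 : ℕ) : ℝ) * τ) (by rw [hre]; positivity)
        (by positivity) (Or.inl hre.ge)
      rw [Real.mul_rpow hk0.le ht0.le] at hp
      have b0 : 0 ≤ τ ^ (-s) * (Real.Gamma s * M ^ (-s) * ρ ^ (k + 1)) := by positivity
      have b1 : ‖z‖ ^ (k + 1) / ((k + 1 : ℕ) : ℝ) *
          (Real.Gamma s * (((k + 1 : ℕ) : ℝ) ^ (-s) * τ ^ (-s))) ≤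
          τ ^ (-s) * (Real.Gamma s *
          (if d ∣ k + 1 then ‖z‖ ^ (k + 1) / ((k + 1 : ℕ) : ℝ) ^ (s + 1) else 0)) +
          τ ^ (-s) * (Real.Gamma s * (if K ≤ k then ρ ^ (k + 1) else 0)) := by
        by_cases hkK : K ≤ k
        · rw [if_pos hkK]
          have b2 : 0 ≤ τ ^ (-s) * (Real.Gamma s *
              (if d ∣ k + 1 then ‖z‖ ^ (k + 1) / ((k + 1 : ℕ) : ℝ) ^ (s + 1) else 0)) := by
            split_ifs <;> positivity
          calc _ ≤ ρ ^ (k + 1) * (Real.Gamma s * (1 * τ ^ (-s))) := by gcongr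
            _ = τ ^ (-s) * (Real.Gamma s * ρ ^ (k + 1)) := by ring
            _ ≤ _ := by linarith
        · have hdvd : d ∣ k + 1 := hd (k + 1) (by omega) (by omega) ⟨h, hh.le⟩
          rw [if_neg hkK, if_pos hdvd, mul_zero, mul_zero, add_zero]
          refine le_of_eq ?_
          rw [Real.rpow_neg hk0.le, Real.rpow_add_one hk0.ne']
          field_simp
      calc _ ≤ ‖z‖ ^ (k + 1) / ((k + 1 : ℕ) : ℝ) *
            (Real.Gamma s * (((k + 1 : ℕ) : ℝ) ^ (-s) * τ ^ (-s)) + C) := by gcongr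
        _ ≤ F k := by rw [hF]; linarith
  refine (tsum_of_norm_bounded hFsum hterm).trans ?_
  refine mul_le_mul_of_nonneg_left ?_ hτs.le
  have c1 := mul_le_mul_of_nonneg_left (tsum_dvd_le hs (norm_nonneg z) hz1 hd3) hG.le
  have c2 := hτ₁' τ ht0 (htτ.trans_le (min_le_left _ _))
  have c3 : Real.Gamma s * M ^ (-s) * S = Real.Gamma s * S * M ^ (-s) := by ring
  have c4 : C * τ ^ s * S = C * S * τ ^ s := by ring
  rw [← hS, c3, c4]
  linarith

/-! ### The arc around `q = 1` and the constant `κ`. -/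

theorem logP_sub_two_pi (s : ℝ) (z t : ℂ) (h : ℤ) :
    logP s z (t - 2 * Real.pi * I * h) = logP s z t := by
  refine tsum_congr fun k => ?_
  rw [← phi_add_two_pi s (((k + 1 : ℕ) : ℂ) * t) ((k + 1) * h)]
  congr 2
  push_cast
  ring

/-- `cos(π/(s+1))^{s+1}` if `s > 1`, and `0` otherwise. -/
def kappa (s : ℝ) : ℝ := (max 0 (Real.cos (Real.pi / (s + 1)))) ^ (s + 1)

theorem exists_int_cos_pos {x : ℝ} (hx : 0 < Real.cos x) :
    ∃ j : ℤ, |x - 2 * Real.pi * j| < Real.pi / 2 := by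
  obtain ⟨j, hj⟩ := exists_int_abs_sub_two_pi_le x
  refine ⟨j, ?_⟩
  by_contra hcon
  push Not at hcon
  have h1 : Real.cos x = Real.cos (|x - 2 * Real.pi * j|) := by
    rw [Real.cos_abs, show x - 2 * Real.pi * j = x - j * (2 * Real.pi) by ring,
      Real.cos_sub_int_mul_two_pi]
  have h2 := Real.cos_nonpos_of_pi_div_two_le_of_le hcon (by linarith [Real.pi_pos])
  linarith

/-- Write `-cos(sφ) = cos ψ` with `ψ = π - sφ - 2πj` in `(-π/2, π/2)`. With weights `1/(s+1)` and
`s/(s+1)`, the geometric mean of `cos ψ` and `cos φ` is at most their arithmetic mean, hence at most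
`cos μ` by concavity. In the mean angle `μ` the variable `φ` cancels: `μ` is an odd multiple of
`π/(s+1)`, so `cos μ ≤ cos(π/(s+1))`. -/
theorem neg_cos_mul_cos_rpow_le {s φ : ℝ} (hs : 0 < s) (hφ : |φ| < Real.pi / 2) :
    -Real.cos (s * φ) * Real.cos φ ^ s ≤ kappa s := by
  have hs1 : 0 < s + 1 := by linarith
  have hφ' := abs_lt.1 hφ
  have hcφ : 0 < Real.cos φ := Real.cos_pos_of_mem_Ioo ⟨by linarith, hφ'.2⟩
  have hκ : 0 ≤ kappa s := Real.rpow_nonneg (le_max_left _ _) _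
  rcases le_or_gt (-Real.cos (s * φ)) 0 with hneg | hpos
  · exact (mul_nonpos_of_nonpos_of_nonneg hneg (by positivity)).trans hκ
  rw [← Real.cos_pi_sub] at hpos ⊢
  obtain ⟨j, hj⟩ := exists_int_cos_pos hpos
  set ψ := Real.pi - s * φ - 2 * Real.pi * j with hψ
  have hcos : Real.cos (Real.pi - s * φ) = Real.cos ψ := by
    rw [hψ, show Real.pi - s * φ - 2 * Real.pi * j = Real.pi - s * φ - j * (2 * Real.pi) by ring,
      Real.cos_sub_int_mul_two_pi]
  rw [hcos] at hpos ⊢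
  have hψ' := abs_lt.1 hj
  set μ := 1 / (s + 1) * ψ + s / (s + 1) * φ with hμ
  have hw1 : 0 ≤ 1 / (s + 1) := by positivity
  have hw2 : 0 ≤ s / (s + 1) := by positivity
  have hw : 1 / (s + 1) + s / (s + 1) = 1 := by field_simp; ring
  have hgm := Real.geom_mean_le_arith_mean2_weighted hw1 hw2 hpos.le hcφ.le hw
  have hconc := strictConcaveOn_cos_Icc.concaveOn.2
    (x := ψ) ⟨by linarith, by linarith⟩ (y := φ) ⟨by linarith, by linarith⟩ hw1 hw2 hw
  simp only [smul_eq_mul] at hconc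
  have hμe : μ = (1 - 2 * j : ℤ) * (Real.pi / (s + 1)) := by
    rw [hμ, hψ]
    push_cast
    field_simp
    ring
  have hμabs : Real.pi / (s + 1) ≤ |μ| := by
    rw [hμe, abs_mul, abs_of_pos (show 0 < Real.pi / (s + 1) by have := Real.pi_pos; positivity)]
    have : (1 : ℝ) ≤ |((1 - 2 * j : ℤ) : ℝ)| := by
      exact_mod_cast Int.one_le_abs (by omega)
    have h3 : 0 < Real.pi / (s + 1) := by have := Real.pi_pos; positivity
    nlinarith
  have hμlt : |μ| ≤ Real.pi / 2 := by
    refine (abs_add_le _ _).trans ?_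
    rw [abs_mul, abs_mul, abs_of_nonneg hw1, abs_of_nonneg hw2]
    calc _ ≤ 1 / (s + 1) * (Real.pi / 2) + s / (s + 1) * (Real.pi / 2) := by gcongr
      _ = (1 / (s + 1) + s / (s + 1)) * (Real.pi / 2) := by ring
      _ = _ := by rw [hw, one_mul]
  have hcμ : Real.cos μ ≤ max 0 (Real.cos (Real.pi / (s + 1))) := by
    refine le_trans ?_ (le_max_right _ _)
    rw [← Real.cos_abs μ]
    exact Real.cos_le_cos_of_nonneg_of_le_pi (by have := Real.pi_pos; positivity)
      (by linarith [Real.pi_pos]) hμabs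
  have hfin := Real.rpow_le_rpow (by positivity) (hgm.trans (hconc.trans hcμ)) hs1.le
  rw [Real.mul_rpow (by positivity) (by positivity), ← Real.rpow_mul hpos.le,
    ← Real.rpow_mul hcφ.le, one_div, inv_mul_cancel₀ hs1.ne', Real.rpow_one,
    div_mul_cancel₀ _ hs1.ne'] at hfin
  exact hfin

theorem cpow_neg_re_eq {s : ℝ} {w : ℂ} (hw : 0 < w.re) :
    (w ^ (-(s : ℂ))).re = w.re ^ (-s) * (Real.cos (s * w.arg) * Real.cos w.arg ^ s) := by
  have hw0 := ne_zero_of_re_pos' hw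
  have hn : 0 < ‖w‖ := norm_pos_iff.2 hw0
  have hc : Real.cos w.arg = w.re / ‖w‖ := Complex.cos_arg hw0
  rw [cpow_def_of_ne_zero hw0, Complex.exp_re, hc, Real.div_rpow hw.le hn.le]
  have e1 : (Complex.log w * -(s : ℂ)).re = Real.log ‖w‖ * -s := by
    rw [← ofReal_neg, re_mul_ofReal, log_re]
  have e2 : (Complex.log w * -(s : ℂ)).im = -(s * w.arg) := by
    rw [← ofReal_neg, im_mul_ofReal, log_im]; ring
  rw [e1, e2, Real.cos_neg, ← Real.rpow_def_of_pos hn, Real.rpow_neg hn.le, Real.rpow_neg hw.le]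
  field_simp

/-- Near `q = 1` the coefficient of `w^{-s}` is negative when `x < 0`, so the danger comes from
negative values of `Re w^{-s}`. In polar form, with `‖w‖ = Re w / cos(arg w)`, the trigonometric
inequality controls them. -/
theorem neg_re_cpow_neg_le {s : ℝ} (hs : 0 < s) {w : ℂ} (hw : 0 < w.re) :
    -(w ^ (-(s : ℂ))).re ≤ w.re ^ (-s) * kappa s := by
  rw [cpow_neg_re_eq hw]
  have h := neg_cos_mul_cos_rpow_le hs
    (Complex.abs_arg_lt_pi_div_two_iff.2 (Or.inl hw))
  have := mul_le_mul_of_nonneg_left h (Real.rpow_nonneg hw.le (-s))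
  linarith

theorem norm_cpow_neg_real (s : ℝ) (w : ℂ) : ‖w ^ (-(s : ℂ))‖ = ‖w‖ ^ (-s) := by
  rw [← ofReal_neg, norm_cpow_real]

/-! ### The exponential gap between the arc at `-1` and the rest of the circle. -/

theorem continuousOn_liR {s : ℝ} (hs : 0 < s) : ContinuousOn (liR s) (Ioo (-1) 1) := by
  intro x hx
  obtain ⟨ρ, h1, h2⟩ := exists_between (abs_lt.2 hx)
  have hρ0 := (abs_nonneg x).trans h1.le
  have : ContinuousOn (liR s) (Icc (-ρ) ρ) := by
    refine continuousOn_tsum (u := fun k : ℕ => ρ ^ (k + 1)) (fun k => by fun_prop)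
      (summable_geometric_succ hρ0 h2) ?_
    intro k y hy
    rw [norm_div, norm_pow, Real.norm_eq_abs, Real.norm_of_nonneg (by positivity)]
    refine (div_le_self (by positivity) (Real.one_le_rpow (by simp) (by linarith))).trans ?_
    exact pow_le_pow_left₀ (abs_nonneg y) (abs_le.2 hy) _
  exact (this.continuousAt (Icc_mem_nhds (abs_lt.1 h1).1 (abs_lt.1 h1).2)).continuousWithinAt

theorem liR_pos {s : ℝ} (hs : 0 < s) {y : ℝ} (hy0 : 0 < y) (hy1 : y < 1) : 0 < liR s y := by
  refine (summable_liR hs (by rwa [abs_of_pos hy0])).tsum_pos (fun k => by positivity) 0 ?_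
  positivity

/-- The coefficient `Λ(x)` of `w^{-s}` in `log P(x, -e^{-w})`. -/
def lam (s x : ℝ) : ℝ := Real.Gamma s * (2 ^ (-(s + 1)) * liR s (x ^ 2))

theorem ofReal_lam (s x : ℝ) : (lam s x : ℂ) = Complex.Gamma s * (2 : ℂ) ^ (-((s + 1 : ℝ) : ℂ)) *
    polylog ((s + 1 : ℝ) : ℂ) ((x : ℂ) ^ 2) := by
  rw [lam, ← ofReal_pow, polylog_ofReal, Complex.Gamma_ofReal, ofReal_mul, ofReal_mul,
    ofReal_cpow (by norm_num)]
  push_cast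
  ring

theorem sq_mem_Ioo {x : ℝ} (hx : x ∈ Ioo (-1 : ℝ) 0) : x ^ 2 ∈ Ioo (0 : ℝ) 1 :=
  ⟨by nlinarith [hx.2], by nlinarith [hx.1, hx.2]⟩

theorem lam_pos {s x : ℝ} (hs : 0 < s) (hx : x ∈ Ioo (-1 : ℝ) 0) : 0 < lam s x := by
  have h1 := liR_pos hs (sq_mem_Ioo hx).1 (sq_mem_Ioo hx).2
  have h2 := Real.Gamma_pos_of_pos hs
  unfold lam
  positivity

theorem continuousOn_liR_sq {s : ℝ} (hs : 0 < s) :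
    ContinuousOn (fun x => liR s (x ^ 2)) (Ioo (-1) 0) :=
  (continuousOn_liR hs).comp (by fun_prop) fun x hx =>
    ⟨by linarith [(sq_mem_Ioo hx).1], (sq_mem_Ioo hx).2⟩

theorem exists_pos_le_of_isCompact {X : Set ℝ} (hX : IsCompact X) {f : ℝ → ℝ} (hf : ContinuousOn f X)
    (hpos : ∀ x ∈ X, 0 < f x) : ∃ δ > 0, ∀ x ∈ X, δ ≤ f x := by
  rcases X.eq_empty_or_nonempty with rfl | hne
  · exact ⟨1, one_pos, by simp⟩
  · obtain ⟨x, hx, hmin⟩ := hX.exists_isMinOn hne hf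
    exact ⟨f x, hpos x hx, fun y hy => hmin hy⟩

theorem exists_lt_one_bound {X : Set ℝ} (hX : IsCompact X) (hsub : X ⊆ Ioo (-1 : ℝ) 0) :
    ∃ ρ, 0 ≤ ρ ∧ ρ < 1 ∧ ∀ x ∈ X, ‖(x : ℂ)‖ ≤ ρ := by
  obtain ⟨δ, hδ, h⟩ := exists_pos_le_of_isCompact hX (f := fun x => 1 + x) (by fun_prop)
    (fun x hx => by linarith [(hsub hx).1])
  refine ⟨max 0 (1 - δ), le_max_left _ _, max_lt one_pos (by linarith), fun x hx => ?_⟩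
  rw [norm_real, Real.norm_eq_abs, abs_of_neg (hsub hx).2]
  exact le_trans (by linarith [h x hx]) (le_max_right _ _)

theorem liR_add_liR_neg {s : ℝ} (hs : 0 < s) {x : ℝ} (hx : |x| < 1) :
    liR s x + liR s (-x) = 2 * (2 ^ (-(s + 1)) * liR s (x ^ 2)) := by
  have hz : ‖(x : ℂ)‖ < 1 := by rwa [norm_real]
  have h1 := summable_polylog hs hz
  have h2 := summable_polylog hs (z := -(x : ℂ)) (by rwa [norm_neg])
  have key : polylog ((s + 1 : ℝ) : ℂ) x + polylog ((s + 1 : ℝ) : ℂ) (-x) =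
      2 * ((2 : ℂ) ^ (-((s + 1 : ℝ) : ℂ)) * polylog ((s + 1 : ℝ) : ℂ) ((x : ℂ) ^ 2)) := by
    rw [← tsum_even_polylog, ← tsum_mul_left, polylog, polylog, ← h1.tsum_add h2]
    refine tsum_congr fun k => ?_
    split_ifs with he
    · rw [he.neg_pow]; ring
    · rw [(Nat.not_even_iff_odd.1 he).neg_pow]; ring
  apply ofReal_injective
  rw [← ofReal_neg, polylog_ofReal, polylog_ofReal, ← ofReal_pow, polylog_ofReal] at key
  rw [ofReal_add, key, ofReal_mul, ofReal_mul, ofReal_cpow (by norm_num)]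
  push_cast
  rfl

/-- By duplication `Li(x) = 2^{-s} Li(x²) - Li(-x)`, where `x² ≤ -x` and `2^{-s} < 1`. -/
theorem liR_neg_of_neg {s : ℝ} (hs : 0 < s) {x : ℝ} (hx : x ∈ Ioo (-1 : ℝ) 0) : liR s x < 0 := by
  have h := liR_add_liR_neg hs (x := x) (abs_lt.2 ⟨hx.1, hx.2.trans one_pos⟩)
  have hx2 := sq_mem_Ioo hx
  have hlt : liR s (x ^ 2) ≤ liR s (-x) := by
    refine Summable.tsum_le_tsum (fun k => ?_)
      (summable_liR hs (by rw [abs_of_pos hx2.1]; exact hx2.2))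
      (summable_liR hs (by rw [abs_of_pos (neg_pos.2 hx.2)]; linarith [hx.1]))
    have : x ^ 2 ≤ -x := by nlinarith [hx.1, hx.2]
    gcongr
  have hpos := liR_pos hs hx2.1 hx2.2
  have h2 : (2 : ℝ) ^ (-(s + 1)) < 2 ^ (-1 : ℝ) :=
    Real.rpow_lt_rpow_of_exponent_lt one_lt_two (by linarith)
  rw [Real.rpow_neg_one] at h2
  nlinarith

/-- On the circle `|q| = e^{-τ}`, outside of the arc around `-1`, the product is exponentially smaller
than near `-1`. -/
theorem exists_re_logP_le {s : ℝ} (hs : 0 < s) {X : Set ℝ} (hX : IsCompact X)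
    (hsub : X ⊆ Ioo (-1 : ℝ) 0)
    (hκ : ∀ x ∈ X, -liR s x * kappa s < 2 ^ (-(s + 1)) * liR s (x ^ 2)) :
    ∃ δ > 0, ∃ τ₀ > 0, ∀ x ∈ X, ∀ τ ϑ : ℝ, 0 < τ → τ < τ₀ → τ ≤ |ϑ| → |ϑ| ≤ Real.pi →
      (logP s x (τ - I * ϑ + Real.pi * I)).re ≤ (lam s x - δ) * τ ^ (-s) := by
  have hG := Real.Gamma_pos_of_pos hs
  obtain ⟨ρ, hρ0, hρ1, hρ⟩ := exists_lt_one_bound hX hsub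
  have hc2 : ContinuousOn (fun x => liR s (x ^ 2)) X := (continuousOn_liR_sq hs).mono hsub
  have hc1 : ContinuousOn (liR s) X := (continuousOn_liR hs).mono fun x hx =>
    ⟨(hsub hx).1, (hsub hx).2.trans one_pos⟩
  have hclam : ContinuousOn (lam s) X := by unfold lam; fun_prop
  -- Three uniform gaps: `δ₁` for the arc at `1`, `δ₂` for points near `-1` beyond the central arc,
  -- `δ₃` for the minor arcs. Halving the least one leaves room for bounded errors, which `δ τ^{-s}`
  -- absorbs for small `τ`.
  obtain ⟨δ₁, hδ₁, h1⟩ := exists_pos_le_of_isCompact hX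
    (f := fun x => lam s x + Real.Gamma s * liR s x * kappa s) (by fun_prop) (fun x hx => by
      have := mul_lt_mul_of_pos_left (hκ x hx) hG
      simp only [lam]
      linarith)
  have h2lt : (2 : ℝ) ^ (-(s / 2)) < 1 := Real.rpow_lt_one_of_one_lt_of_neg one_lt_two (by linarith)
  obtain ⟨δ₂, hδ₂, h2⟩ := exists_pos_le_of_isCompact hX
    (f := fun x => lam s x * (1 - 2 ^ (-(s / 2)))) (by fun_prop) (fun x hx =>
      mul_pos (lam_pos hs (hsub hx)) (by linarith))
  have h3lt : (3 : ℝ) ^ (-(s + 1)) < 2 ^ (-(s + 1)) :=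
    Real.rpow_lt_rpow_of_neg (by norm_num) (by norm_num) (by linarith)
  obtain ⟨δ₃, hδ₃, h3⟩ := exists_pos_le_of_isCompact hX
    (f := fun x => Real.Gamma s * ((2 ^ (-(s + 1)) - 3 ^ (-(s + 1))) * liR s (x ^ 2))) (by fun_prop)
    (fun x hx => mul_pos hG (mul_pos (by linarith)
      (liR_pos hs (sq_mem_Ioo (hsub hx)).1 (sq_mem_Ioo (hsub hx)).2)))
  set δ := min δ₁ (min δ₂ δ₃) / 2 with hδ
  have hδ0 : 0 < δ := half_pos (lt_min hδ₁ (lt_min hδ₂ hδ₃))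
  have hd1 : 2 * δ ≤ δ₁ := by rw [hδ]; linarith [min_le_left δ₁ (min δ₂ δ₃)]
  have hd2 : 2 * δ ≤ δ₂ := by
    rw [hδ]; linarith [min_le_right δ₁ (min δ₂ δ₃), min_le_left δ₂ δ₃]
  have hd3 : 2 * δ ≤ δ₃ := by
    rw [hδ]; linarith [min_le_right δ₁ (min δ₂ δ₃), min_le_right δ₂ δ₃]
  obtain ⟨M, hM, τ₁, hτ₁, hminor⟩ := exists_norm_logP_minor_le hs hρ0 hρ1 hδ0
  obtain ⟨C₁, hC₁⟩ := exists_norm_logP_sub_le hs hρ0 hρ1 M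
  obtain ⟨C₂, hC₂⟩ := exists_norm_logP_add_pi_sub_le hs hρ0 hρ1 M
  obtain ⟨τ₂, hτ₂, hC⟩ : ∃ τ₂ > 0, ∀ τ : ℝ, 0 < τ → τ < τ₂ → max C₁ C₂ ≤ δ * τ ^ (-s) := by
    have h := ((tendsto_rpow_neg_nhdsGT_zero (neg_lt_zero.2 hs)).const_mul_atTop hδ0)
    obtain ⟨τ₂, hτ₂, h'⟩ := mem_nhdsGT_iff_exists_Ioo_subset.1 (h.eventually_ge_atTop (max C₁ C₂))
    exact ⟨τ₂, hτ₂, fun τ h0 hlt => h' ⟨h0, hlt⟩⟩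
  refine ⟨δ, hδ0, min 1 (min τ₁ τ₂), lt_min one_pos (lt_min hτ₁ hτ₂), ?_⟩
  intro x hx τ ϑ hτ0 hττ hϑ1 hϑ2
  have hτ1 : τ < 1 := hττ.trans_le (min_le_left _ _)
  have hττ₁ : τ < τ₁ := hττ.trans_le ((min_le_right _ _).trans (min_le_left _ _))
  have hττ₂ : τ < τ₂ := hττ.trans_le ((min_le_right _ _).trans (min_le_right _ _))
  have hCτ := hC τ hτ0 hττ₂
  have hτs : 0 < τ ^ (-s) := by positivity
  set t : ℂ := τ - I * ϑ + Real.pi * I with ht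
  have htre : t.re = τ := by simp [ht]
  have htim : t.im = Real.pi - ϑ := by simp [ht]; ring
  have near_one : ∀ h : ℤ, |t.im - 2 * Real.pi * h| ≤ M * τ →
      (logP s x t).re ≤ (lam s x - δ) * τ ^ (-s) := by
    intro h hh
    rw [← logP_sub_two_pi s _ t h]
    set w : ℂ := t - 2 * Real.pi * I * h with hw
    have hwre : w.re = τ := by rw [← htre]; simp [hw]
    have hwim : w.im = t.im - 2 * Real.pi * h := by simp [hw]
    have hb := (abs_re_le_norm _).trans (hC₁ x w (hρ x hx) (hwre ▸ hτ0) (by rw [hwim, hwre]; exact hh))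
    rw [polylog_ofReal, Complex.Gamma_ofReal, ← ofReal_mul, sub_re, re_ofReal_mul] at hb
    have hb' := (abs_le.1 hb).2
    have h4 := neg_re_cpow_neg_le hs (hwre ▸ hτ0 : 0 < w.re)
    rw [hwre] at h4
    have h5 : 0 ≤ -(Real.Gamma s * liR s x) := by
      have := mul_pos hG (neg_pos.2 (liR_neg_of_neg hs (hsub hx)))
      linarith
    have h6 := mul_le_mul_of_nonneg_left h4 h5
    have h7 := mul_le_mul_of_nonneg_right (hd1.trans (h1 x hx)) hτs.le
    have h8 := (le_max_left C₁ C₂).trans hCτ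
    linarith
  by_cases hone : ∀ h : ℤ, M * τ < |t.im - 2 * Real.pi * h|
  swap
  · push Not at hone
    obtain ⟨h, hh⟩ := hone
    exact near_one h hh
  by_cases htwo : ∀ h : ℤ, 2 * M * τ < |2 * t.im - 2 * Real.pi * h|
  · have hb := (re_le_norm _).trans (hminor x t (hρ x hx) (htre ▸ hτ0) (htre ▸ hττ₁)
      (htre ▸ hone) (htre ▸ htwo))
    rw [htre, norm_real, Real.norm_eq_abs, sq_abs] at hb
    have h6 := mul_le_mul_of_nonneg_right (hd3.trans (h3 x hx)) hτs.le
    refine hb.trans ?_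
    unfold lam
    linarith
  · push Not at htwo
    obtain ⟨h, hh⟩ := htwo
    -- `2 Im t` lies near `2πh`: for even `h` the point `q` is near `1`, for odd `h` near `-1`.
    rcases Int.even_or_odd h with he | ho
    · obtain ⟨j, rfl⟩ := he
      refine near_one j ?_
      have e : 2 * t.im - 2 * Real.pi * ((j + j : ℤ) : ℝ) = 2 * (t.im - 2 * Real.pi * j) := by
        push_cast; ring
      rw [e, abs_mul, abs_two] at hh
      linarith
    · obtain ⟨j, rfl⟩ := ho
      rw [← logP_sub_two_pi s _ t j]
      set w : ℂ := t - 2 * Real.pi * I * j - Real.pi * I with hw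
      have hwre : w.re = τ := by rw [← htre]; simp [hw]
      have hwim : w.im = -ϑ - 2 * Real.pi * j := by
        simp only [hw, sub_im, htim]; simp; ring
      have hMw : |w.im| ≤ M * w.re := by
        have e : 2 * t.im - 2 * Real.pi * ((2 * j + 1 : ℤ) : ℝ) = 2 * w.im := by
          rw [htim, hwim]; push_cast; ring
        rw [e, abs_mul, abs_two] at hh
        rw [hwre]
        linarith
      -- For `j = 0` this is the exclusion of the central arc; for `j ≠ 0`, `|Im w| ≥ 2π - π > 1 >
      -- τ`.
      have hτim : τ ≤ |w.im| := by
        rcases eq_or_ne j 0 with rfl | hj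
        · rw [hwim]; simpa using hϑ1
        · have hj1 : (1 : ℝ) ≤ |(j : ℝ)| := by exact_mod_cast Int.one_le_abs hj
          have h7 := abs_sub_abs_le_abs_sub (2 * Real.pi * (j : ℝ)) (-ϑ)
          rw [abs_sub_comm, ← hwim, abs_mul, abs_neg, abs_of_pos (by positivity : 0 < 2 * Real.pi)] at h7
          have := Real.pi_gt_three
          nlinarith
      have e : t - 2 * Real.pi * I * j = w + Real.pi * I := by rw [hw]; ring
      rw [e]
      have hb := (re_le_norm _).trans (hC₂ x w (hρ x hx) (hwre ▸ hτ0) hMw)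
      rw [← ofReal_lam, sub_re, re_ofReal_mul] at hb
      -- Both coordinates are at least `τ` in absolute value, so `‖w‖^{-s}` loses the factor
      -- `2^{-s/2}` that defines `δ₂`.
      have hnw : τ * 2 ^ ((1 : ℝ) / 2) ≤ ‖w‖ := by
        rw [← Real.sqrt_eq_rpow, ← abs_of_pos hτ0, ← Real.sqrt_sq_eq_abs, ← Real.sqrt_mul (sq_nonneg _),
          Complex.norm_def]
        refine Real.sqrt_le_sqrt ?_
        rw [Complex.normSq_apply, hwre]
        have := mul_self_le_mul_self hτ0.le hτim
        rw [abs_mul_abs_self] at this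
        nlinarith
      have h7 : (w ^ (-(s : ℂ))).re ≤ τ ^ (-s) * 2 ^ (-(s / 2)) := by
        refine (re_le_norm _).trans ?_
        rw [norm_cpow_neg_real]
        refine (Real.rpow_le_rpow_of_nonpos (by positivity) hnw (by linarith)).trans (le_of_eq ?_)
        rw [Real.mul_rpow hτ0.le (by positivity), ← Real.rpow_mul (by norm_num)]
        congr 2
        ring
      have h8 := mul_le_mul_of_nonneg_left h7 (lam_pos hs (hsub hx)).le
      have h9 := mul_le_mul_of_nonneg_right (hd2.trans (h2 x hx)) hτs.le
      have h10 := (le_max_right C₁ C₂).trans hCτ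
      linarith

/-! ### Laplace's method at the saddle point. -/

/-- The normalized exponent `w + w^{-s}/s - (1 + 1/s)` at `w = 1 - iu`. -/
def saddleExp (s u : ℝ) : ℂ :=
  (1 - I * u) + (1 - I * u) ^ (-(s : ℂ)) / s - (1 + 1 / s)

theorem one_sub_I_mul_re (u : ℝ) : (1 - I * u : ℂ).re = 1 := by simp

theorem one_sub_I_mul_mem_slitPlane (u : ℝ) : (1 - I * u : ℂ) ∈ slitPlane :=
  Or.inl (by simp)

theorem continuous_saddleExp (s : ℝ) : Continuous (saddleExp s) := by
  unfold saddleExp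
  have : Continuous fun u : ℝ => (1 - I * u : ℂ) ^ (-(s : ℂ)) := by
    refine Continuous.cpow (by fun_prop) continuous_const one_sub_I_mul_mem_slitPlane
  fun_prop

/-- The graph of the convex function `(1+v)^{-p}` lies below its chord on `[0,1]`; here this comes
from applying Bernoulli's inequality twice. -/
theorem one_add_rpow_neg_le {p v : ℝ} (hp : 0 < p) (h0 : 0 ≤ v) (h1 : v ≤ 1) :
    (1 + v) ^ (-p) ≤ 1 - v * (1 - 2 ^ (-p)) := by
  have a1 : (2 : ℝ) ^ v ≤ 1 + v := by
    have := rpow_one_add_le_one_add_mul_self (s := 1) (by norm_num) h0 h1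
    norm_num at this
    exact this
  have a2 : (1 + v) ^ (-p) ≤ (2 ^ (-p)) ^ v := by
    rw [← Real.rpow_mul (by norm_num), mul_comm, Real.rpow_mul (by norm_num)]
    exact Real.rpow_le_rpow_of_nonpos (by positivity) a1 (by linarith)
  have a3 := rpow_one_add_le_one_add_mul_self (s := (2 : ℝ) ^ (-p) - 1)
    (by have : (0 : ℝ) < 2 ^ (-p) := by positivity
        linarith) h0 h1
  rw [add_sub_cancel] at a3
  linarith

/-- The constant in the quadratic upper bound for `Re (saddleExp s u)`. -/
def saddleC (s : ℝ) : ℝ := (1 - 2 ^ (-(s / 2))) / s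

theorem saddleC_pos {s : ℝ} (hs : 0 < s) : 0 < saddleC s := by
  have : (2 : ℝ) ^ (-(s / 2)) < 1 := Real.rpow_lt_one_of_one_lt_of_neg one_lt_two (by linarith)
  exact div_pos (by linarith) hs

/-- The chord bound with `v = u²`, applied to `|1 - iu|^{-s} = (1+u²)^{-s/2}`, gives Gaussian
domination on the whole central arc and not only close to the saddle. -/
theorem re_saddleExp_le {s u : ℝ} (hs : 0 < s) (hu : |u| ≤ 1) :
    (saddleExp s u).re ≤ -(saddleC s * u ^ 2) := by
  have h1 : ((1 - I * u : ℂ) ^ (-(s : ℂ))).re ≤ (1 + u ^ 2) ^ (-(s / 2)) := by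
    refine (re_le_norm _).trans ?_
    rw [norm_cpow_neg_real, Complex.norm_def, Real.sqrt_eq_rpow, ← Real.rpow_mul (normSq_nonneg _)]
    refine le_of_eq ?_
    congr 1
    · rw [normSq_apply]; simp; ring
    · ring
  have h2 := one_add_rpow_neg_le (p := s / 2) (by positivity) (sq_nonneg u)
    ((sq_le_one_iff_abs_le_one u).2 hu)
  have e : (saddleExp s u).re = (((1 - I * u : ℂ) ^ (-(s : ℂ))).re - 1) / s := by
    rw [saddleExp, sub_re, add_re, one_sub_I_mul_re, div_ofReal_re, add_re]
    rw [show (1 / (s : ℂ)).re = 1 / s by rw [← ofReal_one, ← ofReal_div, ofReal_re]]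
    simp
    ring
  rw [e, saddleC, div_mul_eq_mul_div, ← neg_div]
  exact div_le_div_of_nonneg_right (by linarith) hs.le

theorem norm_exp_mul_saddleExp_le {s N u : ℝ} (hs : 0 < s) (hN : 0 ≤ N) (hu : |u| ≤ 1) :
    ‖cexp (N * saddleExp s u)‖ ≤ Real.exp (-(saddleC s * N) * u ^ 2) := by
  rw [norm_exp, re_ofReal_mul]
  refine Real.exp_le_exp.2 ?_
  have := mul_le_mul_of_nonneg_left (re_saddleExp_le hs hu) hN
  linarith

/-- Second order Taylor expansion of `saddleExp` at `0`. -/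
theorem tendsto_saddleExp_div_sq {s : ℝ} (hs : 0 < s) :
    Tendsto (fun u : ℝ => saddleExp s u / (u : ℂ) ^ 2) (𝓝[≠] 0) (𝓝 (-((s + 1) / 2))) := by
  have hs0 : (s : ℂ) ≠ 0 := ofReal_ne_zero.2 hs.ne'
  rw [Metric.tendsto_nhdsWithin_nhds]
  intro ε hε
  have hd : HasDerivAt (fun z : ℂ => z ^ (-(s : ℂ) - 1)) ((-(s : ℂ) - 1) * 1 ^ (-(s : ℂ) - 1 - 1) * 1) 1 :=
    (hasDerivAt_id' 1).cpow_const one_mem_slitPlane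
  rw [hasDerivAt_iff_isLittleO] at hd
  have hd' := hd.def (half_pos hε)
  obtain ⟨δ, hδ, hball⟩ := Metric.eventually_nhds_iff_ball.1 hd'
  refine ⟨min δ 1, lt_min hδ one_pos, fun u hu0 hu => ?_⟩
  rw [Real.dist_0_eq_abs] at hu
  have hu0' : u ≠ 0 := hu0
  -- Once the quadratic term is removed, the derivative is the first order Taylor remainder of
  -- `-z^{-s-1}` at `1`, hence `o(z - 1)`; the mean value inequality then gives `o(u²)`.
  set K : ℂ → ℂ := fun z => z + z ^ (-(s : ℂ)) / s - (s + 1) / 2 * (z - 1) ^ 2 with hK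
  have hKd : ∀ z ∈ Metric.closedBall (1 : ℂ) |u|, HasDerivWithinAt K
      (1 + (-(s : ℂ) * z ^ (-(s : ℂ) - 1) * 1) / s - (s + 1) / 2 * (((2 : ℕ) : ℂ) * (z - 1) ^ (2 - 1) * 1))
      (Metric.closedBall (1 : ℂ) |u|) z := by
    intro z hz
    have hz1 : ‖z - 1‖ < 1 := (mem_closedBall_iff_norm.1 hz).trans_lt (hu.trans_le (min_le_right _ _))
    have hzs : z ∈ slitPlane := by
      refine Or.inl ?_
      have := (abs_re_le_norm (z - 1)).trans_lt hz1
      rw [sub_re, one_re, abs_lt] at this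
      linarith
    refine HasDerivAt.hasDerivWithinAt ?_
    exact ((hasDerivAt_id' z).add (((hasDerivAt_id' z).cpow_const hzs).div_const _)).sub
      ((((hasDerivAt_id' z).sub_const 1).pow 2).const_mul _)
  have hKb : ∀ z ∈ Metric.closedBall (1 : ℂ) |u|,
      ‖1 + (-(s : ℂ) * z ^ (-(s : ℂ) - 1) * 1) / s -
        (s + 1) / 2 * (((2 : ℕ) : ℂ) * (z - 1) ^ (2 - 1) * 1)‖ ≤ ε / 2 * |u| := by
    intro z hz
    have h1 := hball z (Metric.closedBall_subset_ball (hu.trans_le (min_le_left _ _)) hz)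
    have h2 := mem_closedBall_iff_norm.1 hz
    rw [smul_eq_mul, one_cpow, one_cpow] at h1
    have e : 1 + (-(s : ℂ) * z ^ (-(s : ℂ) - 1) * 1) / s -
        (s + 1) / 2 * (((2 : ℕ) : ℂ) * (z - 1) ^ (2 - 1) * 1) =
        -(z ^ (-(s : ℂ) - 1) - 1 - (z - 1) * ((-(s : ℂ) - 1) * 1 * 1)) := by
      push_cast
      field_simp
      ring
    rw [e, norm_neg]
    exact h1.trans (by gcongr)
  have hmem : (1 - I * u : ℂ) ∈ Metric.closedBall (1 : ℂ) |u| := by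
    rw [mem_closedBall_iff_norm]
    simp
  have hmv := (convex_closedBall (1 : ℂ) |u|).norm_image_sub_le_of_norm_hasDerivWithin_le hKd hKb
    (Metric.mem_closedBall_self (abs_nonneg u)) hmem
  have e1 : K (1 - I * u) - K 1 = saddleExp s u + (s + 1) / 2 * (u : ℂ) ^ 2 := by
    simp only [hK, saddleExp, one_cpow]
    linear_combination (-((s + 1) / 2 : ℂ) * (u : ℂ) ^ 2) * I_sq
  have e2 : ‖(1 - I * u : ℂ) - 1‖ = |u| := by simp
  rw [e1, e2] at hmv
  have huC : (u : ℂ) ^ 2 ≠ 0 := pow_ne_zero _ (ofReal_ne_zero.2 hu0')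
  rw [dist_eq_norm, show saddleExp s u / (u : ℂ) ^ 2 - -((s + 1) / 2 : ℂ) =
    (saddleExp s u + (s + 1) / 2 * (u : ℂ) ^ 2) / (u : ℂ) ^ 2 by
      rw [eq_div_iff huC, sub_mul, div_mul_cancel₀ _ huC]; ring, norm_div]
  have e3 : ‖(u : ℂ) ^ 2‖ = |u| * |u| := by rw [norm_pow, norm_real, Real.norm_eq_abs, sq]
  have hupos : 0 < |u| := abs_pos.2 hu0'
  rw [e3, div_lt_iff₀ (by positivity)]
  refine hmv.trans_lt ?_
  rw [mul_assoc]
  have : 0 < |u| * |u| := by positivity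
  nlinarith

theorem tendsto_mul_saddleExp {s : ℝ} (hs : 0 < s) (v : ℝ) :
    Tendsto (fun N : ℝ => (N : ℂ) * saddleExp s (v / √N)) atTop
      (𝓝 (((-((s + 1) / 2) * v ^ 2 : ℝ) : ℂ))) := by
  rcases eq_or_ne v 0 with rfl | hv
  · have : saddleExp s 0 = 0 := by simp [saddleExp]
    simp [this]
  have hsq : Tendsto (fun N : ℝ => v / √N) atTop (𝓝[≠] 0) := by
    refine tendsto_nhdsWithin_iff.2 ⟨?_, ?_⟩
    · exact Tendsto.const_div_atTop Real.tendsto_sqrt_atTop v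
    · filter_upwards [eventually_gt_atTop 0] with N hN
      exact div_ne_zero hv (Real.sqrt_pos.2 hN).ne'
  have h1 := ((tendsto_saddleExp_div_sq hs).comp hsq).const_mul ((v : ℂ) ^ 2)
  have e : (v : ℂ) ^ 2 * -((s + 1) / 2) = ((-((s + 1) / 2) * v ^ 2 : ℝ) : ℂ) := by
    push_cast; ring
  rw [e] at h1
  refine h1.congr' ?_
  filter_upwards [eventually_gt_atTop 0] with N hN
  have hvC : (v : ℂ) ≠ 0 := ofReal_ne_zero.2 hv
  have hsN : ((√N : ℝ) : ℂ) ^ 2 = N := by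
    rw [← ofReal_pow, Real.sq_sqrt hN.le]
  simp only [Function.comp]
  rw [ofReal_div, div_pow, hsN]
  field_simp

/-- Laplace's method for the saddle point integral. -/
theorem tendsto_sqrt_mul_integral_saddleExp {s : ℝ} (hs : 0 < s) :
    Tendsto (fun N : ℝ => (√N : ℂ) * ∫ u in (-1 : ℝ)..1, cexp (N * saddleExp s u)) atTop
      (𝓝 ((√(2 * Real.pi / (s + 1)) : ℝ) : ℂ)) := by
  -- The substitution `u = v/√N`, extended by zero to the real line for dominated convergence.
  set F : ℝ → ℝ → ℂ := fun N v => (Ioc (-√N) (√N)).indicator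
    (fun v : ℝ => cexp (N * saddleExp s (v / √N))) v with hF
  have hlim : Tendsto (fun N => ∫ v, F N v) atTop
      (𝓝 (∫ v : ℝ, ((Real.exp (-((s + 1) / 2) * v ^ 2) : ℝ) : ℂ))) := by
    refine tendsto_integral_filter_of_dominated_convergence
      (fun v => Real.exp (-saddleC s * v ^ 2)) ?_ ?_ (integrable_exp_neg_mul_sq (saddleC_pos hs)) ?_
    · filter_upwards with N
      refine AEStronglyMeasurable.indicator ?_ measurableSet_Ioc
      have : Continuous fun v : ℝ => cexp (N * saddleExp s (v / √N)) := by
        have := (continuous_saddleExp s).comp (continuous_id.div_const (√N))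
        exact (continuous_const.mul this).cexp
      exact this.aestronglyMeasurable
    · filter_upwards [eventually_gt_atTop 0] with N hN
      refine Eventually.of_forall fun v => ?_
      simp only [hF, indicator]
      have hsN := Real.sqrt_pos.2 hN
      split_ifs with hv
      · have hle : |v / √N| ≤ 1 := by
          rw [abs_div, abs_of_pos hsN, div_le_one hsN]
          exact abs_le.2 ⟨hv.1.le, hv.2⟩
        refine (norm_exp_mul_saddleExp_le hs hN.le hle).trans (le_of_eq ?_)
        rw [div_pow, Real.sq_sqrt hN.le]
        congr 1
        field_simp
      · rw [norm_zero]; positivity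
    · refine Eventually.of_forall fun v => ?_
      have h1 := (tendsto_mul_saddleExp hs v).cexp
      rw [← ofReal_exp] at h1
      refine h1.congr' ?_
      have h2 := Real.tendsto_sqrt_atTop.eventually_gt_atTop |v|
      filter_upwards [h2] with N hN
      simp only [hF]
      rw [indicator_of_mem]
      have := abs_lt.1 hN
      exact ⟨this.1, this.2.le⟩
  rw [integral_complex_ofReal, integral_gaussian] at hlim
  have e : Real.pi / ((s + 1) / 2) = 2 * Real.pi / (s + 1) := by field_simp
  rw [e] at hlim
  refine hlim.congr' ?_
  filter_upwards [eventually_gt_atTop 0] with N hN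
  have hsN := Real.sqrt_pos.2 hN
  have h1 := intervalIntegral.integral_comp_div (a := -√N) (b := √N)
    (fun u : ℝ => cexp (N * saddleExp s u)) hsN.ne'
  rw [neg_div, div_self hsN.ne', real_smul] at h1
  rw [← h1, intervalIntegral.integral_of_le (by linarith), ← integral_indicator measurableSet_Ioc]

/-- The error on the central arc is relative to the modulus of the integrand. This bound has the
order `N^{-1/2}` of the main term, so a small relative error stays small. -/
theorem integral_norm_exp_saddleExp_le {s N : ℝ} (hs : 0 < s) (hN : 0 < N) :
    ∫ u in (-1 : ℝ)..1, ‖cexp (N * saddleExp s u)‖ ≤ √(Real.pi / saddleC s) / √N := by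
  have hc := saddleC_pos hs
  have hint := integrable_exp_neg_mul_sq (b := saddleC s * N) (by positivity)
  have hcont : Continuous fun u : ℝ => ‖cexp (N * saddleExp s u)‖ :=
    (continuous_const.mul (continuous_saddleExp s)).cexp.norm
  calc ∫ u in (-1 : ℝ)..1, ‖cexp (N * saddleExp s u)‖
      ≤ ∫ u in (-1 : ℝ)..1, Real.exp (-(saddleC s * N) * u ^ 2) := by
        refine intervalIntegral.integral_mono_on (by norm_num) (hcont.intervalIntegrable _ _)
          hint.intervalIntegrable fun u hu => ?_
        exact norm_exp_mul_saddleExp_le hs hN.le (abs_le.2 hu)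
    _ ≤ ∫ u : ℝ, Real.exp (-(saddleC s * N) * u ^ 2) := by
        rw [intervalIntegral.integral_of_le (by norm_num)]
        exact setIntegral_le_integral hint (Eventually.of_forall fun u => (Real.exp_pos _).le)
    _ = √(Real.pi / saddleC s) / √N := by
        rw [integral_gaussian, ← div_div, Real.sqrt_div (by positivity)]

/-! ### Evaluation of the Cauchy integral. -/

/-- The constant term of `log P(x, -e^{-w})` as `w → 0`. -/
def constC (s : ℝ) (z : ℂ) : ℂ := -expB s * Complex.log (1 - z) - expA s * Complex.log (1 + z)

theorem norm_constC_le (s : ℝ) {z : ℂ} {ρ : ℝ} (hz : ‖z‖ ≤ ρ) (hρ : ρ < 1) :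
    ‖constC s z‖ ≤ (‖expB s‖ + ‖expA s‖) * (1 / (1 - ρ)) := by
  have h1 : ∀ u : ℂ, ‖u‖ ≤ ρ → ‖Complex.log (1 - u)‖ ≤ 1 / (1 - ρ) := fun u hu =>
    (norm_log_one_sub_le hρ hu).trans (div_le_div_of_nonneg_right (hu.trans hρ.le) (by linarith))
  have h2 := h1 z hz
  have h3 := h1 (-z) (by rwa [norm_neg])
  rw [sub_neg_eq_add] at h3
  refine (norm_sub_le _ _).trans ?_
  rw [norm_mul, norm_mul, norm_neg, add_mul]
  gcongr

/-- The integrand of Cauchy's formula for `Q_n`. -/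
def arcIntegrand (s : ℝ) (n : ℕ) (z : ℂ) (τ ϑ : ℝ) : ℂ :=
  cexp (n * (τ - I * ϑ) + logP s z (τ - I * ϑ + Real.pi * I))

theorem continuous_arcIntegrand (s : ℝ) (n : ℕ) {z : ℂ} (hz : ‖z‖ < 1) {τ : ℝ} (hτ : 0 < τ) :
    Continuous (arcIntegrand s n z τ) := by
  have h1 : arcIntegrand s n z τ = fun ϑ : ℝ => cexp (n * (τ - I * ϑ)) *
      eulerProduct (powerSeq s) z (cexp (-(τ - I * ϑ + Real.pi * I))) := by
    funext ϑ
    rw [arcIntegrand, Complex.exp_add, eulerProduct_exp_neg s hz (by simpa using hτ)]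
  rw [h1]
  refine Continuous.mul (by fun_prop) ?_
  refine (differentiableOn_eulerProduct s hz.le).continuousOn.comp_continuous (by fun_prop) fun ϑ => ?_
  rw [mem_ball_zero_iff, norm_exp]
  simpa using hτ

/-- The central arc. -/
theorem arcIntegrand_center {s : ℝ} (hs : 0 < s) {n : ℕ} {z : ℂ} {Λ τ N : ℝ} (hτ : 0 < τ)
    (hN : N = n * τ) (hN' : N = s * Λ * τ ^ (-s)) (u : ℝ) :
    arcIntegrand s n z τ (u * τ) = cexp ((1 + 1 / s) * N + constC s z) *
      (cexp (N * saddleExp s u) * cexp (logP s z ((τ * (1 - I * u) : ℂ) + Real.pi * I) -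
        Λ * (τ * (1 - I * u) : ℂ) ^ (-(s : ℂ)) - constC s z)) := by
  have hs0 : (s : ℂ) ≠ 0 := ofReal_ne_zero.2 hs.ne'
  rw [arcIntegrand, ← Complex.exp_add, ← Complex.exp_add]
  have e1 : (τ : ℂ) - I * ((u * τ : ℝ) : ℂ) = τ * (1 - I * u) := by push_cast; ring
  -- The saddle condition says `Λ τ^{-s} = N/s`, so the exponent becomes `N(w + w^{-s}/s)` at `w = 1
  -- - iu`.
  have e2 : (Λ : ℂ) * (τ * (1 - I * u) : ℂ) ^ (-(s : ℂ)) = N / s * (1 - I * u) ^ (-(s : ℂ)) := by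
    rw [ofReal_mul_cpow hτ (slitPlane_ne_zero (one_sub_I_mul_mem_slitPlane u)), hN', ← ofReal_neg,
      ← ofReal_cpow hτ.le]
    push_cast
    field_simp
  have e3 : (n : ℂ) * (τ * (1 - I * u)) = N * (1 - I * u) := by
    rw [hN]; push_cast; ring
  rw [e1, e2, e3, saddleExp]
  congr 1
  ring

theorem norm_exp_sub_one_le_two_mul {e : ℂ} {ε : ℝ} (hε : ε ≤ 1) (he : ‖e‖ ≤ ε) :
    ‖cexp e - 1‖ ≤ 2 * ε :=
  (Complex.norm_exp_sub_one_le (he.trans hε)).trans (by linarith)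

/-- The asymptotic evaluation of the Cauchy integral, uniformly in `x`. -/
theorem exists_norm_integral_sub_le {s : ℝ} (hs : 0 < s) {X : Set ℝ} (hX : IsCompact X)
    (hsub : X ⊆ Ioo (-1 : ℝ) 0)
    (hκ : ∀ x ∈ X, -liR s x * kappa s < 2 ^ (-(s + 1)) * liR s (x ^ 2)) {ε : ℝ} (hε : 0 < ε) :
    ∃ τ₀ > 0, ∀ x ∈ X, ∀ (n : ℕ) (τ N : ℝ), 0 < τ → τ < τ₀ → N = n * τ →
      N = s * lam s x * τ ^ (-s) →
      ‖(√N : ℂ) * (∫ ϑ in (-Real.pi)..Real.pi, arcIntegrand s n x τ ϑ) -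
          τ * cexp ((1 + 1 / s) * N + constC s x) * (√(2 * Real.pi / (s + 1)) : ℝ)‖ ≤
        ε * (τ * ‖cexp ((1 + 1 / s) * N + constC s x)‖) := by
  obtain ⟨ρ, hρ0, hρ1, hρ⟩ := exists_lt_one_bound hX hsub
  obtain ⟨δ, hδ, τ₁, hτ₁, houter⟩ := exists_re_logP_le hs hX hsub hκ
  have hclam : ContinuousOn (lam s) X := by
    have := (continuousOn_liR_sq hs).mono hsub
    unfold lam
    fun_prop
  obtain ⟨l₀, hl₀, hlmin⟩ := exists_pos_le_of_isCompact hX hclam fun x hx => lam_pos hs (hsub hx)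
  obtain ⟨l₁, hlmax⟩ : ∃ l₁, ∀ x ∈ X, lam s x ≤ l₁ := by
    obtain ⟨b, hb⟩ := hX.bddAbove_image hclam
    exact ⟨b, fun x hx => hb (mem_image_of_mem _ hx)⟩
  set c₁ := √(Real.pi / saddleC s) with hc₁
  have hc₁0 : 0 ≤ c₁ := Real.sqrt_nonneg _
  set c₀ := (‖expB s‖ + ‖expA s‖) * (1 / (1 - ρ)) with hc₀
  -- Central approximation, Laplace limit and outer arcs each receive `ε/3`. The bound by `1`
  -- permits `|e^z - 1| ≤ 2|z|`.
  set ε₁ := min 1 (ε / (6 * (c₁ + 1))) with hε₁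
  have hε₁0 : 0 < ε₁ := lt_min one_pos (by positivity)
  have hε₁c : 2 * ε₁ * c₁ ≤ ε / 3 := by
    have h1 : ε₁ ≤ ε / (6 * (c₁ + 1)) := min_le_right _ _
    rw [le_div_iff₀ (by positivity)] at h1
    nlinarith
  obtain ⟨τ₂, hτ₂, hcenter⟩ := exists_norm_logP_add_pi_sub_const_le hs hρ0 hρ1 1 hε₁0
  obtain ⟨N₀, hN₀⟩ := eventually_atTop.1 ((tendsto_sqrt_mul_integral_saddleExp hs).eventually
    (Metric.closedBall_mem_nhds _ (show 0 < ε / 3 by positivity)))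
  have htend : Tendsto (fun τ : ℝ => τ ^ (-s)) (𝓝[>] 0) atTop :=
    tendsto_rpow_neg_nhdsGT_zero (neg_lt_zero.2 hs)
  obtain ⟨τ₃, hτ₃, hNbig⟩ : ∃ τ₃ > 0, ∀ τ : ℝ, 0 < τ → τ < τ₃ → N₀ ≤ s * l₀ * τ ^ (-s) := by
    have h := (htend.const_mul_atTop (show 0 < s * l₀ by positivity)).eventually_ge_atTop N₀
    obtain ⟨τ₃, h1, h2⟩ := mem_nhdsGT_iff_exists_Ioo_subset.1 h
    exact ⟨τ₃, h1, fun τ h0 hlt => h2 ⟨h0, hlt⟩⟩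
  -- On the outer arcs the loss is `√N / τ`, a multiple of the power `1/2 + 1/s` of `τ^{-s}`; the
  -- gap `e^{-δ τ^{-s}}` defeats it.
  obtain ⟨τ₄, hτ₄, hexp⟩ : ∃ τ₄ > 0, ∀ τ : ℝ, 0 < τ → τ < τ₄ →
      2 * Real.pi * Real.exp c₀ * √(s * l₁) *
        ((τ ^ (-s)) ^ ((1 : ℝ) / 2 + 1 / s) * Real.exp (-δ * τ ^ (-s))) ≤ ε / 3 := by
    have h1 := ((tendsto_rpow_mul_exp_neg_mul_atTop_nhds_zero ((1 : ℝ) / 2 + 1 / s) δ hδ).comp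
      htend).const_mul (2 * Real.pi * Real.exp c₀ * √(s * l₁))
    rw [mul_zero] at h1
    obtain ⟨τ₄, h2, h3⟩ := mem_nhdsGT_iff_exists_Ioo_subset.1
      (h1.eventually (gt_mem_nhds (show 0 < ε / 3 by positivity)))
    exact ⟨τ₄, h2, fun τ h0 hlt => (show _ < _ from h3 ⟨h0, hlt⟩).le⟩
  refine ⟨min 1 (min (min τ₁ τ₂) (min τ₃ τ₄)), by positivity, ?_⟩
  intro x hx n τ N hτ hττ hN hN'
  obtain ⟨hτ1, hττ⟩ := lt_min_iff.1 hττ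
  obtain ⟨hττ', hττ⟩ := lt_min_iff.1 hττ
  obtain ⟨hττ₁, hττ₂⟩ := lt_min_iff.1 hττ'
  obtain ⟨hττ₃, hττ₄⟩ := lt_min_iff.1 hττ
  have hz1 : ‖(x : ℂ)‖ < 1 := (hρ x hx).trans_lt hρ1
  have hΛ := lam_pos hs (hsub hx)
  have hτs : 0 < τ ^ (-s) := by positivity
  have hNpos : 0 < N := by rw [hN']; positivity
  have hN₀N : N₀ ≤ N := by
    refine (hNbig τ hτ hττ₃).trans ?_
    rw [hN']
    gcongr
    exact hlmin x hx
  set E : ℂ := cexp ((1 + 1 / s) * N + constC s x) with hE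
  have hEpos : 0 < ‖E‖ := norm_pos_iff.2 (Complex.exp_ne_zero _)
  have hsN := Real.sqrt_pos.2 hNpos
  have hcont := continuous_arcIntegrand s n hz1 hτ
  have hcs : Continuous fun u : ℝ => cexp (N * saddleExp s u) :=
    (continuous_const.mul (continuous_saddleExp s)).cexp
  have hpi1 : (1 : ℝ) < Real.pi := by linarith [Real.pi_gt_three]
  -- the central arc
  have hC : ‖(∫ ϑ in (-τ)..τ, arcIntegrand s n x τ ϑ) -
      τ * E * ∫ u in (-1 : ℝ)..1, cexp (N * saddleExp s u)‖ ≤ τ * ‖E‖ * (2 * ε₁ * (c₁ / √N)) := by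
    have h1 := intervalIntegral.integral_comp_mul_right (a := -1) (b := 1)
      (arcIntegrand s n x τ) hτ.ne'
    rw [neg_one_mul, one_mul, real_smul, ofReal_inv] at h1
    have hτC : (τ : ℂ) ≠ 0 := ofReal_ne_zero.2 hτ.ne'
    have h2 : (∫ ϑ in (-τ)..τ, arcIntegrand s n x τ ϑ) =
        τ * ∫ u in (-1 : ℝ)..1, arcIntegrand s n x τ (u * τ) := by
      rw [h1]; field_simp
    rw [h2, mul_assoc, ← mul_sub, norm_mul, norm_real, Real.norm_of_nonneg hτ.le, mul_assoc]
    refine mul_le_mul_of_nonneg_left ?_ hτ.le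
    have hi1 : Continuous fun u : ℝ => arcIntegrand s n x τ (u * τ) :=
      hcont.comp (continuous_mul_const τ)
    have hi2 : Continuous fun u : ℝ => E * cexp (N * saddleExp s u) := continuous_const.mul hcs
    rw [← intervalIntegral.integral_const_mul, ← intervalIntegral.integral_sub
      (hi1.intervalIntegrable _ _) (hi2.intervalIntegrable _ _)]
    have h3 : ∀ u ∈ Ioc (-1 : ℝ) 1, ‖arcIntegrand s n x τ (u * τ) - E * cexp (N * saddleExp s u)‖ ≤
        ‖E‖ * (2 * ε₁) * ‖cexp (N * saddleExp s u)‖ := by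
      intro u hu
      rw [arcIntegrand_center hs hτ hN hN' u, ← hE, ← mul_sub, ← mul_sub_one, norm_mul, norm_mul,
        mul_assoc, mul_comm (2 * ε₁)]
      refine mul_le_mul_of_nonneg_left (mul_le_mul_of_nonneg_left ?_ (norm_nonneg _)) (norm_nonneg _)
      refine norm_exp_sub_one_le_two_mul (min_le_left _ _) ?_
      have hre : ((τ : ℂ) * (1 - I * u)).re = τ := by simp
      have him : ((τ : ℂ) * (1 - I * u)).im = -(τ * u) := by simp
      rw [ofReal_lam]
      refine hcenter x _ (hρ x hx) (by rw [hre]; exact hτ) ?_ (by rw [hre]; exact hττ₂)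
      rw [hre, him, abs_neg, abs_mul, abs_of_pos hτ, mul_comm]
      gcongr
      exact abs_le.2 ⟨hu.1.le, hu.2⟩
    have hi3 : Continuous fun u : ℝ => ‖E‖ * (2 * ε₁) * ‖cexp (N * saddleExp s u)‖ :=
      continuous_const.mul hcs.norm
    have h4 := intervalIntegral.norm_integral_le_of_norm_le (μ := volume) (by norm_num : (-1 : ℝ) ≤ 1)
      (Eventually.of_forall h3) (hi3.intervalIntegrable _ _)
    refine h4.trans ?_
    rw [intervalIntegral.integral_const_mul, mul_assoc]
    gcongr
    exact integral_norm_exp_saddleExp_le hs hNpos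
  -- the rest of the circle
  set Bd : ℝ := ‖E‖ * (Real.exp c₀ * Real.exp (-δ * τ ^ (-s))) with hBd
  have hout : ∀ ϑ : ℝ, τ ≤ |ϑ| → |ϑ| ≤ Real.pi → ‖arcIntegrand s n x τ ϑ‖ ≤ Bd := by
    intro ϑ h1 h2
    have h3 := houter x hx τ ϑ hτ hττ₁ h1 h2
    have h4 : -c₀ ≤ (constC s x).re :=
      (neg_le_neg (norm_constC_le s (hρ x hx) hρ1)).trans (abs_le.1 (abs_re_le_norm _)).1
    have e1 : ((1 + 1 / (s : ℂ)) * N + constC s x).re = (1 + 1 / s) * N + (constC s x).re := by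
      rw [add_re, re_mul_ofReal, add_re, one_re]
      rw [show (1 / (s : ℂ)).re = 1 / s by rw [← ofReal_one, ← ofReal_div, ofReal_re]]
    have e2 : ((n : ℂ) * (τ - I * ϑ)).re = N := by
      rw [hN]; simp
    rw [hBd, hE, arcIntegrand, norm_exp, norm_exp, ← Real.exp_add, ← Real.exp_add, e1, add_re, e2]
    refine Real.exp_le_exp.2 ?_
    have e3 : lam s x * τ ^ (-s) = N / s := by rw [hN']; field_simp
    have e4 : (1 + 1 / s) * N = N + N / s := by ring
    rw [e4]
    linarith
  have hBd0 : 0 ≤ Bd := by positivity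
  have hO1 : ‖∫ ϑ in (-Real.pi)..(-τ), arcIntegrand s n x τ ϑ‖ ≤ Bd * Real.pi := by
    refine (intervalIntegral.norm_integral_le_of_norm_le_const (C := Bd) fun ϑ hϑ => ?_).trans ?_
    · rw [uIoc_of_le (by linarith)] at hϑ
      have : |ϑ| = -ϑ := abs_of_neg (by linarith [hϑ.2])
      exact hout ϑ (by rw [this]; linarith [hϑ.2]) (by rw [this]; linarith [hϑ.1])
    · gcongr
      rw [abs_of_nonneg (by linarith)]
      linarith
  have hO2 : ‖∫ ϑ in τ..Real.pi, arcIntegrand s n x τ ϑ‖ ≤ Bd * Real.pi := by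
    refine (intervalIntegral.norm_integral_le_of_norm_le_const (C := Bd) fun ϑ hϑ => ?_).trans ?_
    · rw [uIoc_of_le (by linarith)] at hϑ
      have : |ϑ| = ϑ := abs_of_pos (by linarith [hϑ.1])
      exact hout ϑ (by rw [this]; linarith [hϑ.1]) (by rw [this]; linarith [hϑ.2])
    · gcongr
      rw [abs_of_nonneg (by linarith)]
      linarith
  have hOuter : √N * (2 * (Bd * Real.pi)) ≤ ε / 3 * (τ * ‖E‖) := by
    have h1 := hexp τ hτ hττ₄
    have h2 : √N ≤ √(s * l₁) * (τ * (τ ^ (-s)) ^ ((1 : ℝ) / 2 + 1 / s)) := by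
      have e1 : τ * (τ ^ (-s)) ^ ((1 : ℝ) / 2 + 1 / s) = √(τ ^ (-s)) := by
        rw [Real.rpow_add hτs, ← Real.sqrt_eq_rpow, ← Real.rpow_mul hτ.le,
          show -s * (1 / s) = -1 by field_simp, Real.rpow_neg_one]
        field_simp
      rw [e1, ← Real.sqrt_mul' _ hτs.le, hN']
      refine Real.sqrt_le_sqrt ?_
      have := hlmax x hx
      gcongr
    calc √N * (2 * (Bd * Real.pi))
        ≤ (√(s * l₁) * (τ * (τ ^ (-s)) ^ ((1 : ℝ) / 2 + 1 / s))) * (2 * (Bd * Real.pi)) := by gcongr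
      _ = (2 * Real.pi * Real.exp c₀ * √(s * l₁) *
        ((τ ^ (-s)) ^ ((1 : ℝ) / 2 + 1 / s) * Real.exp (-δ * τ ^ (-s)))) * (τ * ‖E‖) := by
          rw [hBd]; ring
      _ ≤ _ := by gcongr
  have hsplit : (∫ ϑ in (-Real.pi)..Real.pi, arcIntegrand s n x τ ϑ) =
      (∫ ϑ in (-Real.pi)..(-τ), arcIntegrand s n x τ ϑ) + (∫ ϑ in (-τ)..τ, arcIntegrand s n x τ ϑ) +
      ∫ ϑ in τ..Real.pi, arcIntegrand s n x τ ϑ := by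
    rw [intervalIntegral.integral_add_adjacent_intervals (hcont.intervalIntegrable _ _)
      (hcont.intervalIntegrable _ _), intervalIntegral.integral_add_adjacent_intervals
      (hcont.intervalIntegrable _ _) (hcont.intervalIntegrable _ _)]
  have hLap := hN₀ N hN₀N
  rw [dist_eq_norm] at hLap
  set J := ∫ u in (-1 : ℝ)..1, cexp (N * saddleExp s u) with hJ
  set O1 := ∫ ϑ in (-Real.pi)..(-τ), arcIntegrand s n x τ ϑ
  set O2 := ∫ ϑ in τ..Real.pi, arcIntegrand s n x τ ϑ
  set Ce := ∫ ϑ in (-τ)..τ, arcIntegrand s n x τ ϑ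
  have hnsN : ‖((√N : ℝ) : ℂ)‖ = √N := by rw [norm_real, Real.norm_of_nonneg hsN.le]
  rw [hsplit]
  have edecomp : (√N : ℂ) * (O1 + Ce + O2) - τ * E * ((√(2 * Real.pi / (s + 1)) : ℝ) : ℂ) =
      (√N : ℂ) * (Ce - τ * E * J) + τ * E * ((√N : ℂ) * J - ((√(2 * Real.pi / (s + 1)) : ℝ) : ℂ)) +
      (√N : ℂ) * (O1 + O2) := by ring
  rw [edecomp]
  refine (norm_add₃_le).trans ?_
  rw [norm_mul, norm_mul, norm_mul, norm_mul, hnsN, norm_real, Real.norm_of_nonneg hτ.le]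
  have t1 : √N * ‖Ce - τ * E * J‖ ≤ ε / 3 * (τ * ‖E‖) := by
    calc √N * ‖Ce - τ * E * J‖ ≤ √N * (τ * ‖E‖ * (2 * ε₁ * (c₁ / √N))) := by gcongr
      _ = (2 * ε₁ * c₁) * (τ * ‖E‖) := by field_simp
      _ ≤ _ := by gcongr
  have t2 : τ * ‖E‖ * ‖(√N : ℂ) * J - ((√(2 * Real.pi / (s + 1)) : ℝ) : ℂ)‖ ≤
      τ * ‖E‖ * (ε / 3) := by gcongr
  have t3 : √N * ‖O1 + O2‖ ≤ √N * (2 * (Bd * Real.pi)) := by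
    refine mul_le_mul_of_nonneg_left ((norm_add_le _ _).trans ?_) hsN.le
    linarith
  linarith

/-! ### From the saddle parameter to the explicit main term. -/

theorem liR_nonneg (s : ℝ) {y : ℝ} (hy : 0 ≤ y) : 0 ≤ liR s y := tsum_nonneg fun k => by positivity

theorem explicitL_eq_ofReal (s x : ℝ) (hs : 0 < s) : explicitL s x =
    ((1 / 2 * (Real.Gamma (s + 1) * liR s (x ^ 2)) ^ (1 / (s + 1)) : ℝ) : ℂ) := by
  have hG := Real.Gamma_pos_of_pos (show 0 < s + 1 by linarith)
  rw [explicitL, ← ofReal_pow, polylog_ofReal, ofReal_mul,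
    ofReal_cpow (mul_nonneg hG.le (liR_nonneg s (sq_nonneg x)))]
  push_cast
  rfl

/-- The saddle point parameter `L_{1,2}(x)`, as a real number. -/
def rootL (s x : ℝ) : ℝ := (s * lam s x) ^ (1 / (s + 1))

/-- The factor `1/2` is the `(s+1)`-st root of `2^{-(s+1)}`, and `s Γ(s) = Γ(s+1)`. -/
theorem explicitL_eq_rootL {s : ℝ} (hs : 0 < s) (x : ℝ) : explicitL s x = (rootL s x : ℂ) := by
  have hG := Real.Gamma_pos_of_pos hs
  have hl := liR_nonneg s (sq_nonneg x)
  rw [explicitL_eq_ofReal s x hs, rootL, lam, Real.Gamma_add_one hs.ne']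
  congr 1
  rw [show s * (Real.Gamma s * (2 ^ (-(s + 1)) * liR s (x ^ 2))) =
    2 ^ (-(s + 1)) * (s * Real.Gamma s * liR s (x ^ 2)) by ring,
    Real.mul_rpow (x := 2 ^ (-(s + 1))) (by positivity) (by positivity),
    ← Real.rpow_mul (by norm_num), show -(s + 1) * (1 / (s + 1)) = -1 by field_simp, Real.rpow_neg_one]
  norm_num

theorem exp_constC (s : ℝ) {x : ℝ} (hx : x ∈ Ioo (-1 : ℝ) 1) :
    cexp (constC s x) = (1 - (x : ℂ)) ^ (-expB s) * (1 + (x : ℂ)) ^ (-expA s) := by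
  have h1 : (1 - (x : ℂ)) ≠ 0 := by
    rw [← ofReal_one, ← ofReal_sub]
    exact ofReal_ne_zero.2 (by linarith [hx.2])
  have h2 : (1 + (x : ℂ)) ≠ 0 := by
    rw [← ofReal_one, ← ofReal_add]
    exact ofReal_ne_zero.2 (by linarith [hx.1])
  rw [cpow_def_of_ne_zero h1, cpow_def_of_ne_zero h2, ← Complex.exp_add, constC]
  congr 1
  ring

/-- At the saddle `N = L n^{s/(s+1)}`, and squaring `τ √(2π/(s+1)) / (2π √N)` gives the quantity
under the square root. -/
theorem mainTerm_eq {s x : ℝ} (hs : 0 < s) (hx : x ∈ Ioo (-1 : ℝ) 0) {n : ℕ} (hn : 0 < n) {τ N : ℝ}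
    (hτ : τ = rootL s x * (n : ℝ) ^ (-(1 / (s + 1)))) (hN : N = n * τ) :
    mainTerm s n x = (-1) ^ n / (2 * Real.pi) *
      (τ * cexp ((1 + 1 / s) * N + constC s x) * (√(2 * Real.pi / (s + 1)) : ℝ) / (√N : ℂ)) := by
  have hs1 : 0 < s + 1 := by linarith
  have hn' : (0 : ℝ) < n := by exact_mod_cast hn
  have hL : 0 < rootL s x := Real.rpow_pos_of_pos (mul_pos hs (lam_pos hs hx)) _
  have hτ0 : 0 < τ := by rw [hτ]; positivity
  have hN0 : 0 < N := by rw [hN]; positivity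
  have hNL : N = rootL s x * (n : ℝ) ^ (s / (s + 1)) := by
    rw [hN, hτ, mul_left_comm]
    congr 1
    nth_rewrite 1 [← Real.rpow_one (n : ℝ)]
    rw [← Real.rpow_add hn']
    congr 1
    field_simp
    ring
  have hpi := Real.pi_pos
  have hroot : rootL s x / (2 * Real.pi * (s + 1) * (n : ℝ) ^ ((s + 2) / (s + 1))) =
      (τ / (2 * Real.pi) * √(2 * Real.pi / (s + 1)) / √N) ^ 2 := by
    rw [div_pow, mul_pow, Real.sq_sqrt (by positivity), Real.sq_sqrt hN0.le]
    have e1 : (n : ℝ) ^ ((s + 2) / (s + 1)) = n * (n : ℝ) ^ (1 / (s + 1)) := by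
      nth_rewrite 2 [← Real.rpow_one (n : ℝ)]
      rw [← Real.rpow_add hn']
      congr 1
      field_simp
      ring
    have e2 : rootL s x = τ * (n : ℝ) ^ (1 / (s + 1)) := by
      rw [hτ, mul_assoc, ← Real.rpow_add hn', neg_add_cancel, Real.rpow_zero, mul_one]
    have hp : 0 < (n : ℝ) ^ (1 / (s + 1)) := by positivity
    rw [e1, e2, hN]
    field_simp
  have hsqrt : (explicitL s x / (2 * Real.pi * ((s : ℂ) + 1) *
      (((n : ℝ) ^ ((s + 2) / (s + 1)) : ℝ) : ℂ))) ^ (1 / 2 : ℂ) =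
      ((τ / (2 * Real.pi) * √(2 * Real.pi / (s + 1)) / √N : ℝ) : ℂ) := by
    have e : explicitL s x / (2 * Real.pi * ((s : ℂ) + 1) *
        (((n : ℝ) ^ ((s + 2) / (s + 1)) : ℝ) : ℂ)) =
        ((rootL s x / (2 * Real.pi * (s + 1) * (n : ℝ) ^ ((s + 2) / (s + 1))) : ℝ) : ℂ) := by
      rw [explicitL_eq_rootL hs]
      push_cast
      rfl
    rw [e, hroot, show (1 / 2 : ℂ) = ((1 / 2 : ℝ) : ℂ) by push_cast; rfl, ← ofReal_cpow (by positivity),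
      ← Real.sqrt_eq_rpow, Real.sqrt_sq (by positivity)]
  have hexp : cexp (((s : ℂ) + 1) / (s : ℂ) * (((n : ℝ) ^ (s / (s + 1)) : ℝ) : ℂ) * explicitL s x) =
      cexp ((1 + 1 / s) * N) := by
    have hs0 : (s : ℂ) ≠ 0 := ofReal_ne_zero.2 hs.ne'
    rw [explicitL_eq_rootL hs, hNL, ofReal_mul]
    congr 1
    field_simp
  rw [mainTerm, hsqrt, hexp, mul_assoc ((-1 : ℂ) ^ n), ← exp_constC s ⟨hx.1, hx.2.trans one_pos⟩,
    Complex.exp_add]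
  push_cast
  ring

/-- The asymptotic formula, in terms of the condition comparing the arcs around `1` and `-1`. -/
theorem coeffQ_asymptotic {s : ℝ} (hs : 0 < s) {X : Set ℝ} (hX : IsCompact X)
    (hsub : X ⊆ Ioo (-1 : ℝ) 0)
    (hκ : ∀ x ∈ X, -liR s x * kappa s < 2 ^ (-(s + 1)) * liR s (x ^ 2)) {ε : ℝ} (hε : 0 < ε) :
    ∀ᶠ n : ℕ in atTop, ∀ x ∈ X,
      ‖coeffQ (powerSeq s) n (x : ℂ) - mainTerm s n x‖ ≤ ε * ‖mainTerm s n x‖ := by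
  have hs1 : 0 < s + 1 := by linarith
  have hpi := Real.pi_pos
  set g := √(2 * Real.pi / (s + 1)) with hg
  have hg0 : 0 < g := Real.sqrt_pos.2 (by positivity)
  obtain ⟨τ₀, hτ₀, hmain⟩ := exists_norm_integral_sub_le hs hX hsub hκ (ε := ε * g) (by positivity)
  -- A bound for the saddle parameter on `X` makes `τ` tend to `0` uniformly in `x`.
  obtain ⟨L₁, hL₁0, hL₁⟩ : ∃ L₁ > 0, ∀ x ∈ X, rootL s x ≤ L₁ := by
    have hc : ContinuousOn (rootL s) X := by
      have := (continuousOn_liR_sq hs).mono hsub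
      unfold rootL lam
      exact ContinuousOn.rpow_const (by fun_prop) fun x _ => Or.inr (by positivity)
    obtain ⟨b, hb⟩ := hX.bddAbove_image hc
    exact ⟨max 1 b, lt_of_lt_of_le one_pos (le_max_left _ _),
      fun x hx => (hb (mem_image_of_mem _ hx)).trans (le_max_right _ _)⟩
  have hlim : Tendsto (fun n : ℕ => L₁ * (n : ℝ) ^ (-(1 / (s + 1)))) atTop (𝓝 (L₁ * 0)) :=
    ((tendsto_rpow_neg_atTop (show 0 < 1 / (s + 1) by positivity)).comp
      tendsto_natCast_atTop_atTop).const_mul _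
  rw [mul_zero] at hlim
  filter_upwards [hlim.eventually (gt_mem_nhds hτ₀), eventually_gt_atTop 0] with n hn hn0 x hx
  have hn' : (0 : ℝ) < n := by exact_mod_cast hn0
  have hxI := hsub hx
  have hΛ := lam_pos hs hxI
  have hL : 0 < rootL s x := Real.rpow_pos_of_pos (mul_pos hs hΛ) _
  set τ := rootL s x * (n : ℝ) ^ (-(1 / (s + 1))) with hτ
  have hτ0 : 0 < τ := by positivity
  have hττ₀ : τ < τ₀ := lt_of_le_of_lt (by have := hL₁ x hx; rw [hτ]; gcongr) hn
  -- Here `τ` is `(sΛ/n)^{1/(s+1)}`, the stationary point of `nτ + Λτ^{-s}`.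
  have hsaddle : (n : ℝ) * τ = s * lam s x * τ ^ (-s) := by
    have e1 : τ ^ (s + 1) = s * lam s x * (n : ℝ)⁻¹ := by
      rw [hτ, Real.mul_rpow hL.le (by positivity), rootL, ← Real.rpow_mul (by positivity),
        ← Real.rpow_mul hn'.le, show 1 / (s + 1) * (s + 1) = 1 by field_simp,
        show -(1 / (s + 1)) * (s + 1) = -1 by field_simp, Real.rpow_one, Real.rpow_neg_one]
    have e2 : s * lam s x = n * τ ^ (s + 1) := by rw [e1]; field_simp
    rw [e2, mul_assoc, ← Real.rpow_add hτ0, show s + 1 + -s = 1 by ring, Real.rpow_one]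
  have hb := hmain x hx n τ (n * τ) hτ0 hττ₀ rfl hsaddle
  have hz1 : ‖(x : ℂ)‖ < 1 := by
    rw [norm_real, Real.norm_eq_abs, abs_lt]
    exact ⟨hxI.1, hxI.2.trans one_pos⟩
  have hN0 : 0 < √((n : ℝ) * τ) := Real.sqrt_pos.2 (by positivity)
  rw [mainTerm_eq hs hxI hn0 hτ rfl, coeffQ_eq_integral s n hz1 hτ0]
  set E := cexp ((1 + 1 / s) * ((n * τ : ℝ) : ℂ) + constC s x) with hE
  change ‖_ * (∫ ϑ in (-Real.pi)..Real.pi, arcIntegrand s n x τ ϑ) - _‖ ≤ _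
  set J := ∫ ϑ in (-Real.pi)..Real.pi, arcIntegrand s n x τ ϑ with hJ
  set S := √((n : ℝ) * τ) with hS
  have hSC : (S : ℂ) ≠ 0 := ofReal_ne_zero.2 hN0.ne'
  have e1 : (-1 : ℂ) ^ n / (2 * Real.pi) * J - (-1) ^ n / (2 * Real.pi) * (τ * E * (g : ℝ) / (S : ℂ)) =
      (-1) ^ n / (2 * Real.pi) * ((S * J - τ * E * (g : ℝ)) / (S : ℂ)) := by
    field_simp
  rw [e1, norm_mul, norm_mul ((-1 : ℂ) ^ n / (2 * Real.pi)), mul_left_comm ε]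
  refine mul_le_mul_of_nonneg_left ?_ (norm_nonneg _)
  rw [norm_div, norm_div, norm_mul (τ * E : ℂ), norm_mul (τ : ℂ), norm_real τ, norm_real g,
    Real.norm_of_nonneg hτ0.le, Real.norm_of_nonneg hg0.le, ← mul_div_assoc]
  refine div_le_div_of_nonneg_right (hb.trans (le_of_eq (by ring))) (norm_nonneg _)

/-! ### Residues, Fourier coefficients and the functions `L_{h,k}`. -/

theorem rootOfUnity_pow (h k m : ℕ) :
    rootOfUnity h k ^ m = cexp (2 * Real.pi * I * ((h : ℝ) / (k : ℝ) : ℝ) * m) := by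
  rw [rootOfUnity, ← Complex.exp_nat_mul]
  congr 1
  push_cast
  ring

theorem rootOfUnity_zero (k : ℕ) : rootOfUnity 0 k = 1 := by simp [rootOfUnity]

theorem rootOfUnity_mul (h j k : ℕ) : rootOfUnity (h * j) k = rootOfUnity h k ^ j := by
  rw [rootOfUnity, rootOfUnity, ← Complex.exp_nat_mul]
  congr 1
  push_cast
  ring

theorem twistedDirichlet_eq (s : ℝ) (h k : ℕ) {σ : ℝ} (hσ : s < σ) :
    twistedDirichlet (powerSeq s) h k σ =
      ∑' m : ℕ, rootOfUnity h k ^ m / (m : ℂ) ^ ((σ - s + 1 : ℝ) : ℂ) := by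
  refine tsum_congr fun m => ?_
  rcases eq_or_ne m 0 with rfl | hm
  -- The term `m = 0` is zero on both sides: on the right `0` to a nonzero power is `0`, and
  -- division by `0` gives `0`.
  · have : ((σ - s + 1 : ℝ) : ℂ) ≠ 0 := ofReal_ne_zero.2 (by linarith)
    rw [LSeries.term_zero, Nat.cast_zero, zero_cpow this, div_zero]
  · have hm' : (m : ℂ) ≠ 0 := Nat.cast_ne_zero.2 hm
    rw [LSeries.term_of_ne_zero hm, ofReal_powerSeq, mul_div_assoc,
      ← cpow_sub _ _ hm', div_eq_mul_inv _ (_ ^ _), ← cpow_neg]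
    congr 2
    push_cast
    ring

/-- For the trivial character the series is `ζ(σ - s + 1)`. -/
theorem residueA_zero (s : ℝ) (k : ℕ) : residueA (powerSeq s) s 0 k = 1 := by
  refine Tendsto.limUnder_eq ?_
  have h1 : Tendsto (fun σ : ℝ => ((σ - s + 1 : ℝ) : ℂ)) (𝓝[>] s) (𝓝[≠] 1) := by
    refine tendsto_nhdsWithin_iff.2 ⟨?_, ?_⟩
    · have : Continuous fun σ : ℝ => ((σ - s + 1 : ℝ) : ℂ) := by fun_prop
      exact (this.tendsto' s 1 (by simp)).mono_left nhdsWithin_le_nhds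
    · filter_upwards [self_mem_nhdsWithin] with σ hσ h
      have hσ' : s < σ := hσ
      have := congrArg Complex.re h
      rw [ofReal_re, one_re] at this
      linarith
  refine (riemannZeta_residue_one.comp h1).congr' ?_
  filter_upwards [self_mem_nhdsWithin] with σ hσ
  have hσ' : s < σ := hσ
  rw [twistedDirichlet_eq s 0 k hσ', Function.comp]
  simp only [rootOfUnity_zero, one_pow]
  rw [zeta_eq_tsum_one_div_nat_cpow (by rw [ofReal_re]; linarith)]
  push_cast
  ring

/-- For a nontrivial additive character the series is an exponential zeta function, which is entire.
-/
theorem residueA_eq_zero (s : ℝ) {h k : ℕ} (h0 : 0 < h) (hk : h < k) :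
    residueA (powerSeq s) s h k = 0 := by
  refine Tendsto.limUnder_eq ?_
  have hk0 : (0 : ℝ) < k := by exact_mod_cast h0.trans hk
  have hh0 : (0 : ℝ) < h := by exact_mod_cast h0
  have hne : (((h : ℝ) / (k : ℝ) : ℝ) : UnitAddCircle) ≠ 0 := by
    intro hz
    obtain ⟨n, hn⟩ := (AddCircle.coe_eq_zero_iff 1).1 hz
    rw [zsmul_eq_mul, mul_one] at hn
    have h1 : (0 : ℝ) < n := by rw [hn]; positivity
    have h2 : (n : ℝ) < 1 := by rw [hn, div_lt_one hk0]; exact_mod_cast hk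
    have h3 : 0 < n := by exact_mod_cast h1
    have h4 : n < 1 := by exact_mod_cast h2
    omega
  have hcont : Continuous fun σ : ℝ => ((σ - s : ℝ) : ℂ) *
      HurwitzZeta.expZeta (((h : ℝ) / (k : ℝ) : ℝ) : UnitAddCircle) ((σ - s + 1 : ℝ) : ℂ) :=
    Continuous.mul (by fun_prop)
      ((HurwitzZeta.differentiable_expZeta_of_ne_zero hne).continuous.comp (by fun_prop))
  refine ((hcont.tendsto' s 0 (by simp)).mono_left nhdsWithin_le_nhds).congr' ?_
  filter_upwards [self_mem_nhdsWithin] with σ hσ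
  have hσ' : s < σ := hσ
  rw [twistedDirichlet_eq s h k hσ', ← (HurwitzZeta.hasSum_expZeta_of_one_lt_re ((h : ℝ) / (k : ℝ))
    (s := ((σ - s + 1 : ℝ) : ℂ)) (by rw [ofReal_re]; linarith)).tsum_eq]
  simp_rw [rootOfUnity_pow]

/-- Only `h = 0` carries a residue, so the Fourier transform is constant. -/
theorem fourierC_eq (s : ℝ) {k : ℕ} (hk : 0 < k) (j : ℕ) : fourierC (powerSeq s) s k j = 1 / k := by
  rw [fourierC, Finset.sum_eq_single_of_mem 0 (Finset.mem_range.2 hk)]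
  · rw [residueA_zero, zero_mul, rootOfUnity_zero]
    simp
  · intro h hmem h0
    rw [residueA_eq_zero s (Nat.pos_of_ne_zero h0) (Finset.mem_range.1 hmem), mul_zero]

theorem sum_rootOfUnity_pow {h k : ℕ} (hk : 0 < k) (hc : Nat.Coprime h k) (m : ℕ) :
    ∑ j ∈ Finset.range k, (rootOfUnity (h * j) k) ^ m = if k ∣ m then (k : ℂ) else 0 := by
  have hp : IsPrimitiveRoot (rootOfUnity h k) k :=
    Complex.isPrimitiveRoot_exp_of_coprime h k hk.ne' hc
  have e : ∀ j, (rootOfUnity (h * j) k) ^ m = (rootOfUnity h k ^ m) ^ j := by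
    intro j
    rw [rootOfUnity_mul, ← pow_mul, ← pow_mul, mul_comm]
  simp_rw [e]
  split_ifs with hd
  · rw [(hp.pow_eq_one_iff_dvd m).2 hd]
    simp
  · have h1 : rootOfUnity h k ^ m ≠ 1 := fun h => hd ((hp.pow_eq_one_iff_dvd m).1 h)
    have h2 := geom_sum_mul (rootOfUnity h k ^ m) k
    rw [← pow_mul, mul_comm m, pow_mul, hp.pow_eq_one, one_pow, sub_self] at h2
    exact (mul_eq_zero.1 h2).resolve_right (sub_ne_zero.2 h1)

theorem norm_rootOfUnity (h k : ℕ) : ‖rootOfUnity h k‖ = 1 := by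
  rw [rootOfUnity, norm_exp]
  have : (2 * Real.pi * I * ((h : ℂ) / (k : ℂ))).re = 0 := by
    rw [show (2 * Real.pi * I * ((h : ℂ) / (k : ℂ))) = ((2 * Real.pi * ((h : ℝ) / k) : ℝ) : ℂ) * I by
      push_cast; ring]
    rw [re_ofReal_mul, I_re, mul_zero]
  rw [this, Real.exp_zero]

/-- The distribution relation: orthogonality keeps the exponents divisible by `k`, and the
dependence on `h` disappears. -/
theorem sum_polylog_rootOfUnity {s : ℝ} (hs : 0 < s) {h k : ℕ} (hk : 0 < k) (hc : Nat.Coprime h k)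
    {z : ℂ} (hz : ‖z‖ < 1) :
    ∑ j ∈ Finset.range k, polylog ((s + 1 : ℝ) : ℂ) (rootOfUnity (h * j) k * z) =
      k * ((k : ℂ) ^ (-((s + 1 : ℝ) : ℂ)) * polylog ((s + 1 : ℝ) : ℂ) (z ^ k)) := by
  have hsum : ∀ j ∈ Finset.range k, Summable fun m : ℕ =>
      (rootOfUnity (h * j) k * z) ^ (m + 1) / ((m + 1 : ℕ) : ℂ) ^ ((s + 1 : ℝ) : ℂ) := fun j _ =>
    summable_polylog hs (by rwa [norm_mul, norm_rootOfUnity, one_mul])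
  unfold polylog
  rw [← Summable.tsum_finsetSum hsum]
  have e : ∀ m : ℕ, ∑ j ∈ Finset.range k,
      (rootOfUnity (h * j) k * z) ^ (m + 1) / ((m + 1 : ℕ) : ℂ) ^ ((s + 1 : ℝ) : ℂ) =
      if k ∣ m + 1 then k * (z ^ (m + 1) / ((m + 1 : ℕ) : ℂ) ^ ((s + 1 : ℝ) : ℂ)) else 0 := by
    intro m
    simp_rw [mul_pow, mul_div_assoc]
    rw [← Finset.sum_mul, sum_rootOfUnity_pow hk hc]
    split_ifs <;> simp
  simp_rw [e]
  have hinj : Function.Injective (fun j : ℕ => k * (j + 1) - 1) := by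
    intro a b h
    simp only at h
    have h1 : 1 ≤ k * (a + 1) := Nat.mul_pos hk (by omega)
    have h2 : 1 ≤ k * (b + 1) := Nat.mul_pos hk (by omega)
    have h3 : k * (a + 1) = k * (b + 1) := by omega
    have := Nat.eq_of_mul_eq_mul_left hk h3
    omega
  have hsupp : Function.support (fun m : ℕ => if k ∣ m + 1 then
      k * (z ^ (m + 1) / ((m + 1 : ℕ) : ℂ) ^ ((s + 1 : ℝ) : ℂ)) else 0) ⊆
      range (fun j : ℕ => k * (j + 1) - 1) := by
    intro m hm
    have : k ∣ m + 1 := by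
      by_contra h
      exact hm (if_neg h)
    obtain ⟨c, hc⟩ := this
    rcases c with _ | c
    · omega
    · exact ⟨c, by simp only; omega⟩
  rw [← hinj.tsum_eq hsupp, ← tsum_mul_left, ← tsum_mul_left]
  refine tsum_congr fun j => ?_
  rw [Nat.sub_add_cancel (Nat.mul_pos hk (by omega)), if_pos (dvd_mul_right _ _), Nat.cast_mul,
    natCast_mul_natCast_cpow, cpow_neg, pow_mul]
  ring

/-- The real number `w^{s₀} s₀ Ψ_{h,k}(x,w)`, which depends on `k` only. -/
def arcBase (s : ℝ) (k : ℕ) (x : ℝ) : ℝ :=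
  Real.Gamma (s + 1) * ((k : ℝ) ^ (-(s + 1)) * liR s (x ^ k))

theorem arcL_eq {s : ℝ} (hs : 0 < s) {h k : ℕ} (hk : 0 < k) (hc : Nat.Coprime h k) {x : ℝ}
    (hx : |x| < 1) :
    arcL (powerSeq s) s h k x = (arcBase s k x : ℂ) ^ ((1 / (s + 1) : ℝ) : ℂ) := by
  have hs0 : (s : ℂ) ≠ 0 := ofReal_ne_zero.2 hs.ne'
  have hk0 : (k : ℂ) ≠ 0 := Nat.cast_ne_zero.2 hk.ne'
  rw [arcL, Psi]
  simp_rw [fourierC_eq s hk]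
  rw [← Finset.mul_sum, sum_polylog_rootOfUnity hs hk hc (by rwa [norm_real]), one_cpow, ← ofReal_pow,
    polylog_ofReal, arcBase]
  congr 1
  rw [ofReal_mul, ofReal_mul, ofReal_cpow k.cast_nonneg]
  push_cast
  field_simp

/-- The real power is by definition the real part of the complex principal power, also for a
negative base. Comparing phases thus becomes comparing real powers. -/
theorem re_arcL_eq {s : ℝ} (hs : 0 < s) {h k : ℕ} (hk : 0 < k) (hc : Nat.Coprime h k) {x : ℝ}
    (hx : |x| < 1) : (arcL (powerSeq s) s h k x).re = arcBase s k x ^ (1 / (s + 1)) := by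
  rw [arcL_eq hs hk hc hx]
  exact (Real.rpow_def _ _).symm

theorem arcL_one_two {s : ℝ} (hs : 0 < s) {x : ℝ} (hx : |x| < 1) :
    arcL (powerSeq s) s 1 2 x = explicitL s x := by
  have hG := Real.Gamma_pos_of_pos (show 0 < s + 1 by linarith)
  have hl := liR_nonneg s (sq_nonneg x)
  rw [arcL_eq hs two_pos (by norm_num) hx, explicitL_eq_ofReal s x hs, arcBase,
    ← ofReal_cpow (by positivity)]
  congr 1
  rw [mul_left_comm, Real.mul_rpow (x := ((2 : ℕ) : ℝ) ^ (-(s + 1))) (by positivity) (by positivity),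
    ← Real.rpow_mul (by positivity), show -(s + 1) * (1 / (s + 1)) = -1 by field_simp,
    Real.rpow_neg_one]
  norm_num

/-! ### Comparison of the arcs. -/

theorem liR_mono {s : ℝ} (hs : 0 < s) {a b : ℝ} (ha : 0 ≤ a) (hab : a ≤ b) (hb : b < 1) :
    liR s a ≤ liR s b := by
  refine Summable.tsum_le_tsum (fun k => by gcongr)
    (summable_liR hs (by rw [abs_of_nonneg ha]; linarith))
    (summable_liR hs (by rw [abs_of_nonneg (ha.trans hab)]; exact hb))

theorem abs_liR_le {s : ℝ} (hs : 0 < s) {x : ℝ} (hx : |x| < 1) : |liR s x| ≤ liR s |x| := by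
  refine tsum_of_norm_bounded (f := fun m : ℕ => x ^ (m + 1) / ((m + 1 : ℕ) : ℝ) ^ (s + 1))
    (summable_liR hs (y := |x|) (by rwa [abs_abs])).hasSum fun k => ?_
  rw [norm_div, norm_pow, Real.norm_eq_abs, Real.norm_of_nonneg (by positivity)]

theorem liR_le_div {s : ℝ} (hs : 0 < s) {y : ℝ} (h0 : 0 ≤ y) (h1 : y < 1) :
    liR s y ≤ y / (1 - y) := by
  have hg := (hasSum_geometric_of_lt_one h0 h1).mul_left y
  rw [← div_eq_mul_inv] at hg
  refine hasSum_le (fun k => ?_) (summable_liR hs (by rwa [abs_of_nonneg h0])).hasSum hg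
  rw [← pow_succ']
  exact div_le_self (by positivity) (Real.one_le_rpow (by simp) (by linarith))

theorem natCast_rpow_neg_lt {s : ℝ} (hs : 0 < s) {a b : ℕ} (ha : 0 < a) (hab : a < b) :
    (b : ℝ) ^ (-(s + 1)) < (a : ℝ) ^ (-(s + 1)) :=
  Real.rpow_lt_rpow_of_neg (by exact_mod_cast ha) (by exact_mod_cast hab) (by linarith)

/-- On the positive axis the first arc dominates. -/
theorem arcBase_rpow_lt_of_pos {s : ℝ} (hs : 0 < s) {x : ℝ} (hx : x ∈ Ioo (0 : ℝ) 1) {k : ℕ}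
    (hk : 2 ≤ k) : arcBase s k x ^ (1 / (s + 1)) < arcBase s 1 x ^ (1 / (s + 1)) := by
  have hG := Real.Gamma_pos_of_pos (show 0 < s + 1 by linarith)
  have hxk : 0 ≤ x ^ k := pow_nonneg hx.1.le k
  have hl := liR_nonneg s hxk
  refine Real.rpow_lt_rpow (by unfold arcBase; positivity) ?_ (by positivity)
  unfold arcBase
  refine mul_lt_mul_of_pos_left ?_ hG
  have h1 : liR s (x ^ k) ≤ liR s (x ^ 1) := by
    refine liR_mono hs hxk ?_ (by rw [pow_one]; exact hx.2)
    exact pow_le_pow_of_le_one hx.1.le hx.2.le (by omega)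
  have h2 := natCast_rpow_neg_lt hs one_pos (show 1 < k by omega)
  have h3 : 0 < liR s (x ^ 1) := by rw [pow_one]; exact liR_pos hs hx.1 hx.2
  calc _ ≤ (k : ℝ) ^ (-(s + 1)) * liR s (x ^ 1) := by gcongr
    _ < _ := mul_lt_mul_of_pos_right h2 h3

/-- On the negative axis the second arc dominates all later ones. -/
theorem arcBase_rpow_lt_of_neg {s : ℝ} (hs : 0 < s) {x : ℝ} (hx : x ∈ Ioo (-1 : ℝ) 0) {k : ℕ}
    (hk : 3 ≤ k) : arcBase s k x ^ (1 / (s + 1)) < arcBase s 2 x ^ (1 / (s + 1)) := by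
  have hG := Real.Gamma_pos_of_pos (show 0 < s + 1 by linarith)
  have hx2 := sq_mem_Ioo hx
  -- For odd `k` the base is negative, so absolute values are compared.
  refine (le_abs_self _).trans_lt ((Real.abs_rpow_le_abs_rpow _ _).trans_lt ?_)
  refine Real.rpow_lt_rpow (abs_nonneg _) ?_ (by positivity)
  unfold arcBase
  rw [abs_mul, abs_mul, abs_of_pos hG, abs_of_nonneg (by positivity : (0 : ℝ) ≤ (k : ℝ) ^ (-(s + 1)))]
  refine mul_lt_mul_of_pos_left ?_ hG
  have hxa : |x| < 1 := abs_lt.2 ⟨hx.1, hx.2.trans one_pos⟩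
  have h1 : |liR s (x ^ k)| ≤ liR s (x ^ 2) := by
    refine (abs_liR_le hs ?_).trans ?_
    · rw [abs_pow]; exact pow_lt_one₀ (abs_nonneg x) hxa (by omega)
    · refine liR_mono hs (abs_nonneg _) ?_ hx2.2
      rw [abs_pow, ← sq_abs x]
      exact pow_le_pow_of_le_one (abs_nonneg x) hxa.le (by omega)
  have h2 := natCast_rpow_neg_lt hs two_pos (show 2 < k by omega)
  calc _ ≤ (k : ℝ) ^ (-(s + 1)) * liR s (x ^ 2) := by gcongr
    _ < _ := mul_lt_mul_of_pos_right h2 (liR_pos hs hx2.1 hx2.2)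

/-- Its sign decides between the first and the second arc. -/
def phaseSign (s x : ℝ) : ℝ := 2 ^ (-(s + 1)) * liR s (x ^ 2) + liR s x * kappa s

/-- The base is negative for `x < 0`, so its principal root has argument `π/(s+1)`. -/
theorem arcBase_one_rpow {s : ℝ} (hs : 0 < s) {x : ℝ} (hx : x ∈ Ioo (-1 : ℝ) 0) :
    arcBase s 1 x ^ (1 / (s + 1)) =
      (Real.Gamma (s + 1) * -liR s x) ^ (1 / (s + 1)) * Real.cos (Real.pi / (s + 1)) := by
  have hG := Real.Gamma_pos_of_pos (show 0 < s + 1 by linarith)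
  have hl := liR_neg_of_neg hs hx
  have e : arcBase s 1 x = -(Real.Gamma (s + 1) * -liR s x) := by
    rw [arcBase, Nat.cast_one, Real.one_rpow, pow_one]; ring
  have hpos : 0 < Real.Gamma (s + 1) * -liR s x := mul_pos hG (by linarith)
  rw [e, Real.rpow_def_of_neg (by linarith), Real.rpow_def_of_pos hpos, Real.log_neg_eq_log]
  congr 2
  ring

theorem kappa_rpow {s : ℝ} (hs : 0 < s) :
    kappa s ^ (1 / (s + 1)) = max 0 (Real.cos (Real.pi / (s + 1))) := by
  rw [kappa, ← Real.rpow_mul (le_max_left _ _), show (s + 1) * (1 / (s + 1)) = 1 by field_simp,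
    Real.rpow_one]

theorem kappa_nonneg (s : ℝ) : 0 ≤ kappa s := Real.rpow_nonneg (le_max_left _ _) _

theorem mul_kappa_rpow {s : ℝ} (hs : 0 < s) {x : ℝ} (hx : x ∈ Ioo (-1 : ℝ) 0) :
    (Real.Gamma (s + 1) * (-liR s x * kappa s)) ^ (1 / (s + 1)) =
      (Real.Gamma (s + 1) * -liR s x) ^ (1 / (s + 1)) * max 0 (Real.cos (Real.pi / (s + 1))) := by
  have hG := Real.Gamma_pos_of_pos (show 0 < s + 1 by linarith)
  have hl := liR_neg_of_neg hs hx
  rw [← mul_assoc, Real.mul_rpow (mul_pos hG (by linarith)).le (kappa_nonneg s), kappa_rpow hs]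

/-- After raising to the power `s + 1`, the factor `cos(π/(s+1))` becomes `κ`. Truncation at `0` is
harmless: a nonpositive cosine makes the first arc nonpositive, while the second is positive. -/
theorem arcBase_lt_iff_phaseSign_pos {s : ℝ} (hs : 0 < s) {x : ℝ} (hx : x ∈ Ioo (-1 : ℝ) 0) :
    arcBase s 1 x ^ (1 / (s + 1)) < arcBase s 2 x ^ (1 / (s + 1)) ↔ 0 < phaseSign s x := by
  have hG := Real.Gamma_pos_of_pos (show 0 < s + 1 by linarith)
  have hl := liR_neg_of_neg hs hx
  have hx2 := sq_mem_Ioo hx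
  have hl2 := liR_pos hs hx2.1 hx2.2
  have hp : 0 < 1 / (s + 1) := by positivity
  have hκ := kappa_nonneg s
  have hb2 : arcBase s 2 x = Real.Gamma (s + 1) * (2 ^ (-(s + 1)) * liR s (x ^ 2)) := by
    rw [arcBase, Nat.cast_ofNat]
  have hA : 0 < (Real.Gamma (s + 1) * -liR s x) ^ (1 / (s + 1)) :=
    Real.rpow_pos_of_pos (mul_pos hG (by linarith)) _
  have hmk : 0 ≤ -liR s x * kappa s := mul_nonneg (by linarith) hκ
  have key : (Real.Gamma (s + 1) * (-liR s x * kappa s)) ^ (1 / (s + 1)) <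
      arcBase s 2 x ^ (1 / (s + 1)) ↔ 0 < phaseSign s x := by
    rw [hb2, Real.rpow_lt_rpow_iff (by positivity) (by positivity) hp, mul_lt_mul_iff_right₀ hG,
      phaseSign]
    constructor <;> intro h <;> linarith
  rw [← key, mul_kappa_rpow hs hx, arcBase_one_rpow hs hx]
  rcases le_total 0 (Real.cos (Real.pi / (s + 1))) with h | h
  · rw [max_eq_right h]
  · rw [max_eq_left h, mul_zero]
    have h2 : 0 < arcBase s 2 x ^ (1 / (s + 1)) := by rw [hb2]; positivity
    exact ⟨fun _ => h2, fun _ => (mul_nonpos_of_nonneg_of_nonpos hA.le h).trans_lt h2⟩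

theorem arcBase_lt_iff_phaseSign_neg {s : ℝ} (hs : 0 < s) {x : ℝ} (hx : x ∈ Ioo (-1 : ℝ) 0) :
    arcBase s 2 x ^ (1 / (s + 1)) < arcBase s 1 x ^ (1 / (s + 1)) ↔ phaseSign s x < 0 := by
  have hG := Real.Gamma_pos_of_pos (show 0 < s + 1 by linarith)
  have hl := liR_neg_of_neg hs hx
  have hx2 := sq_mem_Ioo hx
  have hl2 := liR_pos hs hx2.1 hx2.2
  have hp : 0 < 1 / (s + 1) := by positivity
  have hκ := kappa_nonneg s
  have hb2 : arcBase s 2 x = Real.Gamma (s + 1) * (2 ^ (-(s + 1)) * liR s (x ^ 2)) := by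
    rw [arcBase, Nat.cast_ofNat]
  have hA : 0 < (Real.Gamma (s + 1) * -liR s x) ^ (1 / (s + 1)) :=
    Real.rpow_pos_of_pos (mul_pos hG (by linarith)) _
  have hmk : 0 ≤ -liR s x * kappa s := mul_nonneg (by linarith) hκ
  have key : arcBase s 2 x ^ (1 / (s + 1)) <
      (Real.Gamma (s + 1) * (-liR s x * kappa s)) ^ (1 / (s + 1)) ↔ phaseSign s x < 0 := by
    rw [hb2, Real.rpow_lt_rpow_iff (by positivity) (by positivity) hp, mul_lt_mul_iff_right₀ hG,
      phaseSign]
    constructor <;> intro h <;> linarith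
  rw [← key, mul_kappa_rpow hs hx, arcBase_one_rpow hs hx]
  rcases le_total 0 (Real.cos (Real.pi / (s + 1))) with h | h
  · rw [max_eq_right h]
  · rw [max_eq_left h, mul_zero]
    have h2 : 0 < arcBase s 2 x ^ (1 / (s + 1)) := by rw [hb2]; positivity
    exact ⟨fun h3 => absurd (h3.trans_le (mul_nonpos_of_nonneg_of_nonpos hA.le h)) h2.not_gt,
      fun h3 => absurd h3 h2.not_gt⟩

/-! ### Uniqueness of the transition point. -/

/-- The function `(m+1)t^m - m t^{m+1}` is monotone on `[0,1]`, its derivative being `m(m+1) t^{m-1}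
(1-t)`. This controls ratios of consecutive terms in an alternating series. -/
theorem mul_pow_sub_pow_le {a b : ℝ} (ha : 0 ≤ a) (hab : a ≤ b) (hb : b ≤ 1) (m : ℕ) :
    m * (b ^ (m + 1) - a ^ (m + 1)) ≤ (m + 1) * (b ^ m - a ^ m) := by
  have hmono : MonotoneOn (fun t : ℝ => (m + 1) * t ^ m - m * t ^ (m + 1)) (Icc 0 1) := by
    refine monotoneOn_of_deriv_nonneg (convex_Icc 0 1) (by fun_prop) (by fun_prop) fun t ht => ?_
    rw [interior_Icc] at ht
    have hd : HasDerivAt (fun t : ℝ => (m + 1) * t ^ m - m * t ^ (m + 1))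
        ((m + 1) * (m * t ^ (m - 1)) - m * (((m + 1 : ℕ) : ℝ) * t ^ (m + 1 - 1))) t :=
      ((hasDerivAt_pow m t).const_mul _).sub ((hasDerivAt_pow (m + 1) t).const_mul _)
    rw [hd.deriv]
    rcases m with _ | m
    · simp
    · simp only [Nat.add_sub_cancel]
      have e : ((m + 1 : ℕ) + 1 : ℝ) * (((m + 1 : ℕ) : ℝ) * t ^ m) -
          ((m + 1 : ℕ) : ℝ) * (((m + 1 + 1 : ℕ) : ℝ) * t ^ (m + 1)) =
          ((m + 1 : ℕ) + 1 : ℝ) * ((m + 1 : ℕ) : ℝ) * t ^ m * (1 - t) := by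
        push_cast; ring
      rw [e]
      have h1 : 0 ≤ 1 - t := by linarith [ht.2]
      have h2 : 0 ≤ t ^ m := pow_nonneg ht.1.le m
      positivity
  have h := hmono ⟨ha, hab.trans hb⟩ ⟨ha.trans hab, hb⟩ hab
  simp only at h
  linarith

/-- `y ↦ -Li_{s+1}(-y)/y` is antitone for `s ≥ 1`. -/
theorem neg_liR_neg_div_antitone {s : ℝ} (hs : 1 ≤ s) {a b : ℝ} (ha : 0 < a) (hab : a ≤ b)
    (hb : b < 1) : -liR s (-b) / b ≤ -liR s (-a) / a := by
  have hs0 : 0 < s := by linarith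
  have hsumE : ∀ y : ℝ, 0 < y → y < 1 →
      HasSum (fun m : ℕ => (-1) ^ m * (y ^ m / ((m + 1 : ℕ) : ℝ) ^ (s + 1))) (-liR s (-y) / y) := by
    intro y h0 h1
    have h2 := ((summable_liR hs0 (y := -y) (by rw [abs_neg, abs_of_pos h0]; exact h1)).hasSum.mul_left
      (-1 / y))
    rw [show -liR s (-y) / y = -1 / y * liR s (-y) by ring]
    refine h2.congr_fun fun m => ?_
    rw [neg_pow y, pow_succ y, pow_succ (-1 : ℝ)]
    field_simp
  -- The constant terms cancel in the difference of the two series, leaving an alternating series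
  -- with these terms. It is nonnegative once they decrease.
  set u : ℕ → ℝ := fun m => (b ^ (m + 1) - a ^ (m + 1)) / ((m + 1 + 1 : ℕ) : ℝ) ^ (s + 1) with hu
  have hdiff := (hsumE a ha (hab.trans_lt hb)).sub (hsumE b (ha.trans_le hab) hb)
  have hdiff' : HasSum (fun m : ℕ => (-1) ^ m * u m) (-liR s (-a) / a - -liR s (-b) / b) := by
    have h1 := (hasSum_nat_add_iff' 1).2 hdiff
    simp only [Finset.range_one, Finset.sum_singleton, pow_zero, sub_self, sub_zero] at h1
    refine h1.congr_fun fun m => ?_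
    simp only [hu]
    ring
  have hanti : Antitone u := by
    refine antitone_nat_of_succ_le fun m => ?_
    have h1 := mul_pow_sub_pow_le ha.le hab hb.le (m + 1)
    have hm1 : (0 : ℝ) < ((m + 1 : ℕ) : ℝ) := by positivity
    have hΔ : 0 ≤ b ^ (m + 1) - a ^ (m + 1) := sub_nonneg.2 (by gcongr)
    simp only [hu]
    rw [div_le_div_iff₀ (by positivity) (by positivity)]
    -- Here `s ≥ 1` enters: the case `s = 1` is `(m+2)³ ≤ (m+1)(m+3)²`, and the remaining power `s -
    -- 1` is nonnegative.
    have h2 : ((m + 1 : ℕ) + 1 : ℝ) * ((m + 1 + 1 : ℕ) : ℝ) ^ (s + 1) ≤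
        ((m + 1 : ℕ) : ℝ) * ((m + 1 + 1 + 1 : ℕ) : ℝ) ^ (s + 1) := by
      have e : ∀ t : ℝ, 0 < t → t ^ (s + 1) = t ^ (2 : ℕ) * t ^ (s - 1) := by
        intro t ht
        rw [← Real.rpow_natCast, ← Real.rpow_add ht]
        congr 1
        push_cast
        ring
      rw [e _ (by positivity), e _ (by positivity), ← mul_assoc, ← mul_assoc]
      have h3 : ((m + 1 + 1 : ℕ) : ℝ) ^ (s - 1) ≤ ((m + 1 + 1 + 1 : ℕ) : ℝ) ^ (s - 1) :=
        Real.rpow_le_rpow (by positivity) (by push_cast; linarith) (by linarith)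
      refine mul_le_mul ?_ h3 (by positivity) (by positivity)
      push_cast
      have : (0 : ℝ) ≤ m := m.cast_nonneg
      nlinarith
    have hQ : 0 ≤ ((m + 1 + 1 : ℕ) : ℝ) ^ (s + 1) := by positivity
    refine le_of_mul_le_mul_left ?_ hm1
    calc ((m + 1 : ℕ) : ℝ) * ((b ^ (m + 1 + 1) - a ^ (m + 1 + 1)) * ((m + 1 + 1 : ℕ) : ℝ) ^ (s + 1))
        = (((m + 1 : ℕ) : ℝ) * (b ^ (m + 1 + 1) - a ^ (m + 1 + 1))) *
          ((m + 1 + 1 : ℕ) : ℝ) ^ (s + 1) := by ring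
      _ ≤ (((m + 1 : ℕ) + 1 : ℝ) * (b ^ (m + 1) - a ^ (m + 1))) *
          ((m + 1 + 1 : ℕ) : ℝ) ^ (s + 1) := by gcongr
      _ = (b ^ (m + 1) - a ^ (m + 1)) *
          (((m + 1 : ℕ) + 1 : ℝ) * ((m + 1 + 1 : ℕ) : ℝ) ^ (s + 1)) := by ring
      _ ≤ (b ^ (m + 1) - a ^ (m + 1)) *
          (((m + 1 : ℕ) : ℝ) * ((m + 1 + 1 + 1 : ℕ) : ℝ) ^ (s + 1)) := by gcongr
      _ = _ := by ring
  -- The empty even partial sum already bounds the limit from below by `0`.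
  have := hanti.alternating_series_le_tendsto hdiff'.tendsto_sum_nat 0
  simp only [mul_zero, Finset.range_zero, Finset.sum_empty] at this
  linarith

theorem liR_sq_div_lt {s : ℝ} (hs : 0 < s) {a b : ℝ} (ha : 0 < a) (hab : a < b) (hb : b < 1) :
    liR s (a ^ 2) / a < liR s (b ^ 2) / b := by
  have hb0 := ha.trans hab
  have hsum : ∀ y : ℝ, 0 < y → y < 1 →
      HasSum (fun m : ℕ => y ^ (2 * m + 1) / ((m + 1 : ℕ) : ℝ) ^ (s + 1)) (liR s (y ^ 2) / y) := by
    intro y h0 h1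
    have h2 := (summable_liR hs (y := y ^ 2) (by
      rw [abs_of_pos (by positivity)]; nlinarith)).hasSum.div_const y
    refine h2.congr_fun fun m => ?_
    rw [← pow_mul, show 2 * (m + 1) = 2 * m + 1 + 1 by ring, pow_succ _ (2 * m + 1)]
    field_simp
  refine hasSum_lt (i := 0) (fun m => ?_) ?_ (hsum a ha (hab.trans hb)) (hsum b hb0 hb)
  · gcongr
  · simpa using hab

/-- After division by `y`, the positive part of the sign function at `-y` increases strictly and the
part subtracted does not increase; a nonpositive value thus propagates towards `0`. -/
theorem phaseSign_neg_of_lt {s : ℝ} (hs : 1 ≤ s) {a b : ℝ} (ha : 0 < a) (hab : a < b) (hb : b < 1)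
    (h : phaseSign s (-b) ≤ 0) : phaseSign s (-a) < 0 := by
  have hs0 : 0 < s := by linarith
  have h1 := neg_liR_neg_div_antitone hs ha hab.le hb
  have h2 := liR_sq_div_lt hs0 ha hab hb
  have hκ := kappa_nonneg s
  have hb0 := ha.trans hab
  unfold phaseSign at h ⊢
  rw [neg_sq] at h ⊢
  have hc : (0 : ℝ) < 2 ^ (-(s + 1)) := by positivity
  have h3 : 2 ^ (-(s + 1)) * (liR s (b ^ 2) / b) ≤ kappa s * (-liR s (-b) / b) := by
    rw [← mul_div_assoc, ← mul_div_assoc]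
    exact div_le_div_of_nonneg_right (by linarith) hb0.le
  have h4 : 2 ^ (-(s + 1)) * (liR s (a ^ 2) / a) < kappa s * (-liR s (-a) / a) :=
    (mul_lt_mul_of_pos_left h2 hc).trans_le (h3.trans (mul_le_mul_of_nonneg_left h1 hκ))
  rw [← mul_div_assoc, ← mul_div_assoc, div_lt_div_iff_of_pos_right ha] at h4
  linarith

/-- For `s > 1` the angle `π/(s+1)` is below `π/2`, so `κ > 0`. Near `0` the `Li(y²)` part is
`O(y²)`, whereas the negative part is at least linear in `y`. -/
theorem exists_phaseSign_neg {s : ℝ} (hs : 1 < s) : ∃ y ∈ Ioo (0 : ℝ) 1, phaseSign s (-y) < 0 := by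
  have hs0 : 0 < s := by linarith
  have hκ : 0 < kappa s := by
    refine Real.rpow_pos_of_pos (lt_max_of_lt_right (Real.cos_pos_of_mem_Ioo ⟨?_, ?_⟩)) _
    · have : 0 < Real.pi / (s + 1) := by have := Real.pi_pos; positivity
      linarith [Real.pi_pos]
    · exact div_lt_div_of_pos_left Real.pi_pos two_pos (by linarith)
  set e := -liR s (-(1 / 2)) / (1 / 2) with he
  have he0 : 0 < e := by
    have := liR_neg_of_neg hs0 (x := -(1 / 2)) ⟨by norm_num, by norm_num⟩
    rw [he]
    have h1 : 0 < -liR s (-(1 / 2)) := by linarith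
    positivity
  -- Chosen so that `2y² < κ e y`; the cap `1/2` allows comparison with the quotient `e` taken at
  -- `1/2`.
  set y := min (1 / 2) (kappa s * e / 4) with hy
  have hy0 : 0 < y := lt_min (by norm_num) (by positivity)
  have hy2 : y ≤ 1 / 2 := min_le_left _ _
  have hy4 : y ≤ kappa s * e / 4 := min_le_right _ _
  refine ⟨y, ⟨hy0, by linarith⟩, ?_⟩
  have h1 := neg_liR_neg_div_antitone hs.le hy0 hy2 (by norm_num)
  rw [← he, le_div_iff₀ hy0] at h1
  have hysq : y ^ 2 ≤ 1 / 4 := by nlinarith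
  have h2 := liR_le_div hs0 (sq_nonneg y) (by linarith)
  have h3 : y ^ 2 / (1 - y ^ 2) ≤ 2 * y ^ 2 := by
    rw [div_le_iff₀ (by linarith)]
    nlinarith [sq_nonneg y]
  have hc1 : (2 : ℝ) ^ (-(s + 1)) ≤ 1 := Real.rpow_le_one_of_one_le_of_nonpos (by norm_num) (by linarith)
  have hc0 : (0 : ℝ) < 2 ^ (-(s + 1)) := by positivity
  have hl0 := liR_nonneg s (sq_nonneg y)
  unfold phaseSign
  rw [neg_sq]
  have h4 : 2 ^ (-(s + 1)) * liR s (y ^ 2) ≤ 2 * y ^ 2 := by nlinarith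
  have h5 : kappa s * (e * y) ≤ kappa s * -liR s (-y) := mul_le_mul_of_nonneg_left h1 hκ.le
  have h6 : 2 * y ^ 2 < kappa s * (e * y) := by
    have : 4 * y ≤ kappa s * e := by linarith
    nlinarith
  linarith

theorem continuousOn_phaseSign {s : ℝ} (hs : 0 < s) : ContinuousOn (phaseSign s) (Ioo (-1) 0) := by
  have h1 := continuousOn_liR_sq hs
  have h2 : ContinuousOn (liR s) (Ioo (-1) 0) :=
    (continuousOn_liR hs).mono (Ioo_subset_Ioo_right zero_le_one)
  unfold phaseSign
  fun_prop

/-- The transition point between the two phases. -/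
theorem exists_transition {s : ℝ} (hs : 0 < s) : ∃ xstar ∈ Icc (-1 : ℝ) 0, ∀ x ∈ Ioo (-1 : ℝ) 0,
    (phaseSign s x < 0 ↔ xstar < x) ∧ (0 < phaseSign s x ↔ x < xstar) := by
  -- For `s ≤ 1` the angle `π/(s+1)` is at least `π/2`, so `κ = 0` and the second arc wins on all of
  -- `(-1,0)`. Otherwise the infimum of the nonpositive set is the transition, possibly `-1`.
  rcases le_or_gt s 1 with hs1 | hs1
  · have hκ : kappa s = 0 := by
      have hc : Real.cos (Real.pi / (s + 1)) ≤ 0 := by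
        refine Real.cos_nonpos_of_pi_div_two_le_of_le ?_ ?_
        · exact div_le_div_of_nonneg_left Real.pi_pos.le (by linarith) (by linarith)
        · have : Real.pi / (s + 1) ≤ Real.pi := div_le_self Real.pi_pos.le (by linarith)
          linarith [Real.pi_pos]
      rw [kappa, max_eq_left hc, Real.zero_rpow (by linarith)]
    refine ⟨0, by simp, fun x hx => ?_⟩
    have hpos : 0 < phaseSign s x := by
      have := liR_pos hs (sq_mem_Ioo hx).1 (sq_mem_Ioo hx).2
      rw [phaseSign, hκ, mul_zero, add_zero]
      positivity
    exact ⟨⟨fun h => absurd h hpos.not_gt, fun h => absurd h hx.2.not_gt⟩, fun _ => hx.2, fun _ => hpos⟩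
  · set S : Set ℝ := {x | x ∈ Ioo (-1 : ℝ) 0 ∧ phaseSign s x ≤ 0} with hS
    obtain ⟨y, hy, hyneg⟩ := exists_phaseSign_neg hs1
    have hyS : -y ∈ S := ⟨⟨by linarith [hy.2], by linarith [hy.1]⟩, hyneg.le⟩
    have hbdd : BddBelow S := ⟨-1, fun x hx => hx.1.1.le⟩
    have hup : ∀ x ∈ S, ∀ x' : ℝ, x < x' → x' < 0 → phaseSign s x' < 0 := by
      intro x hx x' h1 h2
      have := phaseSign_neg_of_lt hs1.le (a := -x') (b := -x) (by linarith) (by linarith)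
        (by linarith [hx.1.1]) (by rw [neg_neg]; exact hx.2)
      rwa [neg_neg] at this
    have hgt : ∀ x ∈ Ioo (-1 : ℝ) 0, sInf S < x → phaseSign s x < 0 := by
      intro x hx h
      obtain ⟨x', hx', hlt⟩ := exists_lt_of_csInf_lt ⟨_, hyS⟩ h
      exact hup x' hx' x hlt hx.2
    have hlt : ∀ x ∈ Ioo (-1 : ℝ) 0, x < sInf S → 0 < phaseSign s x := by
      intro x hx h
      by_contra hcon
      exact absurd (csInf_le hbdd ⟨hx, not_lt.1 hcon⟩) (not_le.2 h)
    -- At an interior transition the one-sided limits force the value `0`, so neither strict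
    -- inequality holds there.
    have heq : ∀ x ∈ Ioo (-1 : ℝ) 0, x = sInf S → phaseSign s x = 0 := by
      intro x hx h
      have hc : ContinuousAt (phaseSign s) x :=
        (continuousOn_phaseSign hs).continuousAt (Ioo_mem_nhds hx.1 hx.2)
      refine le_antisymm ?_ ?_
      · refine le_of_tendsto (hc.tendsto.mono_left (nhdsWithin_le_nhds (s := Ioi x))) ?_
        filter_upwards [Ioo_mem_nhdsGT hx.2] with x' hx'
        exact (hgt x' ⟨hx.1.trans hx'.1, hx'.2⟩ (h ▸ hx'.1)).le
      · refine ge_of_tendsto (hc.tendsto.mono_left (nhdsWithin_le_nhds (s := Iio x))) ?_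
        filter_upwards [Ioo_mem_nhdsLT hx.1] with x' hx'
        exact (hlt x' ⟨hx'.1, hx'.2.trans hx.2⟩ (h ▸ hx'.2)).le
    refine ⟨sInf S, ⟨le_csInf ⟨_, hyS⟩ fun x hx => hx.1.1.le,
      (csInf_le hbdd hyS).trans (by linarith [hy.1])⟩, fun x hx => ?_⟩
    rcases lt_trichotomy x (sInf S) with h | h | h
    · have := hlt x hx h
      exact ⟨⟨fun h' => absurd h' this.not_gt, fun h' => absurd h' h.not_gt⟩, fun _ => h, fun _ => this⟩
    · have := heq x hx h
      rw [this]
      exact ⟨⟨fun h' => absurd h' (lt_irrefl _), fun h' => absurd h' (h ▸ lt_irrefl _)⟩,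
        fun h' => absurd h' (lt_irrefl _), fun h' => absurd h' (h ▸ lt_irrefl _)⟩
    · have := hgt x hx h
      exact ⟨⟨fun _ => h, fun _ => this⟩, fun h' => absurd h' this.not_gt, fun h' => absurd h' h.not_gt⟩

/-! ### The two phases. -/

theorem abs_lt_one_of_neg {x : ℝ} (hx : x ∈ Ioo (-1 : ℝ) 0) : |x| < 1 :=
  abs_lt.2 ⟨hx.1, hx.2.trans one_pos⟩

theorem arcBase_zero (s : ℝ) {k : ℕ} (hk : 0 < k) : arcBase s k 0 = 0 := by
  have : liR s 0 = 0 := by simp [liR]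
  rw [arcBase, zero_pow hk.ne', this, mul_zero, mul_zero]

/-- The real parts of `L_{1,1}` and `L_{1,2}` are not identical. -/
theorem re_arcL_half_lt {s : ℝ} (hs : 0 < s) :
    (arcL (powerSeq s) s 1 2 ((1 / 2 : ℝ) : ℂ)).re < (arcL (powerSeq s) s 1 1 ((1 / 2 : ℝ) : ℂ)).re := by
  have hh : |(1 / 2 : ℝ)| < 1 := by rw [abs_of_pos] <;> norm_num
  rw [re_arcL_eq hs two_pos (by norm_num) hh, re_arcL_eq hs one_pos (by norm_num) hh]
  exact arcBase_rpow_lt_of_pos hs ⟨by norm_num, by norm_num⟩ le_rfl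

theorem half_mem_realDisk : ((1 / 2 : ℝ) : ℂ) ∈ realDisk :=
  ⟨1 / 2, ⟨by norm_num, by norm_num⟩, rfl⟩

/-- One inclusion needs only the competitor `k = 2`, and `x = 0` drops out because both roots vanish
there. Conversely, all arcs with `k = 1` form one class, and on the negative side `k ≥ 3` is beaten
through `k = 2`. -/
theorem phase_one_one {s xstar : ℝ} (hs : 0 < s) (hmem : xstar ∈ Icc (-1 : ℝ) 0)
    (hx : ∀ x ∈ Ioo (-1 : ℝ) 0, phaseSign s x < 0 ↔ xstar < x) :
    phase (powerSeq s) s realDisk 1 1 = (fun x : ℝ => (x : ℂ)) '' (Ioo 0 1 ∪ Ioo xstar 0) := by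
  apply Subset.antisymm
  · rintro z ⟨⟨x, hxD, rfl⟩, hz⟩
    refine ⟨x, ?_, rfl⟩
    have hxa : |x| < 1 := abs_lt.2 hxD
    have h := hz 1 2 one_pos one_le_two (by norm_num) (fun hid =>
      (re_arcL_half_lt hs).ne (hid _ half_mem_realDisk))
    simp only at h
    rw [re_arcL_eq hs two_pos (by norm_num) hxa, re_arcL_eq hs one_pos (by norm_num) hxa] at h
    rcases lt_trichotomy x 0 with h0 | h0 | h0
    · exact Or.inr ⟨(hx x ⟨hxD.1, h0⟩).1 ((arcBase_lt_iff_phaseSign_neg hs ⟨hxD.1, h0⟩).1 h), h0⟩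
    · rw [h0, arcBase_zero s two_pos, arcBase_zero s one_pos] at h
      exact absurd h (lt_irrefl _)
    · exact Or.inl ⟨h0, hxD.2⟩
  · rintro z ⟨x, hxU, rfl⟩
    have hxD : x ∈ Ioo (-1 : ℝ) 1 := by
      rcases hxU with h | h
      · exact ⟨by linarith [h.1], h.2⟩
      · exact ⟨lt_of_le_of_lt hmem.1 h.1, h.2.trans one_pos⟩
    have hxa : |x| < 1 := abs_lt.2 hxD
    refine ⟨⟨x, hxD, rfl⟩, fun h k h0 hk hc hne => ?_⟩
    have hk0 : 0 < k := h0.trans_le hk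
    have hk1 : k ≠ 1 := by
      rintro rfl
      refine hne ?_
      rintro u ⟨y, hy, rfl⟩
      rw [re_arcL_eq hs one_pos hc (abs_lt.2 hy), re_arcL_eq hs one_pos (by norm_num) (abs_lt.2 hy)]
    simp only
    rw [re_arcL_eq hs hk0 hc hxa, re_arcL_eq hs one_pos (by norm_num) hxa]
    rcases hxU with hU | hU
    · exact arcBase_rpow_lt_of_pos hs hU (by omega)
    · have hxI : x ∈ Ioo (-1 : ℝ) 0 := ⟨hxD.1, hU.2⟩
      have h12 := (arcBase_lt_iff_phaseSign_neg hs hxI).2 ((hx x hxI).2 hU.1)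
      rcases eq_or_ne k 2 with rfl | hk2
      · exact h12
      · exact (arcBase_rpow_lt_of_neg hs hxI (by omega)).trans h12

theorem phase_one_two {s xstar : ℝ} (hs : 0 < s) (hmem : xstar ∈ Icc (-1 : ℝ) 0)
    (hx : ∀ x ∈ Ioo (-1 : ℝ) 0, 0 < phaseSign s x ↔ x < xstar) :
    phase (powerSeq s) s realDisk 1 2 = (fun x : ℝ => (x : ℂ)) '' (Ioo (-1) xstar) := by
  apply Subset.antisymm
  · rintro z ⟨⟨x, hxD, rfl⟩, hz⟩
    refine ⟨x, ?_, rfl⟩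
    have hxa : |x| < 1 := abs_lt.2 hxD
    have h := hz 1 1 one_pos le_rfl (by norm_num) (fun hid =>
      (re_arcL_half_lt hs).ne (hid _ half_mem_realDisk).symm)
    simp only at h
    rw [re_arcL_eq hs two_pos (by norm_num) hxa, re_arcL_eq hs one_pos (by norm_num) hxa] at h
    rcases lt_trichotomy x 0 with h0 | h0 | h0
    · exact ⟨hxD.1, (hx x ⟨hxD.1, h0⟩).1 ((arcBase_lt_iff_phaseSign_pos hs ⟨hxD.1, h0⟩).1 h)⟩
    · rw [h0, arcBase_zero s two_pos, arcBase_zero s one_pos] at h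
      exact absurd h (lt_irrefl _)
    · exact absurd h (arcBase_rpow_lt_of_pos hs ⟨h0, hxD.2⟩ le_rfl).not_gt
  · rintro z ⟨x, hxU, rfl⟩
    have hxI : x ∈ Ioo (-1 : ℝ) 0 := ⟨hxU.1, hxU.2.trans_le hmem.2⟩
    have hxa : |x| < 1 := abs_lt_one_of_neg hxI
    refine ⟨⟨x, abs_lt.1 hxa, rfl⟩, fun h k h0 hk hc hne => ?_⟩
    have hk0 : 0 < k := h0.trans_le hk
    have hk2 : k ≠ 2 := by
      rintro rfl
      refine hne ?_
      rintro u ⟨y, hy, rfl⟩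
      rw [re_arcL_eq hs two_pos hc (abs_lt.2 hy), re_arcL_eq hs two_pos (by norm_num) (abs_lt.2 hy)]
    simp only
    rw [re_arcL_eq hs hk0 hc hxa, re_arcL_eq hs two_pos (by norm_num) hxa]
    rcases eq_or_ne k 1 with rfl | hk1
    · exact (arcBase_lt_iff_phaseSign_pos hs hxI).2 ((hx x hxI).2 hxU.2)
    · exact arcBase_rpow_lt_of_neg hs hxI (by omega)

end PolyMeinardus

end

theorem mainTheorem4 (s₀ : ℝ) (hs₀ : 0 < s₀) :
    ∃ xstar ∈ Set.Icc (-1 : ℝ) 0,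
      PolyMeinardus.phase (PolyMeinardus.powerSeq s₀) s₀ PolyMeinardus.realDisk 1 1 =
        (fun x : ℝ => (x : ℂ)) '' (Set.Ioo 0 1 ∪ Set.Ioo xstar 0) ∧
      PolyMeinardus.phase (PolyMeinardus.powerSeq s₀) s₀ PolyMeinardus.realDisk 1 2 =
        (fun x : ℝ => (x : ℂ)) '' (Set.Ioo (-1) xstar) ∧
      (∀ x ∈ Set.Ioo (-1 : ℝ) 1,
        PolyMeinardus.arcL (PolyMeinardus.powerSeq s₀) s₀ 1 2 (x : ℂ) =
          PolyMeinardus.explicitL s₀ x) ∧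
      ∀ X : Set ℝ, IsCompact X → X ⊆ Set.Ioo (-1) xstar →
        ∀ ε : ℝ, 0 < ε → ∀ᶠ n : ℕ in Filter.atTop, ∀ x ∈ X,
          ‖PolyMeinardus.coeffQ (PolyMeinardus.powerSeq s₀) n (x : ℂ) -
              PolyMeinardus.mainTerm s₀ n x‖ ≤ ε * ‖PolyMeinardus.mainTerm s₀ n x‖ := by
  obtain ⟨xstar, hmem, hx⟩ := PolyMeinardus.exists_transition hs₀
  refine ⟨xstar, hmem, PolyMeinardus.phase_one_one hs₀ hmem fun x h => (hx x h).1,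
    PolyMeinardus.phase_one_two hs₀ hmem fun x h => (hx x h).2,
    fun x h => PolyMeinardus.arcL_one_two hs₀ (abs_lt.2 h), fun X hX hsub ε hε => ?_⟩
  have hsub' : X ⊆ Set.Ioo (-1 : ℝ) 0 := hsub.trans (Set.Ioo_subset_Ioo_right hmem.2)
  refine PolyMeinardus.coeffQ_asymptotic hs₀ hX hsub' (fun x h => ?_) hε
  -- Membership in the phase is exactly the dominance over the arc at `1` that the circle method
  -- requires.
  have := (hx x (hsub' h)).2.2 (hsub h).2
  unfold PolyMeinardus.phaseSign at this
  linarith
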